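/- **Setting.** Let $(\Omega,\mathcal F,\mathbb P)$ be a probability space, $\alpha\in(0,1)$, and let $Y\in\mathbb R^d$ and $Z\in\mathbb R^q$ be independent random vectors. Let $\varphi:\mathbb R^d\times\mathbb R^q\to\mathbb R$ be measurable with $\mathbb E[|\varphi(Y,Z)|^{2+\delta}]<\infty$ for some $\delta>0$. Put $\mathcal H=\{1/K: K\in\mathbb N, K\ge1\}$, $X_0=\mathbb E[\varphi(Y,Z)\mid Y]$ and, for $h=1/K\in\mathcal H$, $X_h=\frac1K\sum_{k=1}^K\varphi(Y,Z^{(k)})$, where $Z^{(1)},Z^{(2)},\dots$ are i.i.d. copies of $Z$ and the sequence is independent of $Y$. For $h\in\mathcal H\cup\{0\}$ let $F_{X_h}$ be the distribution function of $X_h$ and $V_h(\xi)=\xi+\frac1{1-\alpha}\mathbb E[(X_h-\xi)^+]$. Let $\mathrm{VaR}_a(X_0)=\inf\{\xi:\mathbb P(X_0\le\xi)\ge a\}$, $\xi^0_\star=\mathrm{VaR}_\alpha(X_0)$ and $\chi^0_\star=\frac1{1-\alpha}\int_\alpha^1\mathrm{VaR}_a(X_0)\,\mathrm da$; for $h\in\mathcal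 H$ let $\xi^h_\star$ be a minimiser of $V_h$ and $\chi^h_\star=\min V_h=V_h(\xi^h_\star)$. **Assumptions on the laws.** 1. There are functions $v$ and $w(\cdot,h)$ on $\mathbb R$ with $F_{X_h}(\xi)-F_{X_0}(\xi)=v(\xi)h+w(\xi,h)h$ for all $\xi\in\mathbb R$, $h\in\mathcal H$, such that, for every minimiser $\xi_0$ of $V_0$, $v$ is integrable on $(\xi_0,\infty)$ and $w(\xi_0,h)\to0$, $\int_{\xi_0}^\infty w(\xi,h)\,\mathrm d\xi\to0$ as $\mathcal H\ni h\downarrow0$. 2. For every $h\in\mathcal H\cup\{0\}$, $X_h$ has a continuous density $f_{X_h}$, and $f_{X_h}\to f_{X_0}$ locally uniformly as $\mathcal H\ni h\downarrow0$. 3. For every $R>0$, $\inf\{f_{X_h}(\xi): h\in\mathcal H\cup\{0\},\ |\xi-\xi^0_\star|<R\}>0$. 4. $\sup_{h\in\mathcal H\cup\{0\}}(\|f_{X_h}\|_\infty+[f_{X_h}]_{\mathrm{Lip}})<\infty$, where $[g]_{\mathrm{Lip}}$ is the Lipschitz constant of $g$. **Algorithm.** Let $\gamma_n=\gamma_1n^{-\beta}$,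 $n\ge1$, with $\gamma_1>0$ and $\beta\in(\frac12,1]$. For each $h\in\mathcal H$ let $(X_h^{(n)})_{n\ge1}$ be i.i.d. copies of $X_h$, let $\xi^h_0$ be a real random variable independent of them, let $\chi^h_0=0$ and, for $n\ge0$, $$\xi^h_{n+1}=\xi^h_n-\gamma_{n+1}\Big(1-\tfrac1{1-\alpha}\mathbf 1_{X_h^{(n+1)}\ge\xi^h_n}\Big),\qquad \chi^h_{n+1}=\chi^h_n-\tfrac1{n+1}\Big(\chi^h_n-\xi^h_n-\tfrac1{1-\alpha}\big(X_h^{(n+1)}-\xi^h_n\big)^+\Big).$$ Assume that, with $c_\alpha=\max(1,\frac\alpha{1-\alpha})$, $$\sup_{h\in\mathcal H}\mathbb E\Big[|\xi^h_0|^2\exp\Big(\tfrac4{1-\alpha}\,c_\alpha\,\sup_{h'\in\mathcal H}\|f_{X_{h'}}\|_\infty\,|\xi^h_0|\Big)\Big]<\infty .$$ If $\beta=1$, assume moreover that $\lambda\gamma_1>1$, where $$\lambda=\inf_{h\in\mathcal H\cup\{0\}}\min\Big(\tfrac38V_h''(\xi^h_\star),\ \|V_h''\|_\infty\frac{V_h''(\xi^h_\star)^4}{4[V_h'']_{\mathrm{Lip}}^2}\Big).$$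 **Theorem.** Under these assumptions the matrix $$\Sigma_\beta=\begin{pmatrix}\dfrac{\alpha\gamma_1}{2f_{X_0}(\xi^0_\star)-\gamma_1^{-1}(1-\alpha)\mathbf 1_{\beta=1}}&\alpha\dfrac{\chi^0_\star-\xi^0_\star}{f_{X_0}(\xi^0_\star)}\mathbf 1_{\beta=1}\\[2ex]\alpha\dfrac{\chi^0_\star-\xi^0_\star}{f_{X_0}(\xi^0_\star)}\mathbf 1_{\beta=1}&\dfrac{\mathrm{Var}((X_0-\xi^0_\star)^+)}{(1-\alpha)^2}\end{pmatrix}$$ is positive semidefinite and $$\begin{pmatrix}h^{-\beta}\big(\xi^h_{\lceil h^{-2}\rceil}-\xi^h_\star\big)\\ h^{-1}\big(\chi^h_{\lceil h^{-2}\rceil}-\chi^h_\star\big)\end{pmatrix}\xrightarrow{\ \mathcal L\ }\mathcal N(0,\Sigma_\beta)\qquad\text{as }\mathcal H\ni h\downarrow0 .$$ -/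

import Mathlib

open MeasureTheory ProbabilityTheory Filter Topology

noncomputable section

namespace NestedSA

variable {Ω : Type*} [MeasurableSpace Ω]

/-- The bias parameter `h = 1 / K` of the set `H = {1 / K : K ≥ 1}`. The limit `h ↓ 0` along `H` is
the limit `K → ∞`. -/
def bias (K : ℕ+) : ℝ := 1 / (K : ℝ)

/-- The losses `X_h` for `h ∈ H ∪ {0}`. The index `none` stands for `h = 0` and gives
`X_0 = E[φ(Y, Z) | Y]`; the index `some K` stands for `h = 1 / K` and gives the empirical mean of
`φ(Y, Z⁽¹⁾), …, φ(Y, Z⁽ᴷ⁾)`, where `Z⁽ᵏ⁾ = Zs (k - 1)`. -/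
def loss {E F : Type*} [mE : MeasurableSpace E] (P : Measure Ω)
    (φ : E × F → ℝ) (Y : Ω → E) (Z : Ω → F) (Zs : ℕ → Ω → F) : Option ℕ+ → Ω → ℝ
  | none => P[fun ω => φ (Y ω, Z ω) | MeasurableSpace.comap Y mE]
  | some K => fun ω => 1 / (K : ℝ) * ∑ k ∈ Finset.range (K : ℕ), φ (Y ω, Zs k ω)

/-- The cumulative distribution function of a random variable. -/
def cdfOf (P : Measure Ω) (X : Ω → ℝ) (ξ : ℝ) : ℝ := P.real {ω | X ω ≤ ξ}

/-- Value-at-risk at level `a`. -/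
def VaR (P : Measure Ω) (a : ℝ) (X : Ω → ℝ) : ℝ := sInf {ξ : ℝ | a ≤ cdfOf P X ξ}

/-- Expected shortfall at level `α`. -/
def ES (P : Measure Ω) (α : ℝ) (X : Ω → ℝ) : ℝ := 1 / (1 - α) * ∫ a in α..1, VaR P a X

/-- The objective `V(ξ) = ξ + E[(X - ξ)⁺] / (1 - α)`. -/
def V (P : Measure Ω) (α : ℝ) (X : Ω → ℝ) (ξ : ℝ) : ℝ :=
  ξ + 1 / (1 - α) * ∫ ω, max (X ω - ξ) 0 ∂P

/-- The uniform norm of a bounded function. -/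
def supNorm (g : ℝ → ℝ) : ℝ := ⨆ x, |g x|

/-- The (least) Lipschitz constant of a Lipschitz function. -/
def lipConst (g : ℝ → ℝ) : ℝ := sInf {C : ℝ | 0 ≤ C ∧ ∀ x y, |g x - g y| ≤ C * |x - y|}

/-- `f` is a continuous density with respect to Lebesgue measure of the law of `X`. -/
structure IsContinuousPdf (P : Measure Ω) (X : Ω → ℝ) (f : ℝ → ℝ) : Prop where
  continuous : Continuous f
  nonneg : ∀ x, 0 ≤ f x
  map_eq : P.map X = volume.withDensity fun x => ENNReal.ofReal (f x)

/-- `Y` and `Z` are independent, the `Zs k` are i.i.d. copies of `Z`, and the whole sequence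
`Zs` is independent of `Y`. -/
structure IsSampling {E F : Type*} [MeasurableSpace E] [MeasurableSpace F] (P : Measure Ω)
    (Y : Ω → E) (Z : Ω → F) (Zs : ℕ → Ω → F) : Prop where
  measurable_Y : Measurable Y
  measurable_Z : Measurable Z
  indep_YZ : IndepFun Y Z P
  measurable_Zs : ∀ k, Measurable (Zs k)
  identDistrib_Zs : ∀ k, IdentDistrib (Zs k) Z P P
  indep_Zs : iIndepFun Zs P
  indep_Y_Zs : IndepFun Y (fun ω k => Zs k ω) P

/-- Regularity of the laws of the losses `X i`, `i ∈ H ∪ {0}`: first order expansion of the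
distribution functions in `h`, and continuous densities `f i` that converge locally uniformly, are
locally bounded from below around the value-at-risk of `X_0`, and are bounded and Lipschitz,
all uniformly in `i`. -/
structure Regularity (P : Measure Ω) (α : ℝ) (X : Option ℕ+ → Ω → ℝ) (f : Option ℕ+ → ℝ → ℝ)
    (v : ℝ → ℝ) (w : ℝ → ℝ → ℝ) : Prop where
  expansion : ∀ (K : ℕ+) (ξ : ℝ),
    cdfOf P (X (some K)) ξ - cdfOf P (X none) ξ = v ξ * bias K + w ξ (bias K) * bias K
  integrable_v : ∀ ξ₀ : ℝ, IsMinOn (V P α (X none)) Set.univ ξ₀ → IntegrableOn v (Set.Ioi ξ₀)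
  tendsto_w : ∀ ξ₀ : ℝ, IsMinOn (V P α (X none)) Set.univ ξ₀ →
    Tendsto (fun K : ℕ+ => w ξ₀ (bias K)) atTop (𝓝 0)
  tendsto_integral_w : ∀ ξ₀ : ℝ, IsMinOn (V P α (X none)) Set.univ ξ₀ →
    Tendsto (fun K : ℕ+ => ∫ ξ in Set.Ioi ξ₀, w ξ (bias K)) atTop (𝓝 0)
  pdf : ∀ i, IsContinuousPdf P (X i) (f i)
  tendsto_pdf : TendstoLocallyUniformly (fun K : ℕ+ => f (some K)) (f none) atTop
  pdf_lower : ∀ R > 0, ∃ c > 0, ∀ i, ∀ ξ ∈ Metric.ball (VaR P α (X none)) R, c ≤ f i ξ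
  pdf_bounded : ∃ C : ℝ, ∀ i x, |f i x| ≤ C
  pdf_lipschitz : ∃ C : ℝ, ∀ i x y, |f i x - f i y| ≤ C * |x - y|

/-- The exponential moment condition
`sup_h E[|ξ₀ʰ|² exp(4 / (1 - α) · c_α · sup_h ‖f_{X_h}‖_∞ · |ξ₀ʰ|)] < ∞`, with
`c_α = max(1, α / (1 - α))` and both suprema over `h ∈ H`. -/
def InitialMoment (P : Measure Ω) (α : ℝ) (f : Option ℕ+ → ℝ → ℝ) (ξ₀ : ℕ+ → Ω → ℝ) : Prop :=
  (⨆ K : ℕ+, ∫⁻ ω, ENNReal.ofReal (|ξ₀ K ω| ^ 2 *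
    Real.exp (4 / (1 - α) * max 1 (α / (1 - α)) * (⨆ L : ℕ+, supNorm (f (some L))) * |ξ₀ K ω|))
      ∂P) < ⊤

/-- The constant
`λ = inf_{h ∈ H ∪ {0}} min(3/8 V_h''(ξ_⋆ʰ), ‖V_h''‖_∞ V_h''(ξ_⋆ʰ)⁴ / (4 [V_h'']_Lip²))`. -/
def lam (P : Measure Ω) (α : ℝ) (X : Option ℕ+ → Ω → ℝ) (ξs : Option ℕ+ → ℝ) : ℝ :=
  ⨅ i : Option ℕ+,
    min (3 / 8 * deriv (deriv (V P α (X i))) (ξs i))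
      (supNorm (deriv (deriv (V P α (X i)))) *
        (deriv (deriv (V P α (X i))) (ξs i) ^ 4 /
          (4 * lipConst (deriv (deriv (V P α (X i)))) ^ 2)))

/-- The learning rate `γ_n = γ₁ n^{-β}`. -/
def stepSize (γ₁ β : ℝ) (n : ℕ) : ℝ := γ₁ * (n : ℝ) ^ (-β)

open Classical in
/-- `H₁(ξ, x) = 1 - 𝟙_{x ≥ ξ} / (1 - α)`. -/
def H₁ (α ξ x : ℝ) : ℝ := 1 - 1 / (1 - α) * (if ξ ≤ x then 1 else 0)

/-- `H₂(ξ, χ, x) = χ - (ξ + (x - ξ)⁺ / (1 - α))`. -/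
def H₂ (α ξ χ x : ℝ) : ℝ := χ - (ξ + 1 / (1 - α) * max (x - ξ) 0)

/-- The iterates `(ξ_n, χ_n)` of nested stochastic approximation with learning rate `γ`, started
from `(ξ₀, 0)` and driven by the innovations `x`, where `x n` is the innovation used
in the step from `n` to `n + 1`. -/
def iterate (α : ℝ) (γ : ℕ → ℝ) (ξ₀ : ℝ) (x : ℕ → ℝ) : ℕ → ℝ × ℝ
  | 0 => (ξ₀, 0)
  | n + 1 =>
    let p := iterate α γ ξ₀ x n
    (p.1 - γ (n + 1) * H₁ α p.1 (x n), p.2 - 1 / ((n : ℝ) + 1) * H₂ α p.1 p.2 (x n))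

/-- For each `h = 1 / K`, the innovations `Xs K n`, `n ≥ 0`, are i.i.d. copies of `X_h`, independent
of the starting point `ξ₀ K`. -/
structure IsInnovation (P : Measure Ω) (X : Option ℕ+ → Ω → ℝ) (ξ₀ : ℕ+ → Ω → ℝ)
    (Xs : ℕ+ → ℕ → Ω → ℝ) : Prop where
  measurable_init : ∀ K, Measurable (ξ₀ K)
  measurable : ∀ K n, Measurable (Xs K n)
  identDistrib : ∀ K n, IdentDistrib (Xs K n) (X (some K)) P P
  indep : ∀ K, iIndepFun (Xs K) P
  indep_init : ∀ K, IndepFun (ξ₀ K) (fun ω n => Xs K n ω) P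

/-- The iterate after `⌈h⁻²⌉` steps with bias parameter `h = 1 / K`. -/
def finalIterate (α γ₁ β : ℝ) (ξ₀ : ℕ+ → Ω → ℝ) (Xs : ℕ+ → ℕ → Ω → ℝ) (K : ℕ+) (ω : Ω) : ℝ × ℝ :=
  iterate α (stepSize γ₁ β) (ξ₀ K ω) (fun n => Xs K n ω) ⌈bias K ^ (-2 : ℤ)⌉₊

/-- The rescaled statistical error `(h^{-β} (ξʰ - ξ_⋆ʰ), h⁻¹ (χʰ - χ_⋆ʰ))` after `⌈h⁻²⌉` steps,
where `χ_⋆ʰ = min V_h` is the value of `V_h` at its minimiser `ξ_⋆ʰ`. -/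
def rescaledError (P : Measure Ω) (α γ₁ β : ℝ) (X : Option ℕ+ → Ω → ℝ) (ξs : Option ℕ+ → ℝ)
    (ξ₀ : ℕ+ → Ω → ℝ) (Xs : ℕ+ → ℕ → Ω → ℝ) (K : ℕ+) (ω : Ω) : EuclideanSpace ℝ (Fin 2) :=
  !₂[bias K ^ (-β) * ((finalIterate α γ₁ β ξ₀ Xs K ω).1 - ξs (some K)),
    (bias K)⁻¹ * ((finalIterate α γ₁ β ξ₀ Xs K ω).2 - V P α (X (some K)) (ξs (some K)))]

open Classical in
/-- The limiting covariance matrix `Σ_β`, for the loss `X = X_0` with density `f`. -/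
def limitCov (P : Measure Ω) (α γ₁ β : ℝ) (X : Ω → ℝ) (f : ℝ → ℝ) : Matrix (Fin 2) (Fin 2) ℝ :=
  let ξ := VaR P α X
  let χ := ES P α X
  let e : ℝ := if β = 1 then 1 else 0
  !![α * γ₁ / (2 * f ξ - γ₁⁻¹ * (1 - α) * e), α * ((χ - ξ) / f ξ) * e;
    α * ((χ - ξ) / f ξ) * e, Var[fun ω => max (X ω - ξ) 0; P] / (1 - α) ^ 2]

end NestedSA

end

open NestedSA

/-!
The number of steps is `n = K²` for the bias parameter `h = 1 / K`, and all estimates are uniform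
over the recursions that belong to the different `K`.

For a fixed `K` let `m` be the minimiser of `V_h`, `a = V_h''(m) = f_{X_h}(m) / (1 - α)`, and let
`e k` be the error of the quantile recursion after `k` steps. The product of `e` and its drift
`(F_{X_h}(m + e) - α) / (1 - α)` is at least a multiple of `min (e ^ 2) |e|`, so the error enters every neighbourhood of `0`
with high probability and stays there (`IsErrorProcess`), and from then on its second moment is
of the order of the step size. Since the drift is linear up to a quadratic term and the noise at the
error `e` differs from the noise at `0` by a term of variance `O(|e|)`, the error is
`∑ k < n, weight n k * H₁ m (X k)` up to `o(√γ_n)` in probability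
(`IsErrorProcess.exists_linearisation`). The second component is an exact average of the increments
`-H₂` along the path. The mean of the increment is stationary at the minimiser, and so replacing the
path by `m` costs a drift of `∑ k < n, O(γ_k) = o(√n)` and a martingale of variance `o(n)`
(`IsErrorProcess.exists_sum_sub_le`).

After this reduction both components are sums of independent terms with explicit deterministic
weights, and no martingale limit theorem is needed: Lyapunov's condition for triangular arrays
(`tendsto_integral_cexp_weighted`) gives convergence of the characteristic functions. The limiting
covariance comes from the asymptotics of `∑ weight ^ 2` and `∑ weight`
(`tendsto_sum_weight_sq`, `tendsto_sum_weight`), where the critical case `β = 1` contributes the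
extra terms, and from the convergence of the quantiles, densities and second moments of the two
increments as `h ↓ 0` (`ConvergingLaws`). The latter follows from the convergence of the densities and
the uniform bound on the moments of order `2 + δ`, which the losses inherit from `φ(Y, Z)` by
Jensen's inequality. The matrix is positive semidefinite since its quadratic form is a limit of
variances. Lévy's continuity theorem and Slutsky's lemma conclude.
-/

namespace NestedSA

/-! ### Contracting scalar recursions -/

/-- Discrete Grönwall argument: if `Σ g = ∞` and `g n → 0`, then
`x (n + 1) ≤ (1 - c * g n) * x n + g n * η n` with `η → 0` forces `x` below every positive level,
at a time that depends on the initial bound but not on `x`. -/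
lemma exists_forall_le_of_contraction {g η : ℕ → ℝ} {c : ℝ} (hc : 0 < c) (hg : ∀ n, 0 ≤ g n)
    (hgs : Tendsto (fun n => ∑ i ∈ Finset.range n, g i) atTop atTop)
    (hη : Tendsto η atTop (𝓝 0)) (N₀ : ℕ) (hN₀ : ∀ n, N₀ ≤ n → c * g n ≤ 1) (C : ℝ)
    {ε : ℝ} (hε : 0 < ε) :
    ∃ N, ∀ x : ℕ → ℝ, x N₀ ≤ C → (∀ n, N₀ ≤ n → x (n + 1) ≤ (1 - c * g n) * x n + g n * η n) →
      ∀ n, N ≤ n → x n ≤ ε := by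
  have hev : ∀ᶠ n in atTop, η n ≤ c * (ε / 2) :=
    hη.eventually (ge_mem_nhds (by positivity))
  obtain ⟨N₁', hN₁'⟩ := eventually_atTop.1 hev
  set N₁ := max N₀ N₁' with hN₁
  -- a bound at time `N₁` valid for all admissible sequences
  have hbd : ∀ m, N₀ ≤ m → ∃ D : ℝ, 0 ≤ D ∧ ∀ x : ℕ → ℝ, x N₀ ≤ C →
      (∀ n, N₀ ≤ n → x (n + 1) ≤ (1 - c * g n) * x n + g n * η n) → x m ≤ D := by
    intro m hm
    induction m, hm using Nat.le_induction with
    | base => exact ⟨max C 0, le_max_right _ _, fun x hx _ => hx.trans (le_max_left _ _)⟩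
    | succ m hm ih =>
      obtain ⟨D, hD0, hD⟩ := ih
      have h1 : 0 ≤ 1 - c * g m := by linarith [hN₀ m hm]
      refine ⟨(1 - c * g m) * D + g m * |η m|, by have := hg m; positivity, fun x hx hr => ?_⟩
      refine (hr m hm).trans (add_le_add (mul_le_mul_of_nonneg_left (hD x hx hr) h1) ?_)
      exact mul_le_mul_of_nonneg_left (le_abs_self _) (hg m)
  obtain ⟨D, hD0, hD⟩ := hbd N₁ (le_max_left _ _)
  set S : ℕ → ℝ := fun n => ∑ i ∈ Finset.range n, g i with hS
  have hlim : Tendsto (fun n => Real.exp (-(c * (S n - S N₁))) * D) atTop (𝓝 0) := by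
    have : Tendsto (fun n => c * (S n - S N₁)) atTop atTop :=
      Tendsto.const_mul_atTop hc (tendsto_atTop_add_const_right _ _ hgs)
    simpa using (Real.tendsto_exp_neg_atTop_nhds_zero.comp this).mul_const D
  obtain ⟨N₂, hN₂⟩ := eventually_atTop.1 (hlim.eventually (ge_mem_nhds (half_pos hε)))
  refine ⟨max N₁ N₂, fun x hx hr n hn => ?_⟩
  have key : ∀ n, N₁ ≤ n → x n - ε / 2 ≤ Real.exp (-(c * (S n - S N₁))) * D := by
    intro n hn
    induction n, hn using Nat.le_induction with
    | base => have := hD x hx hr; simp; linarith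
    | succ n hn ih =>
      have hn0 : N₀ ≤ n := (le_max_left _ _).trans hn
      have h1 : 0 ≤ 1 - c * g n := by linarith [hN₀ n hn0]
      have h2 := hr n hn0
      have h3 : g n * η n ≤ g n * (c * (ε / 2)) :=
        mul_le_mul_of_nonneg_left (hN₁' n ((le_max_right _ _).trans hn)) (hg n)
      have h4 : 1 - c * g n ≤ Real.exp (-(c * g n)) := by
        have := Real.add_one_le_exp (-(c * g n)); linarith
      have h5 : S (n + 1) = S n + g n := by simp [hS, Finset.sum_range_succ]
      have h6 : Real.exp (-(c * (S (n + 1) - S N₁))) * D =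
          Real.exp (-(c * g n)) * (Real.exp (-(c * (S n - S N₁))) * D) := by
        rw [h5, ← mul_assoc, ← Real.exp_add]; congr 2; ring
      rw [h6]
      calc x (n + 1) - ε / 2 ≤ (1 - c * g n) * (x n - ε / 2) := by nlinarith
        _ ≤ (1 - c * g n) * (Real.exp (-(c * (S n - S N₁))) * D) :=
            mul_le_mul_of_nonneg_left ih h1
        _ ≤ _ := mul_le_mul_of_nonneg_right h4 (by positivity)
  have h1 := key n ((le_max_left _ _).trans hn)
  have h2 := hN₂ n ((le_max_right _ _).trans hn)
  linarith

/-- The version of `exists_forall_le_of_contraction` for a sequence that is to be compared with a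
vanishing weight `s`, whose logarithmic decrease is dominated by the contraction. -/
lemma exists_forall_le_mul_of_contraction {g η s : ℕ → ℝ} {c c₀ : ℝ} (hc : 0 < c)
    (hg : ∀ n, 0 ≤ g n)
    (hgs : Tendsto (fun n => ∑ i ∈ Finset.range n, g i) atTop atTop)
    (hη : Tendsto η atTop (𝓝 0)) (N₀ : ℕ) (hN₀ : ∀ n, N₀ ≤ n → c * g n ≤ 1)
    (hs : ∀ n, N₀ ≤ n → 0 < s n)
    (hrate : ∀ n, N₀ ≤ n → (1 - c₀ * g n) * (s n / s (n + 1)) ≤ 1 - c * g n) (C : ℝ)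
    {ε : ℝ} (hε : 0 < ε) :
    ∃ N, ∀ x : ℕ → ℝ, (∀ n, 0 ≤ x n) → x N₀ ≤ C →
      (∀ n, N₀ ≤ n → x (n + 1) ≤ (1 - c₀ * g n) * x n + g n * (η n * s (n + 1))) →
      ∀ n, N ≤ n → x n ≤ ε * s n := by
  obtain ⟨N, hN⟩ := exists_forall_le_of_contraction hc hg hgs hη N₀ hN₀ (C / s N₀) hε
  refine ⟨max N N₀, fun x hx0 hx hr n hn => ?_⟩
  have hsn := hs n ((le_max_right _ _).trans hn)
  rw [← div_le_iff₀ hsn]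
  refine hN (fun n => x n / s n) (by have := hs N₀ le_rfl; gcongr) (fun n hn => ?_) n
    ((le_max_left _ _).trans hn)
  have h0 := hs n hn
  have h1 := hs (n + 1) (by omega)
  calc x (n + 1) / s (n + 1)
      ≤ ((1 - c₀ * g n) * x n + g n * (η n * s (n + 1))) / s (n + 1) := by gcongr; exact hr n hn
    _ = ((1 - c₀ * g n) * (s n / s (n + 1))) * (x n / s n) + g n * η n := by field_simp
    _ ≤ _ := by
      gcongr
      · exact div_nonneg (hx0 n) h0.le
      · exact hrate n hn

/-- The version of `exists_forall_le_mul_of_contraction` with an inhomogeneity of exactly the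
order of the weight: the sequence is then bounded by a multiple of the weight. -/
lemma exists_forall_le_mul_of_contraction_of_bounded {g s : ℕ → ℝ} {c c₀ B : ℝ} (hc : 0 < c)
    (hg : ∀ n, 0 ≤ g n) (N₀ : ℕ) (hN₀ : ∀ n, N₀ ≤ n → c * g n ≤ 1)
    (hs : ∀ n, N₀ ≤ n → 0 < s n)
    (hrate : ∀ n, N₀ ≤ n → (1 - c₀ * g n) * (s n / s (n + 1)) ≤ 1 - c * g n) (D : ℝ) :
    ∃ C, 0 ≤ C ∧ ∀ x : ℕ → ℝ, (∀ n, 0 ≤ x n) → x N₀ ≤ D →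
      (∀ n, N₀ ≤ n → x (n + 1) ≤ (1 - c₀ * g n) * x n + g n * (B * s (n + 1))) →
      ∀ n, N₀ ≤ n → x n ≤ C * s n := by
  refine ⟨max (max (D / s N₀) (B / c)) 0, le_max_right _ _, fun x hx0 hx hr n hn => ?_⟩
  set C := max (max (D / s N₀) (B / c)) 0 with hC
  have hCB : B ≤ c * C := by
    have : B / c ≤ C := (le_max_right _ _).trans (le_max_left _ _)
    rw [div_le_iff₀ hc] at this; linarith
  induction n, hn using Nat.le_induction with
  | base =>
    have h0 := hs N₀ le_rfl
    have : D / s N₀ ≤ C := (le_max_left _ _).trans (le_max_left _ _)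
    rw [div_le_iff₀ h0] at this; linarith
  | succ n hn ih =>
    have h0 := hs n hn
    have h1 := hs (n + 1) (by omega)
    have hC0 : 0 ≤ C := le_max_right _ _
    have h2 : 0 ≤ 1 - c * g n := by linarith [hN₀ n hn]
    have h3 : x n / s n ≤ C := by rw [div_le_iff₀ h0]; exact ih
    rw [← div_le_iff₀ h1]
    calc x (n + 1) / s (n + 1)
        ≤ ((1 - c₀ * g n) * x n + g n * (B * s (n + 1))) / s (n + 1) := by gcongr; exact hr n hn
      _ = ((1 - c₀ * g n) * (s n / s (n + 1))) * (x n / s n) + g n * B := by field_simp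
      _ ≤ (1 - c * g n) * (x n / s n) + g n * B := by
        gcongr
        · exact div_nonneg (hx0 n) h0.le
        · exact hrate n hn
      _ ≤ (1 - c * g n) * C + g n * (c * C) := by
        have := hg n
        gcongr
      _ = C := by ring

/-! ### Step sizes -/

section StepSize

variable {γ₁ β : ℝ}

lemma stepSize_pos (hγ₁ : 0 < γ₁) {n : ℕ} (hn : 1 ≤ n) : 0 < stepSize γ₁ β n := by
  have : (0 : ℝ) < n := by exact_mod_cast hn
  exact mul_pos hγ₁ (Real.rpow_pos_of_pos this _)

lemma tendsto_stepSize (hβ : 0 < β) : Tendsto (stepSize γ₁ β) atTop (𝓝 0) := by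
  show Tendsto (fun n : ℕ => γ₁ * (n : ℝ) ^ (-β)) atTop (𝓝 0)
  simpa using ((tendsto_rpow_neg_atTop hβ).comp tendsto_natCast_atTop_atTop).const_mul γ₁

lemma stepSize_antitone (hγ₁ : 0 < γ₁) (hβ : 0 < β) {n : ℕ} (hn : 1 ≤ n) :
    stepSize γ₁ β (n + 1) ≤ stepSize γ₁ β n := by
  have : (0 : ℝ) < n := by exact_mod_cast hn
  unfold stepSize
  refine mul_le_mul_of_nonneg_left ?_ hγ₁.le
  refine Real.rpow_le_rpow_of_nonpos this ?_ (by linarith)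
  push_cast; linarith

lemma stepSize_le (hγ₁ : 0 < γ₁) (hβ : 0 < β) (n : ℕ) : stepSize γ₁ β (n + 1) ≤ γ₁ := by
  have h : ((n + 1 : ℕ) : ℝ) ^ (-β) ≤ 1 :=
    Real.rpow_le_one_of_one_le_of_nonpos (by push_cast; linarith [(Nat.cast_nonneg n : (0:ℝ) ≤ n)])
      (by linarith)
  unfold stepSize
  nlinarith

lemma tendsto_sum_stepSize (hγ₁ : 0 < γ₁) (hβ₁ : β ≤ 1) :
    Tendsto (fun n => ∑ i ∈ Finset.range n, stepSize γ₁ β (i + 1)) atTop atTop := by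
  refine (not_summable_iff_tendsto_nat_atTop_of_nonneg fun n => (stepSize_pos hγ₁ (by omega)).le).1 ?_
  intro h
  rw [summable_nat_add_iff (f := stepSize γ₁ β) 1] at h
  unfold stepSize at h
  rw [summable_mul_left_iff hγ₁.ne', Real.summable_nat_rpow] at h
  linarith

lemma summable_stepSize_sq (hβ₀ : 1 / 2 < β) :
    Summable fun n => stepSize γ₁ β (n + 1) ^ 2 := by
  rw [summable_nat_add_iff (f := fun n => stepSize γ₁ β n ^ 2) 1]
  unfold stepSize
  simp_rw [mul_pow]
  refine Summable.mul_left _ ?_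
  have : ∀ n : ℕ, ((n : ℝ) ^ (-β)) ^ 2 = (n : ℝ) ^ (-β * 2) := fun n => by
    rw [Real.rpow_mul (Nat.cast_nonneg n)]; norm_cast
  simp_rw [this]
  rw [Real.summable_nat_rpow]
  linarith

lemma stepSize_div (hγ₁ : 0 < γ₁) {n : ℕ} (hn : 1 ≤ n) :
    stepSize γ₁ β n / stepSize γ₁ β (n + 1) = (1 + 1 / (n : ℝ)) ^ β := by
  have h0 : (0 : ℝ) < n := by exact_mod_cast hn
  have h1 : (0 : ℝ) < (n + 1 : ℕ) := by positivity
  unfold stepSize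
  rw [mul_div_mul_left _ _ hγ₁.ne', Real.rpow_neg h0.le, Real.rpow_neg h1.le, inv_div_inv,
    ← Real.div_rpow h1.le h0.le]
  congr 1
  push_cast; field_simp

open Classical in
/-- The logarithmic decrease of the step sizes, measured in units of the step: it is negligible
for `β < 1` and of the exact order `1 / γ₁` for `β = 1`. -/
lemma tendsto_stepSize_div (hγ₁ : 0 < γ₁) (hβ₀ : 0 < β) (hβ₁ : β ≤ 1) :
    Tendsto (fun n => (stepSize γ₁ β n / stepSize γ₁ β (n + 1) - 1) / stepSize γ₁ β (n + 1))
      atTop (𝓝 (γ₁⁻¹ * if β = 1 then 1 else 0)) := by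
  split_ifs with h
  · subst h
    have h1 : Tendsto (fun n : ℕ => γ₁⁻¹ * (1 + 1 / (n : ℝ))) atTop (𝓝 (γ₁⁻¹ * (1 + 0))) :=
      (tendsto_one_div_atTop_nhds_zero_nat.const_add 1).const_mul _
    rw [add_zero] at h1
    refine h1.congr' ?_
    filter_upwards [eventually_ge_atTop 1] with n hn
    have h0 : (0 : ℝ) < n := by exact_mod_cast hn
    rw [stepSize_div hγ₁ hn, Real.rpow_one, stepSize, Real.rpow_neg_one]
    push_cast; field_simp; ring
  · have hβ : β < 1 := lt_of_le_of_ne hβ₁ h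
    rw [mul_zero]
    have h1 : Tendsto (fun n : ℕ => γ₁⁻¹ * 2 * (n : ℝ) ^ (-(1 - β))) atTop (𝓝 0) := by
      simpa using ((tendsto_rpow_neg_atTop (by linarith : 0 < 1 - β)).comp
        tendsto_natCast_atTop_atTop).const_mul (γ₁⁻¹ * 2)
    refine squeeze_zero' ?_ ?_ h1
    · filter_upwards [eventually_ge_atTop 1] with n hn
      rw [stepSize_div hγ₁ hn]
      refine div_nonneg ?_ (stepSize_pos hγ₁ (by omega)).le
      have h0 : (0 : ℝ) ≤ 1 / n := by positivity
      linarith [Real.one_le_rpow (by linarith : (1 : ℝ) ≤ 1 + 1 / n) hβ₀.le]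
    · filter_upwards [eventually_ge_atTop 1] with n hn
      have h0 : (1 : ℝ) ≤ n := by exact_mod_cast hn
      have hp : (0 : ℝ) < n := by linarith
      have h2 : (0 : ℝ) ≤ 1 / n := by positivity
      rw [stepSize_div hγ₁ hn, div_le_iff₀ (stepSize_pos hγ₁ (by omega))]
      have h3 : (1 + 1 / (n : ℝ)) ^ β ≤ 1 + 1 / n := by
        conv_rhs => rw [← Real.rpow_one (1 + 1 / (n : ℝ))]
        exact Real.rpow_le_rpow_of_exponent_le (by linarith) hβ₁
      have h4 : ((n : ℝ) ^ (-β)) / 2 ≤ ((n + 1 : ℕ) : ℝ) ^ (-β) := by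
        have h5 : (2 * (n : ℝ)) ^ (-β) ≤ ((n + 1 : ℕ) : ℝ) ^ (-β) :=
          Real.rpow_le_rpow_of_nonpos (by positivity) (by push_cast; linarith) (by linarith)
        have h6 : (2 * (n : ℝ)) ^ (-β) = 2 ^ (-β) * (n : ℝ) ^ (-β) :=
          Real.mul_rpow (by norm_num) hp.le
        have h7 : (2 : ℝ)⁻¹ ≤ 2 ^ (-β) := by
          rw [← Real.rpow_neg_one]
          exact Real.rpow_le_rpow_of_exponent_le (by norm_num) (by linarith)
        have h8 : 0 ≤ (n : ℝ) ^ (-β) := by positivity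
        nlinarith
      have h9 : (n : ℝ) ^ (-(1 - β)) * (n : ℝ) ^ (-β) = 1 / n := by
        rw [← Real.rpow_add hp, show -(1 - β) + -β = -1 by ring, Real.rpow_neg_one, one_div]
      have h10 : 0 ≤ (n : ℝ) ^ (-(1 - β)) := by positivity
      calc (1 + 1 / (n : ℝ)) ^ β - 1 ≤ 1 / n := by linarith
        _ = γ₁⁻¹ * 2 * (n : ℝ) ^ (-(1 - β)) * (γ₁ * ((n : ℝ) ^ (-β) / 2)) := by
          rw [← h9]; field_simp
        _ ≤ _ := by
          unfold stepSize
          gcongr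

open Classical in
/-- A linear contraction of strength `c₀` per unit step, with `c₀ * γ₁ > 1` if `β = 1`, beats the
decrease of the step sizes. -/
lemma exists_contraction_rate (hγ₁ : 0 < γ₁) (hβ₀ : 0 < β) (hβ₁ : β ≤ 1) {c₀ : ℝ} (hc₀ : 0 < c₀)
    (h1 : β = 1 → 1 < c₀ * γ₁) :
    ∃ c > 0, ∃ N, 1 ≤ N ∧ ∀ n, N ≤ n → c * stepSize γ₁ β (n + 1) ≤ 1 ∧
      c₀ * stepSize γ₁ β (n + 1) ≤ 1 ∧
      (1 - c₀ * stepSize γ₁ β (n + 1)) * (stepSize γ₁ β n / stepSize γ₁ β (n + 1)) ≤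
        1 - c * stepSize γ₁ β (n + 1) := by
  set e : ℝ := γ₁⁻¹ * if β = 1 then 1 else 0 with he
  have hec : e < c₀ := by
    rw [he]; split_ifs with h
    · have := h1 h; rw [mul_one, inv_lt_iff_one_lt_mul₀ hγ₁]; linarith
    · simpa using hc₀
  have he0 : 0 ≤ e := by rw [he]; split_ifs <;> simp [hγ₁.le]
  have hlim := tendsto_stepSize_div hγ₁ hβ₀ hβ₁
  rw [← he] at hlim
  have hev1 := hlim.eventually (ge_mem_nhds (show e < (e + c₀) / 2 by linarith))
  have hs : Tendsto (fun n => c₀ * stepSize γ₁ β (n + 1)) atTop (𝓝 0) := by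
    simpa using ((tendsto_add_atTop_iff_nat 1).2 (tendsto_stepSize (γ₁ := γ₁) hβ₀)).const_mul c₀
  have hev2 := hs.eventually (ge_mem_nhds one_pos)
  obtain ⟨N, hN⟩ := eventually_atTop.1 (hev1.and hev2)
  refine ⟨(c₀ - e) / 2, by linarith, max N 1, le_max_right _ _, fun n hn => ?_⟩
  obtain ⟨h2, h3⟩ := hN n ((le_max_left _ _).trans hn)
  have hn1 : 1 ≤ n := (le_max_right _ _).trans hn
  have hp : 0 < stepSize γ₁ β (n + 1) := stepSize_pos hγ₁ (by omega)
  have hp' : 0 < stepSize γ₁ β n := stepSize_pos hγ₁ hn1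
  refine ⟨by nlinarith, h3, ?_⟩
  have hr1 : 1 ≤ stepSize γ₁ β n / stepSize γ₁ β (n + 1) := by
    rw [one_le_div hp]; exact stepSize_antitone hγ₁ hβ₀ hn1
  rw [div_le_iff₀ hp] at h2
  set g := stepSize γ₁ β (n + 1)
  set r := stepSize γ₁ β n / g
  have : c₀ * g * 1 ≤ c₀ * g * r := by gcongr
  nlinarith

end StepSize

/-! ### Weights of the linearised recursion -/

/-- The coefficient of the `k`-th noise term in the value after `n` steps of the linear recursion
`u (n + 1) = (1 - a * γ (n + 1)) * u n - γ (n + 1) * noise n` started from `0`. -/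
noncomputable def weight (γ₁ β a : ℝ) (n k : ℕ) : ℝ :=
  -(stepSize γ₁ β (k + 1) * ∏ j ∈ Finset.Ico (k + 1) n, (1 - a * stepSize γ₁ β (j + 1)))

section Weight

variable {γ₁ β a : ℝ}

lemma weight_succ {n k : ℕ} (h : k < n) :
    weight γ₁ β a (n + 1) k = (1 - a * stepSize γ₁ β (n + 1)) * weight γ₁ β a n k := by
  rw [weight, weight, Finset.prod_Ico_succ_top (by omega)]; ring

lemma weight_self (n : ℕ) : weight γ₁ β a (n + 1) n = -stepSize γ₁ β (n + 1) := by
  simp [weight]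

lemma sum_weight_mul_succ (n : ℕ) (z : ℕ → ℝ) :
    ∑ k ∈ Finset.range (n + 1), weight γ₁ β a (n + 1) k * z k =
      (1 - a * stepSize γ₁ β (n + 1)) * ∑ k ∈ Finset.range n, weight γ₁ β a n k * z k -
        stepSize γ₁ β (n + 1) * z n := by
  rw [Finset.sum_range_succ, weight_self, Finset.mul_sum, neg_mul, ← sub_eq_add_neg]
  congr 1
  refine Finset.sum_congr rfl fun k hk => ?_
  rw [weight_succ (Finset.mem_range.1 hk)]; ring

lemma sum_weight_succ (n : ℕ) :
    ∑ k ∈ Finset.range (n + 1), weight γ₁ β a (n + 1) k =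
      (1 - a * stepSize γ₁ β (n + 1)) * ∑ k ∈ Finset.range n, weight γ₁ β a n k -
        stepSize γ₁ β (n + 1) := by
  simpa using sum_weight_mul_succ (γ₁ := γ₁) (β := β) (a := a) n fun _ => 1

lemma sum_weight_sq_succ (n : ℕ) :
    ∑ k ∈ Finset.range (n + 1), weight γ₁ β a (n + 1) k ^ 2 =
      (1 - a * stepSize γ₁ β (n + 1)) ^ 2 * ∑ k ∈ Finset.range n, weight γ₁ β a n k ^ 2 +
        stepSize γ₁ β (n + 1) ^ 2 := by
  rw [Finset.sum_range_succ, weight_self, Finset.mul_sum, neg_sq]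
  congr 1
  refine Finset.sum_congr rfl fun k hk => ?_
  rw [weight_succ (Finset.mem_range.1 hk)]; ring

/-- A bound on one factor `1 - a * γ` that also covers the first steps, where the factor may be
negative. -/
lemma abs_one_sub_mul_stepSize_le (hγ₁ : 0 < γ₁) (hβ₀ : 0 < β) {a₁ : ℝ} (ha : 0 ≤ a)
    (ha₁ : a ≤ a₁) (n : ℕ) : |1 - a * stepSize γ₁ β (n + 1)| ≤ 1 + a₁ * γ₁ := by
  have h1 := stepSize_le hγ₁ hβ₀ n
  have h2 := (stepSize_pos (β := β) hγ₁ (show 1 ≤ n + 1 by omega)).le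
  have h3 : a * stepSize γ₁ β (n + 1) ≤ a₁ * γ₁ := mul_le_mul ha₁ h1 h2 (ha.trans ha₁)
  have h4 : 0 ≤ a * stepSize γ₁ β (n + 1) := by positivity
  rw [abs_le]; constructor <;> nlinarith

lemma exists_sum_weight_sq_le (hγ₁ : 0 < γ₁) (hβ₀ : 0 < β) (a₁ : ℝ) (n : ℕ) :
    ∃ C, 0 ≤ C ∧ ∀ a, 0 ≤ a → a ≤ a₁ → ∑ k ∈ Finset.range n, weight γ₁ β a n k ^ 2 ≤ C := by
  induction n with
  | zero => exact ⟨0, le_rfl, by simp⟩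
  | succ n ih =>
    obtain ⟨C, hC0, hC⟩ := ih
    refine ⟨(1 + a₁ * γ₁) ^ 2 * C + γ₁ ^ 2, by positivity, fun a ha ha₁ => ?_⟩
    rw [sum_weight_sq_succ]
    have h1 := abs_one_sub_mul_stepSize_le hγ₁ hβ₀ ha ha₁ n
    have h2 := (stepSize_pos (β := β) hγ₁ (show 1 ≤ n + 1 by omega)).le
    have h3 := stepSize_le hγ₁ hβ₀ n
    have h4 : (1 - a * stepSize γ₁ β (n + 1)) ^ 2 ≤ (1 + a₁ * γ₁) ^ 2 := by
      rw [← sq_abs]; gcongr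
    have h5 : 0 ≤ ∑ k ∈ Finset.range n, weight γ₁ β a n k ^ 2 :=
      Finset.sum_nonneg fun _ _ => sq_nonneg _
    gcongr
    exact hC a ha ha₁

lemma exists_abs_sum_weight_le (hγ₁ : 0 < γ₁) (hβ₀ : 0 < β) (a₁ : ℝ) (n : ℕ) :
    ∃ C, 0 ≤ C ∧ ∀ a, 0 ≤ a → a ≤ a₁ → |∑ k ∈ Finset.range n, weight γ₁ β a n k| ≤ C := by
  induction n with
  | zero => exact ⟨0, le_rfl, by simp⟩
  | succ n ih =>
    obtain ⟨C, hC0, hC⟩ := ih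
    refine ⟨|1 + a₁ * γ₁| * C + γ₁, by positivity, fun a ha ha₁ => ?_⟩
    rw [sum_weight_succ]
    have h1 := (abs_one_sub_mul_stepSize_le hγ₁ hβ₀ ha ha₁ n).trans (le_abs_self _)
    have h2 := (stepSize_pos (β := β) hγ₁ (show 1 ≤ n + 1 by omega)).le
    refine (abs_sub _ _).trans (add_le_add ?_ ?_)
    · rw [abs_mul]
      exact mul_le_mul h1 (hC a ha ha₁) (abs_nonneg _) (abs_nonneg _)
    · rw [abs_of_nonneg h2]; exact stepSize_le hγ₁ hβ₀ n

/-- All weights are of the order of the last step size. -/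
lemma exists_abs_weight_le (hγ₁ : 0 < γ₁) (hβ₀ : 0 < β) (hβ₁ : β ≤ 1) {a₀ a₁ : ℝ} (ha₀ : 0 < a₀)
    (h1 : β = 1 → 1 < a₀ * γ₁) :
    ∃ C, 0 ≤ C ∧ ∀ a, a₀ ≤ a → a ≤ a₁ → ∀ n, 1 ≤ n → ∀ k < n,
      |weight γ₁ β a n k| ≤ C * stepSize γ₁ β n := by
  obtain ⟨c, hc, N, hN1, hN⟩ := exists_contraction_rate hγ₁ hβ₀ hβ₁ ha₀ h1
  have hs : Tendsto (fun n => a₁ * stepSize γ₁ β (n + 1)) atTop (𝓝 0) := by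
    simpa using ((tendsto_add_atTop_iff_nat 1).2 (tendsto_stepSize (γ₁ := γ₁) hβ₀)).const_mul a₁
  obtain ⟨N', hN'⟩ := eventually_atTop.1 (hs.eventually (ge_mem_nhds one_pos))
  -- finitely many rows
  have hfin : ∀ n, 1 ≤ n → ∃ C, 0 ≤ C ∧ ∀ a, a₀ ≤ a → a ≤ a₁ → ∀ m, 1 ≤ m → m ≤ n → ∀ k < m,
      |weight γ₁ β a m k| ≤ C * stepSize γ₁ β m := by
    intro n hn
    induction n, hn using Nat.le_induction with
    | base =>
      refine ⟨1, zero_le_one, fun a _ _ m hm hm1 k hk => ?_⟩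
      obtain rfl : m = 1 := by omega
      obtain rfl : k = 0 := by omega
      rw [weight_self, abs_neg, one_mul, abs_of_pos (stepSize_pos hγ₁ (by omega))]
    | succ n hn ih =>
      obtain ⟨C, hC0, hC⟩ := ih
      have hp := stepSize_pos (β := β) hγ₁ hn
      have hp1 := stepSize_pos (β := β) hγ₁ (show 1 ≤ n + 1 by omega)
      set D := |1 + a₁ * γ₁| * C * (stepSize γ₁ β n / stepSize γ₁ β (n + 1)) with hD
      have hD0 : 0 ≤ D := by positivity
      refine ⟨C + D + 1, by positivity, fun a ha ha₁ m hm hmn k hk => ?_⟩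
      have hpm := stepSize_pos (β := β) hγ₁ hm
      rcases Nat.lt_or_ge m (n + 1) with h | h
      · refine (hC a ha ha₁ m hm (by omega) k hk).trans ?_
        gcongr; linarith
      obtain rfl : m = n + 1 := by omega
      rcases Nat.lt_or_ge k n with h' | h'
      · rw [weight_succ h', abs_mul]
        have h2 := (abs_one_sub_mul_stepSize_le hγ₁ hβ₀ (ha₀.le.trans ha) ha₁ n).trans
          (le_abs_self _)
        calc _ ≤ |1 + a₁ * γ₁| * (C * stepSize γ₁ β n) :=
              mul_le_mul h2 (hC a ha ha₁ n hn le_rfl k h') (abs_nonneg _) (abs_nonneg _)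
          _ = D * stepSize γ₁ β (n + 1) := by rw [hD]; field_simp
          _ ≤ _ := by gcongr; linarith
      · obtain rfl : k = n := by omega
        rw [weight_self, abs_neg, abs_of_pos hp1]
        nlinarith
  set M := max N N' with hM
  have hM1 : 1 ≤ M := hN1.trans (le_max_left _ _)
  obtain ⟨C, hC0, hC⟩ := hfin M hM1
  refine ⟨C + 1, by positivity, fun a ha ha₁ n hn => ?_⟩
  rcases Nat.lt_or_ge n M with h | h
  · intro k hk
    refine (hC a ha ha₁ n hn h.le k hk).trans ?_
    have := stepSize_pos (β := β) hγ₁ hn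
    gcongr; linarith
  induction n, h using Nat.le_induction with
  | base =>
    intro k hk
    refine (hC a ha ha₁ M hn le_rfl k hk).trans ?_
    have := stepSize_pos (β := β) hγ₁ hn
    gcongr; linarith
  | succ n hMn ih =>
    intro k hk
    have hn1 : 1 ≤ n := hM1.trans hMn
    have hp := stepSize_pos (β := β) hγ₁ hn1
    have hp1 := stepSize_pos (β := β) hγ₁ hn
    rcases Nat.lt_or_ge k n with h' | h'
    · obtain ⟨h2, h3, h4⟩ := hN n ((le_max_left _ _).trans hMn)
      have h5 := hN' n ((le_max_right _ _).trans hMn)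
      have h6 : a * stepSize γ₁ β (n + 1) ≤ 1 := le_trans (by gcongr) h5
      have h7 : a₀ * stepSize γ₁ β (n + 1) ≤ a * stepSize γ₁ β (n + 1) := by gcongr
      rw [weight_succ h', abs_mul, abs_of_nonneg (by linarith)]
      have h8 : (1 - a * stepSize γ₁ β (n + 1)) * stepSize γ₁ β n ≤ stepSize γ₁ β (n + 1) := by
        rw [← mul_div_assoc, div_le_iff₀ hp1] at h4
        have : 0 < c * stepSize γ₁ β (n + 1) := by positivity
        nlinarith
      calc _ ≤ (1 - a * stepSize γ₁ β (n + 1)) * ((C + 1) * stepSize γ₁ β n) := by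
            refine mul_le_mul_of_nonneg_left (ih hn1 k h') (by linarith)
        _ = (C + 1) * ((1 - a * stepSize γ₁ β (n + 1)) * stepSize γ₁ β n) := by ring
        _ ≤ _ := by gcongr
    · obtain rfl : k = n := by omega
      rw [weight_self, abs_neg, abs_of_pos hp1]
      nlinarith

/-- The weights sum up to `-1 / a` in the limit, uniformly in `a`. -/
lemma exists_abs_sum_weight_add_le (hγ₁ : 0 < γ₁) (hβ₀ : 0 < β) (hβ₁ : β ≤ 1) {a₀ a₁ : ℝ}
    (ha₀ : 0 < a₀) {ε : ℝ} (hε : 0 < ε) :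
    ∃ N, ∀ a, a₀ ≤ a → a ≤ a₁ → ∀ n, N ≤ n →
      |∑ k ∈ Finset.range n, weight γ₁ β a n k + 1 / a| ≤ ε := by
  have hs : Tendsto (fun n => |a₁| * stepSize γ₁ β (n + 1)) atTop (𝓝 0) := by
    simpa using ((tendsto_add_atTop_iff_nat 1).2 (tendsto_stepSize (γ₁ := γ₁) hβ₀)).const_mul |a₁|
  obtain ⟨N₀, hN₀'⟩ := eventually_atTop.1 (hs.eventually (ge_mem_nhds one_pos))
  have hN₀ : ∀ a, a ≤ a₁ → ∀ n, N₀ ≤ n → a * stepSize γ₁ β (n + 1) ≤ 1 := fun a ha n hn => by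
    have := stepSize_pos (β := β) hγ₁ (show 1 ≤ n + 1 by omega)
    refine le_trans ?_ (hN₀' n hn)
    gcongr; exact ha.trans (le_abs_self _)
  obtain ⟨C, hC0, hC⟩ := exists_abs_sum_weight_le hγ₁ hβ₀ a₁ N₀
  rcases le_or_gt a₀ a₁ with h01 | h01
  swap
  · exact ⟨0, fun a h h' => absurd (h.trans h') (not_le.2 h01)⟩
  obtain ⟨N, hN⟩ := exists_forall_le_of_contraction (g := fun n => stepSize γ₁ β (n + 1))
    (η := fun _ => 0) ha₀ (fun n => (stepSize_pos hγ₁ (by omega)).le)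
    (tendsto_sum_stepSize hγ₁ hβ₁) tendsto_const_nhds N₀ (hN₀ a₀ h01) (C + 1 / a₀) hε
  refine ⟨N, fun a ha ha₁ n hn => hN (fun n => |∑ k ∈ Finset.range n, weight γ₁ β a n k + 1 / a|)
    ?_ (fun n hn => ?_) n hn⟩
  · have hap : 0 < a := ha₀.trans_le ha
    refine (abs_add_le _ _).trans (add_le_add (hC a hap.le ha₁) ?_)
    rw [abs_of_pos (by positivity)]
    gcongr
  · have hap : 0 < a := ha₀.trans_le ha
    have h1 := hN₀ a ha₁ n hn
    have hp := stepSize_pos (β := β) hγ₁ (show 1 ≤ n + 1 by omega)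
    have h2 : ∑ k ∈ Finset.range (n + 1), weight γ₁ β a (n + 1) k + 1 / a =
        (1 - a * stepSize γ₁ β (n + 1)) * (∑ k ∈ Finset.range n, weight γ₁ β a n k + 1 / a) := by
      rw [sum_weight_succ]; field_simp; ring
    simp only [mul_zero, add_zero]
    rw [h2, abs_mul, abs_of_nonneg (by linarith)]
    gcongr

open Classical in
/-- The asymptotic variance of the linearised recursion: the sum of the squared weights is
equivalent to `γ n / (2 * a - 𝟙_{β = 1} / γ₁)`, uniformly in `a`. -/
lemma exists_abs_sum_weight_sq_div_sub_le (hγ₁ : 0 < γ₁) (hβ₀ : 0 < β) (hβ₁ : β ≤ 1) {a₀ a₁ : ℝ}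
    (ha₀ : 0 < a₀) (h1 : β = 1 → 1 < a₀ * γ₁) {ε : ℝ} (hε : 0 < ε) :
    ∃ N, ∀ a, a₀ ≤ a → a ≤ a₁ → ∀ n, N ≤ n →
      |(∑ k ∈ Finset.range n, weight γ₁ β a n k ^ 2) / stepSize γ₁ β n -
        1 / (2 * a - γ₁⁻¹ * if β = 1 then 1 else 0)| ≤ ε := by
  rcases le_or_gt a₀ a₁ with h01 | h01
  swap
  · exact ⟨0, fun a h h' => absurd (h.trans h') (not_le.2 h01)⟩
  set e : ℝ := γ₁⁻¹ * if β = 1 then 1 else 0 with he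
  have hec : e < a₀ := by
    rw [he]; split_ifs with h
    · have := h1 h; rw [mul_one, inv_lt_iff_one_lt_mul₀ hγ₁]; linarith
    · simpa using ha₀
  have he0 : 0 ≤ e := by rw [he]; split_ifs <;> simp [hγ₁.le]
  obtain ⟨c, hc, N, hN1, hN⟩ := exists_contraction_rate hγ₁ hβ₀ hβ₁ ha₀ h1
  have hsγ : Tendsto (fun n => stepSize γ₁ β (n + 1)) atTop (𝓝 0) :=
    (tendsto_add_atTop_iff_nat 1).2 (tendsto_stepSize (γ₁ := γ₁) hβ₀)
  have hs : Tendsto (fun n => a₁ * stepSize γ₁ β (n + 1)) atTop (𝓝 0) := by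
    simpa using hsγ.const_mul a₁
  obtain ⟨N', hN'⟩ := eventually_atTop.1 (hs.eventually (ge_mem_nhds one_pos))
  set N₀ := max N N' with hN₀
  have hN₀1 : 1 ≤ N₀ := hN1.trans (le_max_left _ _)
  obtain ⟨C, hC0, hC⟩ := exists_sum_weight_sq_le hγ₁ hβ₀ a₁ N₀
  -- `θ n` is the error in the expansion of the ratio of consecutive step sizes
  set θ : ℕ → ℝ := fun n =>
    (stepSize γ₁ β n / stepSize γ₁ β (n + 1) - 1) / stepSize γ₁ β (n + 1) - e with hθ
  have hθ0 : Tendsto θ atTop (𝓝 0) := by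
    have := (tendsto_stepSize_div hγ₁ hβ₀ hβ₁).sub_const e
    rwa [← he, sub_self] at this
  set η : ℕ → ℝ := fun n => 1 / a₀ * (|θ n| + (a₁ ^ 2 + 2 * a₁ * (e + |θ n|)) *
    stepSize γ₁ β (n + 1) + a₁ ^ 2 * (e + |θ n|) * stepSize γ₁ β (n + 1) ^ 2) with hη
  have hη0 : Tendsto η atTop (𝓝 0) := by
    have h2 : Tendsto (fun n => |θ n|) atTop (𝓝 0) := by simpa using hθ0.abs
    have h3 : Tendsto (fun n => e + |θ n|) atTop (𝓝 (e + 0)) := h2.const_add e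
    have := ((h2.add (((h3.const_mul (2 * a₁)).const_add (a₁ ^ 2)).mul hsγ)).add
      ((h3.const_mul (a₁ ^ 2)).mul (hsγ.pow 2))).const_mul (1 / a₀)
    simpa [hη] using this
  obtain ⟨M, hM⟩ := exists_forall_le_of_contraction (g := fun n => stepSize γ₁ β (n + 1))
    (η := η) hc (fun n => (stepSize_pos hγ₁ (by omega)).le)
    (tendsto_sum_stepSize hγ₁ hβ₁) hη0 N₀ (fun n hn => (hN n ((le_max_left _ _).trans hn)).1)
    (C / stepSize γ₁ β N₀ + 1 / a₀) hε
  refine ⟨M, fun a ha ha₁ n hn => hM (fun n => |(∑ k ∈ Finset.range n, weight γ₁ β a n k ^ 2) /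
    stepSize γ₁ β n - 1 / (2 * a - e)|) ?_ (fun n hn => ?_) n hn⟩
  · have hap : 0 < a := ha₀.trans_le ha
    have hp := stepSize_pos (β := β) hγ₁ hN₀1
    have h5 : 0 ≤ ∑ k ∈ Finset.range N₀, weight γ₁ β a N₀ k ^ 2 :=
      Finset.sum_nonneg fun _ _ => sq_nonneg _
    have h6 : 0 < 2 * a - e := by linarith
    refine (abs_sub _ _).trans (add_le_add ?_ ?_)
    · rw [abs_of_nonneg (by positivity)]
      gcongr
      exact hC a hap.le ha₁
    · rw [abs_of_pos (by positivity)]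
      gcongr; linarith
  · have hap : 0 < a := ha₀.trans_le ha
    have hde : 0 < 2 * a - e := by linarith
    have hn1 : 1 ≤ n := hN₀1.trans hn
    have hp := stepSize_pos (β := β) hγ₁ (show 1 ≤ n + 1 by omega)
    have hp' := stepSize_pos (β := β) hγ₁ hn1
    obtain ⟨h2, h3, h4⟩ := hN n ((le_max_left _ _).trans hn)
    have h5 := hN' n ((le_max_right _ _).trans hn)
    have h6 : a * stepSize γ₁ β (n + 1) ≤ 1 := le_trans (by gcongr) h5
    have h7 : a₀ * stepSize γ₁ β (n + 1) ≤ a * stepSize γ₁ β (n + 1) := by gcongr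
    have hr : stepSize γ₁ β n / stepSize γ₁ β (n + 1) =
        1 + (e + θ n) * stepSize γ₁ β (n + 1) := by
      simp only [hθ]; field_simp; ring
    have hrpos : 0 < stepSize γ₁ β n / stepSize γ₁ β (n + 1) := by positivity
    set g := stepSize γ₁ β (n + 1) with hg
    set S := ∑ k ∈ Finset.range n, weight γ₁ β a n k ^ 2 with hS
    set r := stepSize γ₁ β n / g with hrd
    set ℓ := 1 / (2 * a - e) with hℓ
    have hℓ1 : ℓ * (2 * a - e) = 1 := by rw [hℓ]; field_simp
    have hℓ0 : 0 < ℓ := by positivity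
    have hℓ2 : ℓ ≤ 1 / a₀ := by rw [hℓ]; gcongr; linarith
    have h8 : ((1 - a * g) ^ 2 * S + g ^ 2) / g - ℓ =
        (1 - a * g) ^ 2 * r * (S / stepSize γ₁ β n - ℓ) +
          g * (ℓ * (θ n + (a ^ 2 - 2 * a * (e + θ n)) * g + a ^ 2 * (e + θ n) * g ^ 2)) := by
      have h9 : ((1 - a * g) ^ 2 * S + g ^ 2) / g =
          (1 - a * g) ^ 2 * r * (S / stepSize γ₁ β n) + g := by
        rw [hrd]; field_simp
      rw [h9, mul_sub]
      have h10 : (1 - a * g) ^ 2 * r * ℓ = ℓ + ℓ * g * (-(2 * a - e) +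
          (θ n + (a ^ 2 - 2 * a * (e + θ n)) * g + a ^ 2 * (e + θ n) * g ^ 2)) := by
        rw [hr]; ring
      rw [h10]
      linear_combination (-g) * hℓ1
    rw [sum_weight_sq_succ, h8]
    refine (abs_add_le _ _).trans (add_le_add ?_ ?_)
    · rw [abs_mul, abs_of_nonneg (by positivity)]
      gcongr
      have h11 : (1 - a * g) ^ 2 ≤ 1 - a₀ * g := by
        have : 0 ≤ a * g := by positivity
        nlinarith
      refine le_trans ?_ h4
      gcongr
    · rw [abs_mul, abs_of_pos hp, abs_mul, abs_of_pos hℓ0]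
      have h12 : |e + θ n| ≤ e + |θ n| :=
        (abs_add_le _ _).trans (by rw [abs_of_nonneg he0])
      have h13 : 0 ≤ e + |θ n| := by positivity
      have ha₁0 : 0 ≤ a₁ := hap.le.trans ha₁
      simp only [hη]
      gcongr
      refine (abs_add_le _ _).trans (add_le_add ((abs_add_le _ _).trans (add_le_add le_rfl ?_)) ?_)
      · rw [abs_mul, abs_of_pos hp]
        gcongr
        refine (abs_sub _ _).trans ?_
        rw [abs_mul, abs_of_pos (by positivity : 0 < 2 * a), abs_of_nonneg (sq_nonneg a)]
        gcongr
      · rw [abs_mul, abs_mul, abs_of_nonneg (sq_nonneg g), abs_of_nonneg (sq_nonneg a)]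
        gcongr

end Weight

/-! ### A Lyapunov central limit theorem -/

/-- Second order Taylor expansion of the characteristic exponential, with an error term
interpolating between the quadratic and the cubic bound. -/
lemma norm_cexp_mul_I_sub_taylor_le {δ : ℝ} (hδ₀ : 0 < δ) (hδ₁ : δ ≤ 1) (x : ℝ) :
    ‖Complex.exp (x * Complex.I) - (1 + x * Complex.I - (x : ℂ) ^ 2 / 2)‖ ≤ 4 * |x| ^ (2 + δ) := by
  rcases le_or_gt |x| 1 with h | h
  · have h1 : ‖(x * Complex.I : ℂ)‖ ≤ 1 := by simpa using h
    have h2 := Complex.exp_bound h1 (n := 3) (by norm_num)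
    have h3 : ∑ m ∈ Finset.range 3, (x * Complex.I : ℂ) ^ m / (m.factorial : ℂ) =
        1 + x * Complex.I - (x : ℂ) ^ 2 / 2 := by
      simp [Finset.sum_range_succ, Nat.factorial, mul_pow]; ring
    rw [h3] at h2
    have h4 : ‖(x * Complex.I : ℂ)‖ = |x| := by simp
    rw [h4] at h2
    refine h2.trans ?_
    rcases (abs_nonneg x).eq_or_lt with h0 | h0
    · rw [← h0]; norm_num; positivity
    have h5 : |x| ^ 3 ≤ |x| ^ (2 + δ) := by
      rw [← Real.rpow_natCast]
      exact Real.rpow_le_rpow_of_exponent_ge h0 h (by push_cast; linarith)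
    have h6 : (0 : ℝ) ≤ |x| ^ 3 := by positivity
    norm_num [Nat.factorial]
    nlinarith
  · have h1 : |x| ^ 2 ≤ |x| ^ (2 + δ) := by
      rw [← Real.rpow_natCast]
      exact Real.rpow_le_rpow_of_exponent_le h.le (by push_cast; linarith)
    have h2 : ‖Complex.exp (x * Complex.I)‖ = 1 := Complex.norm_exp_ofReal_mul_I x
    have h3 : ‖(1 + x * Complex.I - (x : ℂ) ^ 2 / 2)‖ ≤ 1 + |x| + |x| ^ 2 / 2 := by
      refine (norm_sub_le _ _).trans (add_le_add ((norm_add_le _ _).trans ?_) ?_) <;> simp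
    have h4 := norm_sub_le (Complex.exp (x * Complex.I)) (1 + x * Complex.I - (x : ℂ) ^ 2 / 2)
    nlinarith

lemma norm_prod_sub_prod_le {ι : Type*} (s : Finset ι) (a b : ι → ℂ) (ha : ∀ i ∈ s, ‖a i‖ ≤ 1)
    (hb : ∀ i ∈ s, ‖b i‖ ≤ 1) : ‖∏ i ∈ s, a i - ∏ i ∈ s, b i‖ ≤ ∑ i ∈ s, ‖a i - b i‖ := by
  classical
  induction s using Finset.induction_on with
  | empty => simp
  | insert j s hj ih =>
    rw [Finset.prod_insert hj, Finset.prod_insert hj, Finset.sum_insert hj]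
    have h1 : a j * ∏ i ∈ s, a i - b j * ∏ i ∈ s, b i =
        (a j - b j) * ∏ i ∈ s, a i + b j * (∏ i ∈ s, a i - ∏ i ∈ s, b i) := by ring
    rw [h1]
    have h2 : ‖∏ i ∈ s, a i‖ ≤ 1 := by
      rw [norm_prod]
      exact Finset.prod_le_one (fun _ _ => norm_nonneg _)
        fun i hi => ha i (Finset.mem_insert_of_mem hi)
    refine (norm_add_le _ _).trans (add_le_add ?_ ?_)
    · rw [norm_mul]; exact mul_le_of_le_one_right (norm_nonneg _) h2
    · rw [norm_mul]
      refine (mul_le_of_le_one_left (norm_nonneg _) (hb j (Finset.mem_insert_self _ _))).trans ?_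
      exact ih (fun i hi => ha i (Finset.mem_insert_of_mem hi))
        fun i hi => hb i (Finset.mem_insert_of_mem hi)

section Lyapunov

variable {Ω : Type*} [MeasurableSpace Ω] {P : Measure Ω} [IsProbabilityMeasure P]

lemma integrable_sq_of_integrable_rpow {Z : Ω → ℝ} (hZ : Measurable Z) {δ : ℝ} (hδ₀ : 0 < δ)
    (hi : Integrable (fun ω => |Z ω| ^ (2 + δ)) P) : Integrable (fun ω => Z ω ^ 2) P := by
  refine (hi.add (integrable_const 1)).mono' (by fun_prop) (ae_of_all _ fun ω => ?_)
  have h0 := abs_nonneg (Z ω)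
  have h2 : 0 ≤ |Z ω| ^ (2 + δ) := by positivity
  rw [Real.norm_of_nonneg (sq_nonneg _), ← sq_abs, Pi.add_apply]
  rcases le_or_gt |Z ω| 1 with h | h
  · nlinarith
  · have : |Z ω| ^ 2 ≤ |Z ω| ^ (2 + δ) := by
      rw [← Real.rpow_natCast]
      exact Real.rpow_le_rpow_of_exponent_le h.le (by push_cast; linarith)
    linarith

lemma integrable_of_integrable_sq {Z : Ω → ℝ} (hZ : AEStronglyMeasurable Z P)
    (hi : Integrable (fun ω => Z ω ^ 2) P) : Integrable Z P :=
  ((memLp_two_iff_integrable_sq hZ).2 hi).integrable (by norm_num)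

lemma norm_integral_cexp_sub_exp_le {Z : Ω → ℝ} (hZ : Measurable Z) {δ : ℝ} (hδ₀ : 0 < δ)
    (hδ₁ : δ ≤ 1) (hi : Integrable (fun ω => |Z ω| ^ (2 + δ)) P) (h0 : ∫ ω, Z ω ∂P = 0) :
    ‖∫ ω, Complex.exp (Z ω * Complex.I) ∂P - Complex.exp (((-(∫ ω, Z ω ^ 2 ∂P) / 2 : ℝ) : ℂ))‖ ≤
      4 * ∫ ω, |Z ω| ^ (2 + δ) ∂P + (∫ ω, Z ω ^ 2 ∂P) ^ 2 := by
  have h2 := integrable_sq_of_integrable_rpow hZ hδ₀ hi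
  have h1 := integrable_of_integrable_sq hZ.aestronglyMeasurable h2
  set s := ∫ ω, Z ω ^ 2 ∂P with hs
  have hs0 : 0 ≤ s := integral_nonneg fun ω => sq_nonneg _
  have he : Integrable (fun ω => Complex.exp (Z ω * Complex.I)) P := by
    refine (integrable_const (1 : ℝ)).mono' (by fun_prop) (ae_of_all _ fun ω => ?_)
    rw [Complex.norm_exp_ofReal_mul_I]
  have hI1 : Integrable (fun ω => (Z ω : ℂ) * Complex.I) P := h1.ofReal.mul_const _
  have hI2 : Integrable (fun ω => (Z ω : ℂ) ^ 2 / 2) P := by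
    have := (h2.ofReal (𝕜 := ℂ)).div_const 2
    simpa using this
  have hI3 : Integrable (fun ω => 1 + (Z ω : ℂ) * Complex.I) P := (integrable_const 1).add hI1
  have hI4 : Integrable (fun ω => 1 + (Z ω : ℂ) * Complex.I - (Z ω : ℂ) ^ 2 / 2) P := hI3.sub hI2
  have ht : ∫ ω, (1 + Z ω * Complex.I - (Z ω : ℂ) ^ 2 / 2) ∂P = ((1 - s / 2 : ℝ) : ℂ) := by
    rw [integral_sub hI3 hI2, integral_add (integrable_const 1) hI1,
      integral_mul_const, integral_div]
    have h3 : ∫ ω, (Z ω : ℂ) ∂P = 0 := by rw [integral_complex_ofReal, h0]; simp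
    have h4 : ∫ ω, (Z ω : ℂ) ^ 2 ∂P = (s : ℂ) := by
      rw [hs, ← integral_complex_ofReal]; simp
    rw [h3, h4]; simp
  have hA : ‖∫ ω, Complex.exp (Z ω * Complex.I) ∂P - ((1 - s / 2 : ℝ) : ℂ)‖ ≤
      4 * ∫ ω, |Z ω| ^ (2 + δ) ∂P := by
    rw [← ht, ← integral_sub he hI4, ← integral_const_mul]
    refine norm_integral_le_of_norm_le (hi.const_mul 4) (ae_of_all _ fun ω => ?_)
    exact norm_cexp_mul_I_sub_taylor_le hδ₀ hδ₁ (Z ω)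
  have hB : ‖((1 - s / 2 : ℝ) : ℂ) - Complex.exp ((-s / 2 : ℝ) : ℂ)‖ ≤ s ^ 2 := by
    rw [← Complex.ofReal_exp, ← Complex.ofReal_sub, Complex.norm_real, Real.norm_eq_abs]
    have h3 : 1 - s / 2 ≤ Real.exp (-s / 2) := by
      have := Real.add_one_le_exp (-s / 2); linarith
    have h4 : Real.exp (-s / 2) ≤ 1 := Real.exp_le_one_iff.2 (by linarith)
    rw [abs_le]
    refine ⟨?_, by nlinarith⟩
    rcases le_or_gt (s / 2) 1 with h | h
    · have h5 := Real.abs_exp_sub_one_sub_id_le (x := -s / 2)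
        (by rw [abs_le]; constructor <;> linarith)
      have := (abs_le.1 h5).2
      nlinarith
    · nlinarith
  calc _ ≤ _ := norm_sub_le_norm_sub_add_norm_sub _ ((1 - s / 2 : ℝ) : ℂ) _
    _ ≤ _ := add_le_add hA hB

/-- Lyapunov's theorem for arrays of row-wise independent centred variables, in terms of
characteristic functions. -/
theorem tendsto_integral_cexp_sum {ι : Type*} {l : Filter ι} (n : ι → ℕ) (ζ : ι → ℕ → Ω → ℝ)
    (hζ : ∀ i k, Measurable (ζ i k)) (hind : ∀ i, iIndepFun (ζ i) P)
    (h0 : ∀ i k, ∫ ω, ζ i k ω ∂P = 0) {δ : ℝ} (hδ₀ : 0 < δ) (hδ₁ : δ ≤ 1)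
    (hint : ∀ i k, Integrable (fun ω => |ζ i k ω| ^ (2 + δ)) P) {s : ℝ}
    (hs : Tendsto (fun i => ∑ k ∈ Finset.range (n i), ∫ ω, ζ i k ω ^ 2 ∂P) l (𝓝 s))
    (hs2 : Tendsto (fun i => ∑ k ∈ Finset.range (n i), (∫ ω, ζ i k ω ^ 2 ∂P) ^ 2) l (𝓝 0))
    (hl : Tendsto (fun i => ∑ k ∈ Finset.range (n i), ∫ ω, |ζ i k ω| ^ (2 + δ) ∂P) l (𝓝 0)) :
    Tendsto (fun i => ∫ ω, Complex.exp ((∑ k ∈ Finset.range (n i), ζ i k ω : ℝ) * Complex.I) ∂P) l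
      (𝓝 (Complex.exp ((-s / 2 : ℝ) : ℂ))) := by
  have hprod : ∀ i, ∫ ω, Complex.exp ((∑ k ∈ Finset.range (n i), ζ i k ω : ℝ) * Complex.I) ∂P =
      ∏ k ∈ Finset.range (n i), ∫ ω, Complex.exp (ζ i k ω * Complex.I) ∂P := by
    intro i
    have h1 := congrFun (((hind i).restrict _).charFun_map_fun_finsetSum_eq_prod
      (s := Finset.range (n i)) (X := ζ i) fun k _ => (hζ i k).aemeasurable) (1 : ℝ)
    rw [Finset.prod_apply] at h1
    simp_rw [charFun_apply_real] at h1
    rw [integral_map (by fun_prop) (by fun_prop)] at h1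
    simp only [Complex.ofReal_one, one_mul] at h1
    rw [h1]
    refine Finset.prod_congr rfl fun k _ => ?_
    rw [integral_map (by fun_prop) (by fun_prop)]
  have hexp : Tendsto (fun i => ∏ k ∈ Finset.range (n i),
      Complex.exp (((-(∫ ω, ζ i k ω ^ 2 ∂P) / 2 : ℝ) : ℂ))) l
      (𝓝 (Complex.exp ((-s / 2 : ℝ) : ℂ))) := by
    have h1 : ∀ i, ∏ k ∈ Finset.range (n i), Complex.exp (((-(∫ ω, ζ i k ω ^ 2 ∂P) / 2 : ℝ) : ℂ)) =
        Complex.exp ((-(∑ k ∈ Finset.range (n i), ∫ ω, ζ i k ω ^ 2 ∂P) / 2 : ℝ) : ℂ) := by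
      intro i
      rw [← Complex.exp_sum, ← Complex.ofReal_sum, ← Finset.sum_div, Finset.sum_neg_distrib]
    simp_rw [h1]
    exact (Complex.continuous_exp.tendsto _).comp
      ((Complex.continuous_ofReal.tendsto _).comp (hs.neg.div_const 2))
  simp_rw [hprod]
  have hdiff : Tendsto (fun i => ∏ k ∈ Finset.range (n i), ∫ ω, Complex.exp (ζ i k ω * Complex.I) ∂P -
      ∏ k ∈ Finset.range (n i), Complex.exp (((-(∫ ω, ζ i k ω ^ 2 ∂P) / 2 : ℝ) : ℂ))) l (𝓝 0) := by
    refine squeeze_zero_norm (fun i => ?_) (by simpa using (hl.const_mul 4).add hs2)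
    refine (norm_prod_sub_prod_le _ _ _ (fun k _ => ?_) fun k _ => ?_).trans ?_
    · refine (norm_integral_le_of_norm_le (integrable_const (1 : ℝ))
        (ae_of_all _ fun ω => (Complex.norm_exp_ofReal_mul_I _).le)).trans ?_
      simp
    · rw [← Complex.ofReal_exp, Complex.norm_real, Real.norm_of_nonneg (Real.exp_pos _).le,
        Real.exp_le_one_iff]
      have : 0 ≤ ∫ ω, ζ i k ω ^ 2 ∂P := integral_nonneg fun ω => sq_nonneg _
      linarith
    · rw [Finset.mul_sum, ← Finset.sum_add_distrib]
      exact Finset.sum_le_sum fun k _ =>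
        norm_integral_cexp_sub_exp_le (hζ i k) hδ₀ hδ₁ (hint i k) (h0 i k)
  simpa using hdiff.add hexp

end Lyapunov

/-! ### Stochastic approximation of a zero: confinement and mean square rate -/

section Confined

variable {Ω : Type*}

/-- The event that the error stays in `[-ρ, ρ]` between the times `N` and `n`. -/
def confined (e : ℕ → Ω → ℝ) (ρ : ℝ) (N n : ℕ) : Set Ω :=
  {ω | ∀ j, N ≤ j → j ≤ n → |e j ω| ≤ ρ}

lemma confined_succ {e : ℕ → Ω → ℝ} {ρ : ℝ} {N n : ℕ} (hn : N ≤ n) :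
    confined e ρ N (n + 1) = confined e ρ N n ∩ {ω | |e (n + 1) ω| ≤ ρ} := by
  ext ω
  simp only [confined, Set.mem_ofPred_eq, Set.mem_inter_iff]
  refine ⟨fun h => ⟨fun j hj hjn => h j hj (by omega), h _ (by omega) le_rfl⟩, fun h j hj hjn => ?_⟩
  rcases Nat.lt_or_ge j (n + 1) with h' | h'
  · exact h.1 j hj (by omega)
  · obtain rfl : j = n + 1 := by omega
    exact h.2

lemma confined_anti {e : ℕ → Ω → ℝ} {ρ : ℝ} {N m n : ℕ} (hmn : m ≤ n) :
    confined e ρ N n ⊆ confined e ρ N m := fun _ h j hj hjm => h j hj (hjm.trans hmn)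

end Confined

variable {Ω : Type*} [mΩ : MeasurableSpace Ω]

/-- The error process `e` of a stochastic approximation scheme with learning rate `stepSize γ₁ β`,
increments `H (e k) (X k)` and i.i.d. innovations `X k` of law `μ`, where `X k` is independent of the
past `ℱ k`. The increments are bounded by `B`, the mean field `∫ x, H e x ∂μ` points away from its
zero `e = 0` (constant `c`), has slope `a` there with a quadratic error (constant `L`), and `H` is
mean square Hölder continuous of order `1 / 2` at `e = 0` (constant `L`). The constants `B`, `c`,
`L`, `D` are meant to be uniform over a family of such processes. -/
structure IsErrorProcess (P : Measure Ω) (γ₁ β B c L D a : ℝ) (ℱ : Filtration ℕ mΩ)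
    (X : ℕ → Ω → ℝ) (μ : Measure ℝ) (H : ℝ → ℝ → ℝ) (e : ℕ → Ω → ℝ) : Prop where
  measurable_X : ∀ k, Measurable[ℱ (k + 1)] (X k)
  map_X : ∀ k, P.map (X k) = μ
  indep : ∀ k, Indep (ℱ k) (MeasurableSpace.comap (X k) inferInstance) P
  measurable_init : Measurable[ℱ 0] (e 0)
  measurable_H : Measurable (Function.uncurry H)
  succ : ∀ k ω, e (k + 1) ω = e k ω - stepSize γ₁ β (k + 1) * H (e k ω) (X k ω)
  bound : ∀ z x, |H z x| ≤ B
  drift : ∀ z, c * min (z ^ 2) |z| ≤ z * ∫ x, H z x ∂μ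
  linear : ∀ z, |∫ x, H z x ∂μ - a * z| ≤ L * z ^ 2
  noise : ∀ z, ∫ x, (H z x - H 0 x) ^ 2 ∂μ ≤ L * |z|
  integrable_init : Integrable (fun ω => e 0 ω ^ 2) P
  init_le : ∫ ω, e 0 ω ^ 2 ∂P ≤ D

lemma integrable_of_measurable_of_abs_le {P : Measure Ω} [IsFiniteMeasure P] {f : Ω → ℝ}
    (hf : Measurable f) (C : ℝ) (hC : ∀ ω, |f ω| ≤ C) : Integrable f P :=
  (integrable_const C).mono' hf.aestronglyMeasurable (ae_of_all _ hC)

/-- Freezing the past: an innovation that is independent of `m` is integrated out first. -/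
lemma integral_mul_comp_of_indep {Ω : Type*} {m mΩ : MeasurableSpace Ω} {P : Measure Ω}
    [IsProbabilityMeasure P] (hm : m ≤ mΩ)
    {X : Ω → ℝ} (hX : Measurable X) {μ : Measure ℝ} (hμ : P.map X = μ)
    (hind : Indep m (MeasurableSpace.comap X inferInstance) P) {Z U : Ω → ℝ}
    (hZ : Measurable[m] Z) (hU : Measurable[m] U) {F : ℝ → ℝ → ℝ}
    (hF : Measurable (Function.uncurry F))
    (hi : Integrable (fun ω => Z ω * F (U ω) (X ω)) P) :
    ∫ ω, Z ω * F (U ω) (X ω) ∂P = ∫ ω, Z ω * ∫ x, F (U ω) x ∂μ ∂P := by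
  have hZU : Measurable[m] fun ω => (Z ω, U ω) := hZ.prodMk hU
  have hZU' : Measurable fun ω => (Z ω, U ω) := hZU.mono hm le_rfl
  have hI : IndepFun (fun ω => (Z ω, U ω)) X P := by
    rw [IndepFun_iff_Indep]
    exact indep_of_indep_of_le_left hind hZU.comap_le
  have hprod := (indepFun_iff_map_prod_eq_prod_map_map hZU'.aemeasurable hX.aemeasurable).1 hI
  have hG : Measurable fun p : (ℝ × ℝ) × ℝ => p.1.1 * F p.1.2 p.2 :=
    (measurable_fst.comp measurable_fst).mul
      (hF.comp ((measurable_snd.comp measurable_fst).prodMk measurable_snd))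
  have : IsProbabilityMeasure (P.map X) := Measure.isProbabilityMeasure_map hX.aemeasurable
  have : IsProbabilityMeasure (P.map fun ω => (Z ω, U ω)) :=
    Measure.isProbabilityMeasure_map hZU'.aemeasurable
  have hi' : Integrable (fun p : (ℝ × ℝ) × ℝ => p.1.1 * F p.1.2 p.2)
      ((P.map fun ω => (Z ω, U ω)).prod (P.map X)) := by
    rw [← hprod, integrable_map_measure hG.aestronglyMeasurable (hZU'.prodMk hX).aemeasurable]
    exact hi
  have h1 : ∫ ω, Z ω * F (U ω) (X ω) ∂P =
      ∫ p, p.1.1 * F p.1.2 p.2 ∂((P.map fun ω => (Z ω, U ω)).prod (P.map X)) := by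
    rw [← hprod, integral_map (hZU'.prodMk hX).aemeasurable hG.aestronglyMeasurable]
  have hm2 : Measurable fun q : ℝ × ℝ => ∫ x, q.1 * F q.2 x ∂(P.map X) :=
    (hG.stronglyMeasurable.integral_prod_right').measurable
  rw [h1, integral_prod _ hi', integral_map hZU'.aemeasurable hm2.aestronglyMeasurable, ← hμ]
  simp_rw [integral_const_mul]

namespace IsErrorProcess

set_option linter.unusedSectionVars false

variable {P : Measure Ω} [IsProbabilityMeasure P] {γ₁ β B c L D a : ℝ} {ℱ : Filtration ℕ mΩ}
  {X : ℕ → Ω → ℝ} {μ : Measure ℝ} {H : ℝ → ℝ → ℝ} {e : ℕ → Ω → ℝ}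

lemma measurable_X' (h : IsErrorProcess P γ₁ β B c L D a ℱ X μ H e) (k : ℕ) : Measurable (X k) :=
  (h.measurable_X k).mono (ℱ.le _) le_rfl

lemma isProbabilityMeasure (h : IsErrorProcess P γ₁ β B c L D a ℱ X μ H e) :
    IsProbabilityMeasure μ := by
  rw [← h.map_X 0]; exact Measure.isProbabilityMeasure_map (h.measurable_X' 0).aemeasurable

lemma measurable (h : IsErrorProcess P γ₁ β B c L D a ℱ X μ H e) (k : ℕ) :
    Measurable[ℱ k] (e k) := by
  induction k with
  | zero => exact h.measurable_init
  | succ k ih =>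
    have h1 : Measurable[ℱ (k + 1)] (e k) := ih.mono (ℱ.mono (Nat.le_succ k)) le_rfl
    have h2 : e (k + 1) = fun ω => e k ω - stepSize γ₁ β (k + 1) * H (e k ω) (X k ω) :=
      funext fun ω => h.succ k ω
    rw [h2]
    exact h1.sub ((h.measurable_H.comp (h1.prodMk (h.measurable_X k))).const_mul _)

lemma measurable' (h : IsErrorProcess P γ₁ β B c L D a ℱ X μ H e) (k : ℕ) : Measurable (e k) :=
  (h.measurable k).mono (ℱ.le _) le_rfl

lemma integral_mul_comp (h : IsErrorProcess P γ₁ β B c L D a ℱ X μ H e) {k : ℕ} {Z U : Ω → ℝ}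
    (hZ : Measurable[ℱ k] Z) (hU : Measurable[ℱ k] U) {F : ℝ → ℝ → ℝ}
    (hF : Measurable (Function.uncurry F))
    (hi : Integrable (fun ω => Z ω * F (U ω) (X k ω)) P) :
    ∫ ω, Z ω * F (U ω) (X k ω) ∂P = ∫ ω, Z ω * ∫ x, F (U ω) x ∂μ ∂P :=
  integral_mul_comp_of_indep (ℱ.le k) (h.measurable_X' k) (h.map_X k) (h.indep k) hZ hU hF hi

lemma integrable_sq (h : IsErrorProcess P γ₁ β B c L D a ℱ X μ H e) (k : ℕ) :
    Integrable (fun ω => e k ω ^ 2) P := by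
  induction k with
  | zero => exact h.integrable_init
  | succ k ih =>
    refine ((ih.const_mul 2).add (integrable_const (2 * (stepSize γ₁ β (k + 1) * B) ^ 2))).mono'
      ((h.measurable' (k + 1)).pow_const 2).aestronglyMeasurable (ae_of_all _ fun ω => ?_)
    rw [Real.norm_of_nonneg (sq_nonneg _), h.succ, Pi.add_apply]
    have h1 : (stepSize γ₁ β (k + 1) * H (e k ω) (X k ω)) ^ 2 ≤ (stepSize γ₁ β (k + 1) * B) ^ 2 := by
      rw [mul_pow, mul_pow, ← sq_abs (H _ _)]
      have := h.bound (e k ω) (X k ω)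
      gcongr
    nlinarith [sq_nonneg (e k ω + stepSize γ₁ β (k + 1) * H (e k ω) (X k ω))]

lemma integrable (h : IsErrorProcess P γ₁ β B c L D a ℱ X μ H e) (k : ℕ) : Integrable (e k) P :=
  integrable_of_integrable_sq (h.measurable' k).aestronglyMeasurable (h.integrable_sq k)

lemma measurable_mean (h : IsErrorProcess P γ₁ β B c L D a ℱ X μ H e) :
    Measurable fun z => ∫ x, H z x ∂μ := by
  have := h.isProbabilityMeasure
  exact (h.measurable_H.stronglyMeasurable.integral_prod_right').measurable

lemma abs_mean_le (h : IsErrorProcess P γ₁ β B c L D a ℱ X μ H e) (z : ℝ) :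
    |∫ x, H z x ∂μ| ≤ B := by
  have := h.isProbabilityMeasure
  have h1 := norm_integral_le_of_norm_le (f := H z) (integrable_const B)
    (ae_of_all μ fun x => h.bound z x)
  simpa using h1

lemma nonneg_B (h : IsErrorProcess P γ₁ β B c L D a ℱ X μ H e) : 0 ≤ B :=
  (abs_nonneg _).trans (h.bound 0 0)

lemma integrable_mul_mean (h : IsErrorProcess P γ₁ β B c L D a ℱ X μ H e) (k : ℕ) :
    Integrable (fun ω => e k ω * ∫ x, H (e k ω) x ∂μ) P := by
  refine ((h.integrable k).norm.const_mul B).mono'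
    ((h.measurable' k).mul (h.measurable_mean.comp (h.measurable' k))).aestronglyMeasurable
    (ae_of_all _ fun ω => ?_)
  rw [norm_mul, mul_comm]
  exact mul_le_mul_of_nonneg_right (h.abs_mean_le _) (norm_nonneg _)

/-- The one step inequality for the mean square error on an event of the past. -/
lemma setIntegral_sq_succ_le (h : IsErrorProcess P γ₁ β B c L D a ℱ X μ H e) {k : ℕ} {A : Set Ω}
    (hA : MeasurableSet[ℱ k] A) :
    ∫ ω in A, e (k + 1) ω ^ 2 ∂P ≤ ∫ ω in A, e k ω ^ 2 ∂P -
      2 * stepSize γ₁ β (k + 1) * ∫ ω in A, e k ω * ∫ x, H (e k ω) x ∂μ ∂P +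
      stepSize γ₁ β (k + 1) ^ 2 * B ^ 2 := by
  have hA' : MeasurableSet A := ℱ.le k A hA
  have hmH : Measurable fun ω => H (e k ω) (X k ω) :=
    h.measurable_H.comp ((h.measurable' k).prodMk (h.measurable_X' k))
  have hi1 : Integrable (fun ω => e k ω * H (e k ω) (X k ω)) P := by
    refine ((h.integrable k).norm.const_mul B).mono'
      ((h.measurable' k).mul hmH).aestronglyMeasurable (ae_of_all _ fun ω => ?_)
    rw [norm_mul, mul_comm]
    exact mul_le_mul_of_nonneg_right (h.bound _ _) (norm_nonneg _)
  have hi2 : Integrable (fun ω => H (e k ω) (X k ω) ^ 2) P :=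
    integrable_of_measurable_of_abs_le (hmH.pow_const 2) (B ^ 2) fun ω => by
      rw [abs_pow]; have := h.bound (e k ω) (X k ω); gcongr
  have hcross : ∫ ω in A, e k ω * H (e k ω) (X k ω) ∂P =
      ∫ ω in A, e k ω * ∫ x, H (e k ω) x ∂μ ∂P := by
    have h1 := h.integral_mul_comp (Z := A.indicator (e k)) ((h.measurable k).indicator hA)
      (h.measurable k) h.measurable_H (by
        refine (hi1.indicator hA').congr (ae_of_all _ fun ω => ?_)
        by_cases hω : ω ∈ A <;> simp [hω])
    rw [← integral_indicator hA', ← integral_indicator hA']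
    convert h1 using 2 <;> ext ω <;> by_cases hω : ω ∈ A <;> simp [hω]
  have hexp : ∫ ω in A, e (k + 1) ω ^ 2 ∂P = ∫ ω in A, e k ω ^ 2 ∂P -
      2 * stepSize γ₁ β (k + 1) * ∫ ω in A, e k ω * H (e k ω) (X k ω) ∂P +
      stepSize γ₁ β (k + 1) ^ 2 * ∫ ω in A, H (e k ω) (X k ω) ^ 2 ∂P := by
    rw [← integral_const_mul, ← integral_const_mul, ← integral_sub, ← integral_add]
    · refine integral_congr_ae (ae_of_all _ fun ω => ?_)
      simp only [h.succ]; ring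
    · exact (((h.integrable_sq k).integrableOn).sub ((hi1.integrableOn).const_mul _))
    · exact (hi2.integrableOn).const_mul _
    · exact (h.integrable_sq k).integrableOn
    · exact (hi1.integrableOn).const_mul _
  rw [hexp, hcross]
  gcongr
  calc ∫ ω in A, H (e k ω) (X k ω) ^ 2 ∂P ≤ ∫ ω, H (e k ω) (X k ω) ^ 2 ∂P :=
        setIntegral_le_integral hi2 (ae_of_all _ fun ω => sq_nonneg _)
    _ ≤ ∫ _, B ^ 2 ∂P := by
      refine integral_mono hi2 (integrable_const _) fun ω => ?_
      have := h.bound (e k ω) (X k ω)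
      show H (e k ω) (X k ω) ^ 2 ≤ B ^ 2
      rw [← sq_abs]; gcongr
    _ = B ^ 2 := by simp

lemma mean_nonneg (h : IsErrorProcess P γ₁ β B c L D a ℱ X μ H e) (hc : 0 ≤ c) (z : ℝ) :
    0 ≤ z * ∫ x, H z x ∂μ :=
  le_trans (mul_nonneg hc (le_min (sq_nonneg _) (abs_nonneg _))) (h.drift z)

/-- Telescoping the one step inequality: the accumulated drift is bounded. -/
lemma sum_drift_le (h : IsErrorProcess P γ₁ β B c L D a ℱ X μ H e) (n : ℕ) :
    ∫ ω, e n ω ^ 2 ∂P + 2 * ∑ k ∈ Finset.range n, stepSize γ₁ β (k + 1) *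
      ∫ ω, e k ω * ∫ x, H (e k ω) x ∂μ ∂P ≤
        D + B ^ 2 * ∑ k ∈ Finset.range n, stepSize γ₁ β (k + 1) ^ 2 := by
  induction n with
  | zero => simpa using h.init_le
  | succ n ih =>
    have h1 := h.setIntegral_sq_succ_le (k := n) MeasurableSet.univ
    simp only [setIntegral_univ] at h1
    rw [Finset.sum_range_succ, Finset.sum_range_succ]
    linarith

lemma integral_sq_le (h : IsErrorProcess P γ₁ β B c L D a ℱ X μ H e) (hc : 0 ≤ c) (hγ₁ : 0 < γ₁)
    (hβ₀ : 1 / 2 < β) (n : ℕ) :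
    ∫ ω, e n ω ^ 2 ∂P ≤ D + B ^ 2 * ∑' k, stepSize γ₁ β (k + 1) ^ 2 := by
  have h1 := h.sum_drift_le n
  have h2 : 0 ≤ ∑ k ∈ Finset.range n, stepSize γ₁ β (k + 1) *
      ∫ ω, e k ω * ∫ x, H (e k ω) x ∂μ ∂P :=
    Finset.sum_nonneg fun k _ => mul_nonneg (stepSize_pos hγ₁ (by omega)).le
      (integral_nonneg fun ω => h.mean_nonneg hc _)
  have h3 : ∑ k ∈ Finset.range n, stepSize γ₁ β (k + 1) ^ 2 ≤ ∑' k, stepSize γ₁ β (k + 1) ^ 2 :=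
    (summable_stepSize_sq hβ₀).sum_le_tsum _ fun _ _ => sq_nonneg _
  nlinarith [sq_nonneg B]

lemma measureReal_lt_abs_le (h : IsErrorProcess P γ₁ β B c L D a ℱ X μ H e) (hc : 0 < c)
    {r : ℝ} (hr : 0 < r) (k : ℕ) :
    c * min (r ^ 2) r * P.real {ω | r < |e k ω|} ≤
      ∫ ω, e k ω * ∫ x, H (e k ω) x ∂μ ∂P := by
  have hms : MeasurableSet {ω | r < |e k ω|} := measurableSet_lt measurable_const (h.measurable' k).abs
  calc c * min (r ^ 2) r * P.real {ω | r < |e k ω|}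
      = ∫ ω, ({ω | r < |e k ω|}.indicator (fun _ => c * min (r ^ 2) r)) ω ∂P := by
        rw [integral_indicator_const _ hms, smul_eq_mul, mul_comm]
    _ ≤ _ := by
      refine integral_mono ((integrable_const _).indicator hms) (h.integrable_mul_mean k) fun ω => ?_
      by_cases hω : r < |e k ω|
      · simp only [Set.indicator, Set.mem_ofPred_eq, hω, if_true]
        refine le_trans ?_ (h.drift _)
        rw [← sq_abs (e k ω)]
        gcongr
      · simp only [Set.indicator, Set.mem_ofPred_eq, hω, if_false]
        exact h.mean_nonneg hc.le _

lemma measurableSet_confined (h : IsErrorProcess P γ₁ β B c L D a ℱ X μ H e) (ρ : ℝ) (N n : ℕ) :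
    MeasurableSet[ℱ n] (confined e ρ N n) := by
  have : confined e ρ N n = ⋂ j, ⋂ (_ : N ≤ j), ⋂ (_ : j ≤ n), {ω | |e j ω| ≤ ρ} := by
    ext ω; simp [confined]
  rw [this]
  refine MeasurableSet.iInter fun j => MeasurableSet.iInter fun _ => MeasurableSet.iInter fun hj => ?_
  have h1 : Measurable[ℱ n] (e j) := (h.measurable j).mono (ℱ.mono hj) le_rfl
  have h2 : {ω | |e j ω| ≤ ρ} = e j ⁻¹' {z | |z| ≤ ρ} := rfl
  rw [h2]
  exact h1 (measurableSet_le measurable_id.abs measurable_const)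

/-- The maximal inequality: started in `[-r, r]` at time `N`, the error leaves `[-ρ, ρ]` with
probability at most `(r ^ 2 + B ^ 2 * ∑ γ ^ 2) / ρ ^ 2`. -/
lemma measureReal_exit_le (h : IsErrorProcess P γ₁ β B c L D a ℱ X μ H e) (hc : 0 < c)
    (hγ₁ : 0 < γ₁) {r ρ : ℝ} (hr : 0 < r) (hrρ : r ≤ ρ) {N n : ℕ} (hn : N ≤ n) :
    ρ ^ 2 * P.real ({ω | |e N ω| ≤ r} \ confined e ρ N n) ≤
      r ^ 2 + B ^ 2 * ∑ k ∈ Finset.Ico N n, stepSize γ₁ β (k + 1) ^ 2 := by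
  have hS : MeasurableSet[ℱ N] {ω | |e N ω| ≤ r} :=
    h.measurable N (measurableSet_le measurable_id.abs measurable_const)
  have hS' : MeasurableSet {ω | |e N ω| ≤ r} := ℱ.le N _ hS
  set S := {ω | |e N ω| ≤ r} with hSdef
  have hρ : 0 < ρ := hr.trans_le hrρ
  suffices hkey : ∫ ω in S ∩ confined e ρ N n, e n ω ^ 2 ∂P +
      ρ ^ 2 * P.real (S \ confined e ρ N n) ≤
      r ^ 2 + B ^ 2 * ∑ k ∈ Finset.Ico N n, stepSize γ₁ β (k + 1) ^ 2 by
    have : 0 ≤ ∫ ω in S ∩ confined e ρ N n, e n ω ^ 2 ∂P := integral_nonneg fun ω => sq_nonneg _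
    linarith
  induction n, hn using Nat.le_induction with
  | base =>
    have h1 : S ⊆ confined e ρ N N := fun ω hω j hj hjN => by
      obtain rfl : j = N := le_antisymm hjN hj
      exact le_trans hω hrρ
    rw [Set.inter_eq_left.2 h1, Set.sdiff_eq_empty.2 h1]
    simp only [measureReal_empty, mul_zero, add_zero, Finset.Ico_self, Finset.sum_empty]
    calc ∫ ω in S, e N ω ^ 2 ∂P ≤ ∫ ω in S, r ^ 2 ∂P := by
          refine setIntegral_mono_on (h.integrable_sq N).integrableOn
            (integrable_const _).integrableOn hS' fun ω hω => ?_
          rw [← sq_abs]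
          have : |e N ω| ≤ r := hω
          gcongr
      _ ≤ r ^ 2 := by
        rw [setIntegral_const, smul_eq_mul]
        exact mul_le_of_le_one_left (sq_nonneg _) measureReal_le_one
  | succ n hn ih =>
    have hC := h.measurableSet_confined ρ N n
    have hC' : MeasurableSet (confined e ρ N n) := ℱ.le n _ hC
    have hC1 := ℱ.le (n + 1) _ (h.measurableSet_confined ρ N (n + 1))
    have hA : MeasurableSet[ℱ n] (S ∩ confined e ρ N n) := (ℱ.mono hn _ hS).inter hC
    have hA' := ℱ.le n _ hA
    set A := S ∩ confined e ρ N n with hAdef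
    have hstep := h.setIntegral_sq_succ_le hA
    have hdrift : 0 ≤ ∫ ω in A, e n ω * ∫ x, H (e n ω) x ∂μ ∂P :=
      integral_nonneg fun ω => h.mean_nonneg hc.le _
    have hγ := (stepSize_pos (β := β) hγ₁ (show 1 ≤ n + 1 by omega)).le
    -- on the exit event at time `n + 1` the square exceeds `ρ ^ 2`
    have hsplit : ∫ ω in S ∩ confined e ρ N (n + 1), e (n + 1) ω ^ 2 ∂P +
        ρ ^ 2 * P.real (A \ confined e ρ N (n + 1)) ≤ ∫ ω in A, e (n + 1) ω ^ 2 ∂P := by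
      have h1 : A ∩ confined e ρ N (n + 1) = S ∩ confined e ρ N (n + 1) := by
        rw [hAdef, Set.inter_assoc, Set.inter_eq_right.2 (confined_anti (Nat.le_succ n))]
      rw [← integral_inter_add_sdiff (s := A) hC1 (h.integrable_sq (n + 1)).integrableOn, h1]
      gcongr
      rw [mul_comm, ← smul_eq_mul, ← setIntegral_const]
      refine setIntegral_mono_on (integrable_const _).integrableOn
        (h.integrable_sq (n + 1)).integrableOn (hA'.diff hC1) fun ω hω => ?_
      have h2 : ¬ |e (n + 1) ω| ≤ ρ := fun h3 => hω.2 (by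
        rw [confined_succ hn]; exact ⟨hω.1.2, h3⟩)
      rw [← sq_abs (e _ _)]
      have := not_le.1 h2
      gcongr
    have hunion : P.real (S \ confined e ρ N (n + 1)) ≤
        P.real (S \ confined e ρ N n) + P.real (A \ confined e ρ N (n + 1)) := by
      refine le_trans (measureReal_mono ?_) (measureReal_union_le _ _)
      intro ω hω
      by_cases h' : ω ∈ confined e ρ N n
      · exact Or.inr ⟨⟨hω.1, h'⟩, hω.2⟩
      · exact Or.inl ⟨hω.1, h'⟩
    rw [Finset.sum_Ico_succ_top hn]
    have h3 : ρ ^ 2 * P.real (S \ confined e ρ N (n + 1)) ≤ ρ ^ 2 *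
        (P.real (S \ confined e ρ N n) + P.real (A \ confined e ρ N (n + 1))) := by gcongr
    have h4 : 0 ≤ 2 * stepSize γ₁ β (n + 1) * ∫ ω in A, e n ω * ∫ x, H (e n ω) x ∂μ ∂P := by
      positivity
    linarith

/-- At some time in a window `[N₁, N₂]` that does not depend on the process, the error is small in
probability. -/
lemma exists_measureReal_lt_abs_le (hγ₁ : 0 < γ₁) (hβ₀ : 1 / 2 < β) (hβ₁ : β ≤ 1) (hc : 0 < c)
    (B L D : ℝ) {r ε : ℝ} (hr : 0 < r) (hε : 0 < ε) (N₁ : ℕ) :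
    ∃ N₂, ∀ a ℱ X μ H e, IsErrorProcess P γ₁ β B c L D a ℱ X μ H e →
      ∃ n, N₁ ≤ n ∧ n ≤ N₂ ∧ P.real {ω | r < |e n ω|} ≤ ε := by
  set κ := c * min (r ^ 2) r with hκ
  have hκ0 : 0 < κ := by positivity
  have ht := (tendsto_sum_stepSize hγ₁ hβ₁).eventually_gt_atTop
    ((D + B ^ 2 * ∑' k, stepSize γ₁ β (k + 1) ^ 2) / (2 * κ * ε) +
      ∑ i ∈ Finset.range N₁, stepSize γ₁ β (i + 1))
  obtain ⟨N₂, hN₂, hN₂1⟩ := (ht.and (eventually_ge_atTop N₁)).exists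
  refine ⟨N₂, fun a ℱ X μ H e h => ?_⟩
  by_contra! hcon
  have h1 := h.sum_drift_le N₂
  have h0 : 0 ≤ ∫ ω, e N₂ ω ^ 2 ∂P := integral_nonneg fun ω => sq_nonneg _
  have h3 : ∑ k ∈ Finset.range N₂, stepSize γ₁ β (k + 1) ^ 2 ≤ ∑' k, stepSize γ₁ β (k + 1) ^ 2 :=
    (summable_stepSize_sq hβ₀).sum_le_tsum _ fun _ _ => sq_nonneg _
  have hpos : ∀ k, 0 ≤ stepSize γ₁ β (k + 1) := fun k => (stepSize_pos hγ₁ (by omega)).le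
  have h4 : κ * ε * ∑ k ∈ Finset.Ico N₁ N₂, stepSize γ₁ β (k + 1) ≤
      ∑ k ∈ Finset.range N₂, stepSize γ₁ β (k + 1) * ∫ ω, e k ω * ∫ x, H (e k ω) x ∂μ ∂P := by
    rw [Finset.mul_sum, Finset.range_eq_Ico]
    refine le_trans (Finset.sum_le_sum fun k hk => ?_)
      (Finset.sum_le_sum_of_subset_of_nonneg (Finset.Ico_subset_Ico_left (Nat.zero_le N₁))
        fun k _ _ => mul_nonneg (hpos k) (integral_nonneg fun ω => h.mean_nonneg hc.le _))
    rw [mul_comm]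
    refine mul_le_mul_of_nonneg_left (le_trans ?_ (h.measureReal_lt_abs_le hc hr k)) (hpos k)
    have h5 := hcon k (Finset.mem_Ico.1 hk).1 (Finset.mem_Ico.1 hk).2.le
    exact mul_le_mul_of_nonneg_left h5.le hκ0.le
  rw [Finset.sum_Ico_eq_sub _ hN₂1] at h4
  rw [← lt_sub_iff_add_lt, div_lt_iff₀ (by positivity)] at hN₂
  nlinarith [sq_nonneg B]

/-- With high probability, the error is eventually confined to a given neighbourhood of zero, from
a time on that does not depend on the process. -/
lemma exists_measureReal_compl_confined_le (hγ₁ : 0 < γ₁) (hβ₀ : 1 / 2 < β) (hβ₁ : β ≤ 1)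
    (hc : 0 < c) (B L D : ℝ) {ρ ε : ℝ} (hρ : 0 < ρ) (hε : 0 < ε) (N₀ : ℕ) :
    ∃ N, N₀ ≤ N ∧ ∀ a ℱ X μ H e, IsErrorProcess P γ₁ β B c L D a ℱ X μ H e →
      ∀ n, N ≤ n → P.real (confined e ρ N n)ᶜ ≤ ε := by
  -- the three sources of error are made smaller than `ε / 3`
  set r := ρ * min 1 (√(ε / 3)) with hrdef
  have hr : 0 < r := by positivity
  have hrρ : r ≤ ρ := mul_le_of_le_one_right hρ.le (min_le_left _ _)
  have hr2 : r ^ 2 ≤ ρ ^ 2 * (ε / 3) := by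
    rw [hrdef, mul_pow]
    gcongr
    calc (min 1 √(ε / 3)) ^ 2 ≤ √(ε / 3) ^ 2 := by gcongr; exact min_le_right _ _
      _ = ε / 3 := Real.sq_sqrt (by positivity)
  have htail : Tendsto (fun N => B ^ 2 * ∑' k, stepSize γ₁ β (k + N + 1) ^ 2) atTop (𝓝 0) := by
    simpa using (tendsto_sum_nat_add fun k => stepSize γ₁ β (k + 1) ^ 2).const_mul (B ^ 2)
  have hev := htail.eventually (ge_mem_nhds (show 0 < ρ ^ 2 * (ε / 3) by positivity))
  obtain ⟨N₁, hN₁, hN₁0⟩ := (hev.and (eventually_ge_atTop N₀)).exists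
  obtain ⟨N₂, hN₂⟩ := exists_measureReal_lt_abs_le (P := P) hγ₁ hβ₀ hβ₁ hc B L D hr
    (show 0 < ε / 3 by positivity) N₁
  refine ⟨max N₁ N₂, hN₁0.trans (le_max_left _ _), fun a ℱ X μ H e h n hn => ?_⟩
  obtain ⟨n₀, hn₀1, hn₀2, hn₀⟩ := hN₂ a ℱ X μ H e h
  have hn₀N : n₀ ≤ max N₁ N₂ := hn₀2.trans (le_max_right _ _)
  have hexit := h.measureReal_exit_le hc hγ₁ hr hrρ (hn₀N.trans hn)
  have hsum : ∑ k ∈ Finset.Ico n₀ n, stepSize γ₁ β (k + 1) ^ 2 ≤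
      ∑' k, stepSize γ₁ β (k + N₁ + 1) ^ 2 := by
    have h1 : ∑ k ∈ Finset.Ico n₀ n, stepSize γ₁ β (k + 1) ^ 2 ≤
        ∑ k ∈ Finset.Ico N₁ n, stepSize γ₁ β (k + 1) ^ 2 :=
      Finset.sum_le_sum_of_subset_of_nonneg (Finset.Ico_subset_Ico_left hn₀1)
        fun _ _ _ => sq_nonneg _
    refine h1.trans ?_
    rw [Finset.sum_Ico_eq_sum_range]
    simp_rw [add_comm N₁]
    refine Summable.sum_le_tsum (f := fun k => stepSize γ₁ β (k + N₁ + 1) ^ 2) _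
      (fun _ _ => sq_nonneg _) ?_
    exact (summable_nat_add_iff (f := fun k => stepSize γ₁ β (k + 1) ^ 2) N₁).2
      (summable_stepSize_sq hβ₀)
  have hexit' : P.real ({ω | |e n₀ ω| ≤ r} \ confined e ρ n₀ n) ≤ 2 * (ε / 3) := by
    have h1 : B ^ 2 * ∑ k ∈ Finset.Ico n₀ n, stepSize γ₁ β (k + 1) ^ 2 ≤ ρ ^ 2 * (ε / 3) :=
      le_trans (by gcongr) hN₁
    have h2 : 0 < ρ ^ 2 := by positivity
    refine le_of_mul_le_mul_left ?_ h2
    linarith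
  calc P.real (confined e ρ (max N₁ N₂) n)ᶜ
      ≤ P.real ({ω | r < |e n₀ ω|} ∪ ({ω | |e n₀ ω| ≤ r} \ confined e ρ n₀ n)) := by
        refine measureReal_mono fun ω hω => ?_
        by_cases h1 : r < |e n₀ ω|
        · exact Or.inl h1
        · refine Or.inr ⟨not_lt.1 h1, fun h2 => hω fun j hj hjn => h2 j (hn₀N.trans hj) hjn⟩
    _ ≤ ε / 3 + 2 * (ε / 3) := (measureReal_union_le _ _).trans (add_le_add hn₀ hexit')
    _ = ε := by ring

/-- On the confinement event, the mean square error is of the order of the step size. -/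
lemma exists_setIntegral_sq_le (hγ₁ : 0 < γ₁) (hβ₀ : 1 / 2 < β) (hβ₁ : β ≤ 1) {a₀ : ℝ}
    (ha₀ : 0 < a₀) (h1 : β = 1 → 1 < a₀ * γ₁) (B c D : ℝ) {L ρ : ℝ}
    (hρL : L * ρ ≤ a₀ / 2) :
    ∃ N₀, 1 ≤ N₀ ∧ ∀ N, N₀ ≤ N → ∃ C, 0 ≤ C ∧ ∀ a ℱ X μ H e, a₀ ≤ a →
      IsErrorProcess P γ₁ β B c L D a ℱ X μ H e →
      ∀ n, N ≤ n → ∫ ω in confined e ρ N n, e n ω ^ 2 ∂P ≤ C * stepSize γ₁ β n := by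
  have hβ : 0 < β := by linarith
  obtain ⟨c', hc', N₀, hN₀1, hN₀⟩ := exists_contraction_rate hγ₁ hβ hβ₁ ha₀ h1
  refine ⟨N₀, hN₀1, fun N hN => ?_⟩
  obtain ⟨C, hC0, hC⟩ := exists_forall_le_mul_of_contraction_of_bounded (B := B ^ 2)
    (g := fun n => stepSize γ₁ β (n + 1)) (s := fun n => stepSize γ₁ β n) hc'
    (fun n => (stepSize_pos hγ₁ (by omega)).le) N (fun n hn => (hN₀ n (hN.trans hn)).1)
    (fun n hn => stepSize_pos hγ₁ (hN₀1.trans (hN.trans hn)))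
    (fun n hn => (hN₀ n (hN.trans hn)).2.2) (ρ ^ 2)
  refine ⟨C, hC0, fun a ℱ X μ H e ha h n hn => ?_⟩
  have hmeas : ∀ n, MeasurableSet (confined e ρ N n) := fun n =>
    ℱ.le n _ (h.measurableSet_confined ρ N n)
  refine hC (fun n => ∫ ω in confined e ρ N n, e n ω ^ 2 ∂P)
    (fun n => integral_nonneg fun ω => sq_nonneg _) ?_ (fun n hn => ?_) n hn
  · calc ∫ ω in confined e ρ N N, e N ω ^ 2 ∂P ≤ ∫ ω in confined e ρ N N, ρ ^ 2 ∂P := by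
          refine setIntegral_mono_on (h.integrable_sq N).integrableOn
            (integrable_const _).integrableOn (hmeas N) fun ω hω => ?_
          rw [← sq_abs]
          have : |e N ω| ≤ ρ := hω N le_rfl le_rfl
          gcongr
      _ ≤ ρ ^ 2 := by
        rw [setIntegral_const, smul_eq_mul]
        exact mul_le_of_le_one_left (sq_nonneg _) measureReal_le_one
  · have hγ := (stepSize_pos (β := β) hγ₁ (show 1 ≤ n + 1 by omega)).le
    have h2 : ∫ ω in confined e ρ N (n + 1), e (n + 1) ω ^ 2 ∂P ≤
        ∫ ω in confined e ρ N n, e (n + 1) ω ^ 2 ∂P :=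
      setIntegral_mono_set (h.integrable_sq (n + 1)).integrableOn
        (ae_of_all _ fun ω => sq_nonneg _) (ae_of_all _ (confined_anti (Nat.le_succ n)))
    have h3 := h.setIntegral_sq_succ_le (h.measurableSet_confined ρ N n)
    have h4 : a₀ / 2 * ∫ ω in confined e ρ N n, e n ω ^ 2 ∂P ≤
        ∫ ω in confined e ρ N n, e n ω * ∫ x, H (e n ω) x ∂μ ∂P := by
      rw [← integral_const_mul]
      refine setIntegral_mono_on ((h.integrable_sq n).const_mul _).integrableOn
        (h.integrable_mul_mean n).integrableOn (hmeas n) fun ω hω => ?_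
      have h5 : |e n ω| ≤ ρ := hω n hn le_rfl
      have h6 := h.linear (e n ω)
      have h7 : |e n ω * (∫ x, H (e n ω) x ∂μ - a * e n ω)| ≤ L * ρ * e n ω ^ 2 := by
        rw [abs_mul]
        calc _ ≤ ρ * (L * e n ω ^ 2) := by gcongr; exact (abs_nonneg _).trans h5
          _ = _ := by ring
      have h8 := (abs_le.1 h7).1
      have h9 := sq_nonneg (e n ω)
      nlinarith
    have h5 : 2 * stepSize γ₁ β (n + 1) * (a₀ / 2 * ∫ ω in confined e ρ N n, e n ω ^ 2 ∂P) ≤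
        2 * stepSize γ₁ β (n + 1) *
          ∫ ω in confined e ρ N n, e n ω * ∫ x, H (e n ω) x ∂μ ∂P := by gcongr
    refine (h2.trans h3).trans ?_
    linarith

end IsErrorProcess

/-! ### Linearisation of the error process -/

/-- The solution of `x (n + 1) = p n * x n + y n`, `n ≥ N`, with `x n = x₀` for `n ≤ N`. -/
def linRec (p y : ℕ → ℝ) (x₀ : ℝ) (N : ℕ) : ℕ → ℝ
  | 0 => x₀
  | n + 1 => if n < N then x₀ else p n * linRec p y x₀ N n + y n

lemma linRec_self (p y : ℕ → ℝ) (x₀ : ℝ) (N : ℕ) : linRec p y x₀ N N = x₀ := by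
  cases N <;> simp [linRec]

lemma linRec_succ (p y : ℕ → ℝ) (x₀ : ℝ) {N n : ℕ} (hn : N ≤ n) :
    linRec p y x₀ N (n + 1) = p n * linRec p y x₀ N n + y n := by
  simp [linRec, not_lt.2 hn]

lemma stepSize_le_two_mul {γ₁ β : ℝ} (hγ₁ : 0 < γ₁) (hβ₁ : β ≤ 1) {n : ℕ} (hn : 1 ≤ n) :
    stepSize γ₁ β n ≤ 2 * stepSize γ₁ β (n + 1) := by
  have h1 : (1 : ℝ) ≤ n := by exact_mod_cast hn
  have h0 : 1 / (n : ℝ) ≤ 1 := by rw [div_le_one (by linarith)]; exact h1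
  have h3 : 0 < 1 / (n : ℝ) := by positivity
  rw [← div_le_iff₀ (stepSize_pos hγ₁ (by omega)), stepSize_div hγ₁ hn]
  calc (1 + 1 / (n : ℝ)) ^ β ≤ (1 + 1 / (n : ℝ)) ^ (1 : ℝ) :=
        Real.rpow_le_rpow_of_exponent_le (by linarith) hβ₁
    _ ≤ 2 := by rw [Real.rpow_one]; linarith

/-- Kronecker's lemma for the step sizes: since their squares are summable, their partial sums are
of smaller order than `√n`. -/
lemma tendsto_sum_stepSize_div_sqrt {γ₁ β : ℝ} (hγ₁ : 0 < γ₁) (hβ₀ : 1 / 2 < β) :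
    Tendsto (fun n : ℕ => (∑ k ∈ Finset.range n, stepSize γ₁ β k) / √n) atTop (𝓝 0) := by
  have hpos : ∀ k, 0 ≤ stepSize γ₁ β k := fun k =>
    mul_nonneg hγ₁.le (Real.rpow_nonneg (Nat.cast_nonneg _) _)
  have hsum : Summable fun k => stepSize γ₁ β k ^ 2 :=
    (summable_nat_add_iff (f := fun k => stepSize γ₁ β k ^ 2) 1).1 (summable_stepSize_sq hβ₀)
  rw [Metric.tendsto_atTop]
  intro ε hε
  have htail := tendsto_sum_nat_add fun k => stepSize γ₁ β k ^ 2
  obtain ⟨m, hm⟩ := (htail.eventually (ge_mem_nhds (show 0 < (ε / 4) ^ 2 by positivity))).exists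
  have hsq : Tendsto (fun n : ℕ => (∑ k ∈ Finset.range m, stepSize γ₁ β k) / √n) atTop (𝓝 0) :=
    tendsto_const_nhds.div_atTop (Real.tendsto_sqrt_atTop.comp tendsto_natCast_atTop_atTop)
  obtain ⟨M, hM⟩ := eventually_atTop.1 (hsq.eventually (ge_mem_nhds (show 0 < ε / 4 by positivity)))
  refine ⟨max (max m M) 1, fun n hn => ?_⟩
  have hmn : m ≤ n := (le_max_left _ _).trans ((le_max_left _ _).trans hn)
  have hMn : M ≤ n := (le_max_right _ _).trans ((le_max_left _ _).trans hn)
  have hn1 : 1 ≤ n := (le_max_right _ _).trans hn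
  have hnp : (0 : ℝ) < √n := Real.sqrt_pos.2 (by exact_mod_cast hn1)
  rw [Real.dist_eq, sub_zero, abs_of_nonneg
    (div_nonneg (Finset.sum_nonneg fun k _ => hpos k) hnp.le)]
  have h1 := hM n hMn
  have h2 : ∑ k ∈ Finset.range n, stepSize γ₁ β k = ∑ k ∈ Finset.range m, stepSize γ₁ β k +
      ∑ k ∈ Finset.Ico m n, stepSize γ₁ β k := (Finset.sum_range_add_sum_Ico _ hmn).symm
  have h3 : ∑ k ∈ Finset.Ico m n, stepSize γ₁ β k ≤ ε / 4 * √n := by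
    refine (sq_le_sq₀ (Finset.sum_nonneg fun k _ => hpos k) (by positivity)).1 ?_
    calc (∑ k ∈ Finset.Ico m n, stepSize γ₁ β k) ^ 2
        ≤ (Finset.Ico m n).card * ∑ k ∈ Finset.Ico m n, stepSize γ₁ β k ^ 2 :=
          sq_sum_le_card_mul_sum_sq
      _ ≤ n * (ε / 4) ^ 2 := by
        gcongr
        · simp
        · refine le_trans ?_ hm
          rw [Finset.sum_Ico_eq_sum_range]
          simp_rw [add_comm m]
          exact Summable.sum_le_tsum (f := fun k => stepSize γ₁ β (k + m) ^ 2) _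
            (fun _ _ => sq_nonneg _) ((summable_nat_add_iff m).2 hsum)
      _ = (ε / 4 * √n) ^ 2 := by rw [mul_pow, Real.sq_sqrt (Nat.cast_nonneg n)]; ring
  rw [h2, add_div]
  have h4 : (∑ k ∈ Finset.Ico m n, stepSize γ₁ β k) / √n ≤ ε / 4 := by
    rw [div_le_iff₀ hnp]; exact h3
  linarith

section Markov

variable {Ω : Type*} [MeasurableSpace Ω] {P : Measure Ω} [IsProbabilityMeasure P]

lemma measureReal_lt_le_div {f : Ω → ℝ} (hf : ∀ ω, 0 ≤ f ω) (hi : Integrable f P) {t : ℝ}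
    (ht : 0 < t) : P.real {ω | t < f ω} ≤ (∫ ω, f ω ∂P) / t := by
  rw [le_div_iff₀ ht, mul_comm]
  refine le_trans (mul_le_mul_of_nonneg_left (measureReal_mono fun ω hω => ?_) ht.le)
    (mul_meas_ge_le_integral_of_nonneg (ae_of_all _ hf) hi t)
  have : t < f ω := hω
  exact this.le

lemma measureReal_lt_abs_le_div_sq {f : Ω → ℝ} (hi : Integrable (fun ω => f ω ^ 2) P) {t : ℝ}
    (ht : 0 < t) : P.real {ω | t < |f ω|} ≤ (∫ ω, f ω ^ 2 ∂P) / t ^ 2 := by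
  refine le_trans (measureReal_mono fun ω hω => ?_)
    (measureReal_lt_le_div (fun ω => sq_nonneg (f ω)) hi (show 0 < t ^ 2 by positivity))
  show t ^ 2 < f ω ^ 2
  rw [← sq_abs (f ω)]
  have : t < |f ω| := hω
  gcongr

end Markov

namespace IsErrorProcess

set_option linter.unusedSectionVars false

variable {Ω : Type*} [mΩ : MeasurableSpace Ω]
  {P : Measure Ω} [IsProbabilityMeasure P] {γ₁ β B c L D a : ℝ} {ℱ : Filtration ℕ mΩ}
  {X : ℕ → Ω → ℝ} {μ : Measure ℝ} {H : ℝ → ℝ → ℝ} {e : ℕ → Ω → ℝ}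

lemma measurable_indicator_comp (h : IsErrorProcess P γ₁ β B c L D a ℱ X μ H e) {n : ℕ}
    {A : Set Ω} (hA : MeasurableSet[ℱ n] A) {F : ℝ → ℝ → ℝ} (hF : Measurable (Function.uncurry F)) :
    Measurable[ℱ (n + 1)] (A.indicator fun ω => F (e n ω) (X n ω)) := by
  have h1 : Measurable[ℱ (n + 1)] (e n) := (h.measurable n).mono (ℱ.mono (Nat.le_succ n)) le_rfl
  exact (hF.comp (h1.prodMk (h.measurable_X n))).indicator (ℱ.mono (Nat.le_succ n) _ hA)

/-- Orthogonality of a centred increment to the past. -/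
lemma integral_sq_add_indicator (h : IsErrorProcess P γ₁ β B c L D a ℱ X μ H e) {n : ℕ} {A : Set Ω}
    (hA : MeasurableSet[ℱ n] A) {F : ℝ → ℝ → ℝ} (hF : Measurable (Function.uncurry F))
    (hF0 : ∀ z, ∫ x, F z x ∂μ = 0) {C : ℝ} (hC : 0 ≤ C) (hFC : ∀ ω ∈ A, ∀ x, |F (e n ω) x| ≤ C)
    {M : Ω → ℝ} (hM : Measurable[ℱ n] M) {C' : ℝ} (hMC : ∀ ω, |M ω| ≤ C') (p q : ℝ) :
    ∫ ω, (p * M ω + q * A.indicator (fun ω => F (e n ω) (X n ω)) ω) ^ 2 ∂P =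
      p ^ 2 * ∫ ω, M ω ^ 2 ∂P + q ^ 2 * ∫ ω in A, ∫ x, F (e n ω) x ^ 2 ∂μ ∂P := by
  set Y := A.indicator (fun ω => F (e n ω) (X n ω)) with hY
  have hA' := ℱ.le n _ hA
  have hM' : Measurable M := hM.mono (ℱ.le n) le_rfl
  have hYm : Measurable Y := (h.measurable_indicator_comp hA hF).mono (ℱ.le _) le_rfl
  have hYC : ∀ ω, |Y ω| ≤ C := fun ω => by
    by_cases hω : ω ∈ A
    · simp only [hY, Set.indicator_of_mem hω]; exact hFC ω hω _
    · simp only [hY, Set.indicator_of_notMem hω, abs_zero]; exact hC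
  have hC'0 : ∀ _ : Ω, 0 ≤ C' := fun ω => (abs_nonneg _).trans (hMC ω)
  have hiM : Integrable (fun ω => M ω ^ 2) P :=
    integrable_of_measurable_of_abs_le (hM'.pow_const 2) (C' ^ 2) fun ω => by
      rw [abs_pow]; have := hMC ω; gcongr
  have hiY : Integrable (fun ω => Y ω ^ 2) P :=
    integrable_of_measurable_of_abs_le (hYm.pow_const 2) (C ^ 2) fun ω => by
      rw [abs_pow]; have := hYC ω; gcongr
  have hiMY : Integrable (fun ω => M ω * Y ω) P :=
    integrable_of_measurable_of_abs_le (hM'.mul hYm) (C' * C) fun ω => by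
      rw [abs_mul]; exact mul_le_mul (hMC ω) (hYC ω) (abs_nonneg _) (hC'0 ω)
  have hcross : ∫ ω, M ω * Y ω ∂P = 0 := by
    have heq : ∀ ω, A.indicator M ω * F (e n ω) (X n ω) = M ω * Y ω := fun ω => by
      by_cases hω : ω ∈ A <;> simp [hY, hω]
    have h1 := h.integral_mul_comp (Z := A.indicator M) (hM.indicator hA) (h.measurable n) hF
      (by simpa only [heq] using hiMY)
    simpa only [heq, hF0, mul_zero, integral_zero] using h1
  have hF2 : Measurable (Function.uncurry fun z x => F z x ^ 2) := hF.pow_const 2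
  have hsq : ∫ ω, Y ω ^ 2 ∂P = ∫ ω in A, ∫ x, F (e n ω) x ^ 2 ∂μ ∂P := by
    have heq : ∀ ω, A.indicator (fun _ => (1 : ℝ)) ω * F (e n ω) (X n ω) ^ 2 = Y ω ^ 2 := fun ω => by
      by_cases hω : ω ∈ A <;> simp [hY, hω]
    have h1 := h.integral_mul_comp (Z := A.indicator fun _ => (1 : ℝ))
      ((measurable_const).indicator hA) (h.measurable n) hF2 (by simpa only [heq] using hiY)
    rw [← integral_indicator hA']
    simp only [heq] at h1
    rw [h1]
    refine integral_congr_ae (ae_of_all _ fun ω => ?_)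
    by_cases hω : ω ∈ A <;> simp [hω]
  have hexp : ∀ ω, (p * M ω + q * Y ω) ^ 2 =
      p ^ 2 * M ω ^ 2 + 2 * p * q * (M ω * Y ω) + q ^ 2 * Y ω ^ 2 := fun ω => by ring
  have hi12 : Integrable (fun ω => p ^ 2 * M ω ^ 2 + 2 * p * q * (M ω * Y ω)) P :=
    (hiM.const_mul _).add (hiMY.const_mul _)
  simp_rw [hexp]
  rw [integral_add hi12 (hiY.const_mul _), integral_add (hiM.const_mul _) (hiMY.const_mul _),
    integral_const_mul, integral_const_mul, integral_const_mul, hcross, hsq]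
  ring

/-- The martingale driven by the centred increments `F (e k) (X k)` on the confinement event, with
drift factors `p` and gains `q`. -/
noncomputable def _root_.NestedSA.confinedMartingale (e X : ℕ → Ω → ℝ) (ρ : ℝ) (N : ℕ)
    (F : ℝ → ℝ → ℝ) (p q : ℕ → ℝ) (n : ℕ) (ω : Ω) : ℝ :=
  linRec p (fun k => q k * (confined e ρ N k).indicator (fun ω => F (e k ω) (X k ω)) ω) 0 N n

lemma confinedMartingale_aux (h : IsErrorProcess P γ₁ β B c L D a ℱ X μ H e) (ρ : ℝ) {N n : ℕ}
    (hn : N ≤ n) {F : ℝ → ℝ → ℝ} (hF : Measurable (Function.uncurry F)) {C : ℝ} (hC : 0 ≤ C)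
    (hFC : ∀ z x, |z| ≤ ρ → |F z x| ≤ C) (p q : ℕ → ℝ) :
    Measurable[ℱ n] (confinedMartingale e X ρ N F p q n) ∧
      ∃ C', ∀ ω, |confinedMartingale e X ρ N F p q n ω| ≤ C' := by
  induction n, hn using Nat.le_induction with
  | base =>
    have : confinedMartingale e X ρ N F p q N = fun _ => 0 := by
      ext ω; simp [confinedMartingale, linRec_self]
    rw [this]
    exact ⟨measurable_const, 0, fun ω => by simp⟩
  | succ n hn ih =>
    obtain ⟨h1, C', h2⟩ := ih
    have h3 : confinedMartingale e X ρ N F p q (n + 1) = fun ω =>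
        p n * confinedMartingale e X ρ N F p q n ω +
          q n * (confined e ρ N n).indicator (fun ω => F (e n ω) (X n ω)) ω := by
      ext ω; simp only [confinedMartingale, linRec_succ _ _ _ hn]
    rw [h3]
    refine ⟨?_, |p n| * C' + |q n| * C, fun ω => ?_⟩
    · have h4 := h.measurable_indicator_comp (h.measurableSet_confined ρ N n) hF
      exact ((h1.mono (ℱ.mono (Nat.le_succ n)) le_rfl).const_mul _).add (h4.const_mul _)
    · refine (abs_add_le _ _).trans (add_le_add ?_ ?_)
      · rw [abs_mul]; exact mul_le_mul_of_nonneg_left (h2 ω) (abs_nonneg _)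
      · rw [abs_mul]
        refine mul_le_mul_of_nonneg_left ?_ (abs_nonneg _)
        by_cases hω : ω ∈ confined e ρ N n
        · rw [Set.indicator_of_mem hω]; exact hFC _ _ (hω n hn le_rfl)
        · rw [Set.indicator_of_notMem hω, abs_zero]; exact hC

lemma integrable_confinedMartingale_sq (h : IsErrorProcess P γ₁ β B c L D a ℱ X μ H e) (ρ : ℝ)
    {N n : ℕ} (hn : N ≤ n) {F : ℝ → ℝ → ℝ} (hF : Measurable (Function.uncurry F)) {C : ℝ}
    (hC : 0 ≤ C) (hFC : ∀ z x, |z| ≤ ρ → |F z x| ≤ C) (p q : ℕ → ℝ) :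
    Integrable (fun ω => confinedMartingale e X ρ N F p q n ω ^ 2) P := by
  obtain ⟨h1, C', h2⟩ := h.confinedMartingale_aux ρ hn hF hC hFC p q
  refine integrable_of_measurable_of_abs_le ((h1.mono (ℱ.le n) le_rfl).pow_const 2) (C' ^ 2)
    fun ω => ?_
  rw [abs_pow]; have := h2 ω; gcongr

lemma integral_confinedMartingale_sq_succ (h : IsErrorProcess P γ₁ β B c L D a ℱ X μ H e) (ρ : ℝ)
    {N n : ℕ} (hn : N ≤ n) {F : ℝ → ℝ → ℝ} (hF : Measurable (Function.uncurry F))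
    (hF0 : ∀ z, ∫ x, F z x ∂μ = 0) {C : ℝ} (hC : 0 ≤ C) (hFC : ∀ z x, |z| ≤ ρ → |F z x| ≤ C)
    (p q : ℕ → ℝ) :
    ∫ ω, confinedMartingale e X ρ N F p q (n + 1) ω ^ 2 ∂P =
      p n ^ 2 * ∫ ω, confinedMartingale e X ρ N F p q n ω ^ 2 ∂P +
        q n ^ 2 * ∫ ω in confined e ρ N n, ∫ x, F (e n ω) x ^ 2 ∂μ ∂P := by
  obtain ⟨h1, C', h2⟩ := h.confinedMartingale_aux ρ hn hF hC hFC p q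
  rw [← h.integral_sq_add_indicator (h.measurableSet_confined ρ N n) hF hF0 hC
    (fun ω hω x => hFC _ _ (hω n hn le_rfl)) h1 h2]
  refine integral_congr_ae (ae_of_all _ fun ω => ?_)
  simp only [confinedMartingale, linRec_succ _ _ _ hn]

lemma integral_zero_eq_zero (h : IsErrorProcess P γ₁ β B c L D a ℱ X μ H e) :
    ∫ x, H 0 x ∂μ = 0 := by
  have := h.linear 0
  simpa using this

lemma integrable_H (h : IsErrorProcess P γ₁ β B c L D a ℱ X μ H e) (z : ℝ) :
    Integrable (H z) μ := by
  have := h.isProbabilityMeasure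
  exact integrable_of_measurable_of_abs_le (h.measurable_H.comp (measurable_prodMk_left)) B
    (h.bound z)

/-- The conditional variance of the change of the noise. -/
lemma integral_noise_sq_le (h : IsErrorProcess P γ₁ β B c L D a ℱ X μ H e) (z : ℝ) :
    ∫ x, (H z x - H 0 x - ∫ y, H z y ∂μ) ^ 2 ∂μ ≤ L * |z| := by
  have := h.isProbabilityMeasure
  refine le_trans ?_ (h.noise z)
  have hm : Measurable fun x => H z x - H 0 x :=
    (h.measurable_H.comp measurable_prodMk_left).sub (h.measurable_H.comp measurable_prodMk_left)
  have h1 : ∫ x, (H z x - H 0 x) ∂μ = ∫ y, H z y ∂μ := by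
    rw [integral_sub (h.integrable_H z) (h.integrable_H 0), h.integral_zero_eq_zero, sub_zero]
  have h2 := variance_le_expectation_sq (μ := μ) hm.aestronglyMeasurable
  rw [variance_eq_integral hm.aemeasurable, h1] at h2
  simpa using h2

/-- The error process is approximated by the solution of the linearised recursion, with an error
that is negligible on the scale `√γ` of the fluctuations. -/
theorem exists_linearisation (hγ₁ : 0 < γ₁) (hβ₀ : 1 / 2 < β) (hβ₁ : β ≤ 1) {a₀ a₁ : ℝ}
    (ha₀ : 0 < a₀) (h1 : β = 1 → 1 < a₀ * γ₁) {c : ℝ} (hc : 0 < c) (B : ℝ) {L : ℝ} (hL : 0 < L)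
    (D : ℝ) {ε : ℝ} (hε : 0 < ε) :
    ∃ N, ∀ a ℱ X μ H e, a₀ ≤ a → a ≤ a₁ → IsErrorProcess P γ₁ β B c L D a ℱ X μ H e →
      ∀ n, N ≤ n → P.real {ω | ε * √(stepSize γ₁ β n) <
        |e n ω - ∑ k ∈ Finset.range n, weight γ₁ β a n k * H 0 (X k ω)|} ≤ ε := by
  have hβ : 0 < β := by linarith
  set ρ := a₀ / (2 * L) with hρdef
  have hρ : 0 < ρ := by positivity
  have hρL : L * ρ ≤ a₀ / 2 := by rw [hρdef]; field_simp; rfl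
  obtain ⟨N₁, hN₁1, hN₁⟩ := exists_setIntegral_sq_le (P := P) hγ₁ hβ₀ hβ₁ ha₀ h1 B c D hρL
  obtain ⟨c', hc', N₂, hN₂1, hN₂⟩ := exists_contraction_rate hγ₁ hβ hβ₁ ha₀ h1
  have hsγ : Tendsto (stepSize γ₁ β) atTop (𝓝 0) := tendsto_stepSize hβ
  have hs : Tendsto (fun n => a₁ * stepSize γ₁ β (n + 1)) atTop (𝓝 0) := by
    simpa using ((tendsto_add_atTop_iff_nat 1).2 hsγ).const_mul a₁
  obtain ⟨N₃, hN₃⟩ := eventually_atTop.1 (hs.eventually (ge_mem_nhds one_pos))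
  obtain ⟨N, hNN, hN⟩ := exists_measureReal_compl_confined_le (P := P) hγ₁ hβ₀ hβ₁ hc B L D hρ
    (show 0 < ε / 3 by positivity) (max N₁ (max N₂ N₃))
  have hNN₁ : N₁ ≤ N := (le_max_left _ _).trans hNN
  have hNN₂ : N₂ ≤ N := (le_max_left _ _).trans ((le_max_right _ _).trans hNN)
  have hNN₃ : N₃ ≤ N := (le_max_right _ _).trans ((le_max_right _ _).trans hNN)
  have hN1 : 1 ≤ N := hN₁1.trans hNN₁
  obtain ⟨C, hC0, hC⟩ := hN₁ N hNN₁
  obtain ⟨Cw, hCw0, hCw⟩ := exists_abs_weight_le hγ₁ hβ hβ₁ (a₁ := a₁) ha₀ h1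
  have hγpos : ∀ n, 0 < stepSize γ₁ β (n + 1) := fun n => stepSize_pos hγ₁ (by omega)
  -- rate of the drift part `R`
  obtain ⟨CR, hCR0, hCR⟩ := exists_forall_le_mul_of_contraction_of_bounded (B := L * (2 * C))
    (g := fun n => stepSize γ₁ β (n + 1)) (s := fun n => stepSize γ₁ β n) hc'
    (fun n => (hγpos n).le) N (fun n hn => (hN₂ n (hNN₂.trans hn)).1)
    (fun n hn => stepSize_pos hγ₁ (hN1.trans hn))
    (fun n hn => (hN₂ n (hNN₂.trans hn)).2.2) (ρ + N * (Cw * stepSize γ₁ β N * |B|))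
  -- rate of the martingale part `M`
  have hηM : Tendsto (fun n => L * ((1 + C) * √(stepSize γ₁ β n))) atTop (𝓝 0) := by
    have := ((hsγ.sqrt).const_mul (1 + C)).const_mul L
    simpa using this
  obtain ⟨NM, hNM⟩ := exists_forall_le_mul_of_contraction
    (g := fun n => stepSize γ₁ β (n + 1)) (s := fun n => stepSize γ₁ β n) hc'
    (fun n => (hγpos n).le) (tendsto_sum_stepSize hγ₁ hβ₁) hηM N
    (fun n hn => (hN₂ n (hNN₂.trans hn)).1)
    (fun n hn => stepSize_pos hγ₁ (hN1.trans hn))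
    (fun n hn => (hN₂ n (hNN₂.trans hn)).2.2) 0 (show 0 < ε ^ 3 / 12 by positivity)
  have hRlim : Tendsto (fun n => CR * √(stepSize γ₁ β n)) atTop (𝓝 0) := by
    simpa using hsγ.sqrt.const_mul CR
  obtain ⟨NR, hNR⟩ := eventually_atTop.1
    (hRlim.eventually (ge_mem_nhds (show 0 < ε * ε / 6 by positivity)))
  refine ⟨max N (max NM NR), fun a ℱ X μ H e ha ha₁ h n hn => ?_⟩
  have hnN : N ≤ n := (le_max_left _ _).trans hn
  have hnM : NM ≤ n := (le_max_left _ _).trans ((le_max_right _ _).trans hn)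
  have hnR : NR ≤ n := (le_max_right _ _).trans ((le_max_right _ _).trans hn)
  have hμ := h.isProbabilityMeasure
  have hB0 := h.nonneg_B
  have hmeas : ∀ n, MeasurableSet (confined e ρ N n) := fun n =>
    ℱ.le n _ (h.measurableSet_confined ρ N n)
  set u : ℕ → Ω → ℝ := fun n ω => ∑ k ∈ Finset.range n, weight γ₁ β a n k * H 0 (X k ω) with hu
  set g : ℝ → ℝ := fun z => ∫ x, H z x ∂μ with hg
  have hgm : Measurable g := h.measurable_mean
  have hum : ∀ n, Measurable (u n) := fun n => by
    refine Finset.measurable_sum _ fun k _ => Measurable.const_mul ?_ _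
    exact h.measurable_H.comp (measurable_const.prodMk (h.measurable_X' k))
  set p : ℕ → ℝ := fun n => 1 - a * stepSize γ₁ β (n + 1) with hp
  have hp0 : ∀ n, N ≤ n → 0 ≤ p n ∧ p n ≤ 1 - a₀ * stepSize γ₁ β (n + 1) := fun n hn => by
    have h2 := hN₃ n (hNN₃.trans hn)
    have h3 : a * stepSize γ₁ β (n + 1) ≤ a₁ * stepSize γ₁ β (n + 1) :=
      mul_le_mul_of_nonneg_right ha₁ (hγpos n).le
    have h4 : a₀ * stepSize γ₁ β (n + 1) ≤ a * stepSize γ₁ β (n + 1) :=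
      mul_le_mul_of_nonneg_right ha (hγpos n).le
    exact ⟨by simp only [hp]; linarith, by simp only [hp]; linarith⟩
  -- the remainder of the linearisation of the mean field, killed at the exit from `[-ρ, ρ]`
  set r : ℕ → Ω → ℝ := fun n =>
    (confined e ρ N n).indicator fun ω => g (e n ω) - a * e n ω with hr
  have hrm : ∀ n, Measurable (r n) := fun n =>
    ((hgm.comp (h.measurable' n)).sub ((h.measurable' n).const_mul a)).indicator (hmeas n)
  have hrle : ∀ n ω, |r n ω| ≤ (confined e ρ N n).indicator (fun ω => L * e n ω ^ 2) ω :=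
    fun n ω => by
      by_cases hω : ω ∈ confined e ρ N n
      · simp only [hr, Set.indicator_of_mem hω]; exact h.linear _
      · simp only [hr, Set.indicator_of_notMem hω, abs_zero]; exact le_rfl
  have hri : ∀ n, Integrable (fun ω => |r n ω|) P := fun n =>
    (((h.integrable_sq n).const_mul L).indicator (hmeas n)).mono' (hrm n).abs.aestronglyMeasurable
      (ae_of_all _ fun ω => by rw [Real.norm_eq_abs, abs_abs]; exact hrle n ω)
  have hrint : ∀ n, N ≤ n → ∫ ω, |r n ω| ∂P ≤ L * (2 * C) * stepSize γ₁ β (n + 1) := fun n hn => by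
    calc ∫ ω, |r n ω| ∂P
        ≤ ∫ ω, (confined e ρ N n).indicator (fun ω => L * e n ω ^ 2) ω ∂P :=
          integral_mono (hri n) (((h.integrable_sq n).const_mul L).indicator (hmeas n)) (hrle n)
      _ = L * ∫ ω in confined e ρ N n, e n ω ^ 2 ∂P := by
        rw [integral_indicator (hmeas n), integral_const_mul]
      _ ≤ L * (C * (2 * stepSize γ₁ β (n + 1))) := by
        gcongr
        refine (hC a ℱ X μ H e ha h n hn).trans ?_
        gcongr
        exact stepSize_le_two_mul hγ₁ hβ₁ (hN1.trans hn)
      _ = _ := by ring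
  set R : ℕ → Ω → ℝ := fun n ω => linRec p (fun k => -stepSize γ₁ β (k + 1) * r k ω)
    ((confined e ρ N N).indicator (fun ω => e N ω - u N ω) ω) N n with hR
  have hRN : ∀ ω, |R N ω| ≤ ρ + N * (Cw * stepSize γ₁ β N * |B|) := fun ω => by
    have hs0 : 0 ≤ N * (Cw * stepSize γ₁ β N * |B|) := by
      have := stepSize_pos (β := β) hγ₁ hN1; positivity
    simp only [hR, linRec_self]
    by_cases hω : ω ∈ confined e ρ N N
    · rw [Set.indicator_of_mem hω]
      refine (abs_sub _ _).trans (add_le_add (hω N le_rfl le_rfl) ?_)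
      refine (Finset.abs_sum_le_sum_abs _ _).trans ?_
      have : ∀ k ∈ Finset.range N, |weight γ₁ β a N k * H 0 (X k ω)| ≤
          Cw * stepSize γ₁ β N * |B| := fun k hk => by
        rw [abs_mul]
        exact mul_le_mul (hCw a ha ha₁ N hN1 k (Finset.mem_range.1 hk))
          ((h.bound _ _).trans (le_abs_self B)) (abs_nonneg _)
          (mul_nonneg hCw0 (stepSize_pos hγ₁ hN1).le)
      simpa using Finset.sum_le_card_nsmul _ _ _ this
    · rw [Set.indicator_of_notMem hω, abs_zero]; positivity
  have hRm : ∀ n, N ≤ n → Measurable (R n) ∧ Integrable (fun ω => |R n ω|) P := by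
    intro n hn
    induction n, hn using Nat.le_induction with
    | base =>
      have hm : Measurable (R N) := by
        simp only [hR, linRec_self]
        exact ((h.measurable' N).sub (hum N)).indicator (hmeas N)
      exact ⟨hm, integrable_of_measurable_of_abs_le hm.abs _ fun ω => by
        rw [abs_abs]; exact hRN ω⟩
    | succ n hn ih =>
      have h3 : R (n + 1) = fun ω => p n * R n ω + -stepSize γ₁ β (n + 1) * r n ω := by
        ext ω; simp only [hR, linRec_succ _ _ _ hn]
      rw [h3]
      have hm := (ih.1.const_mul (p n)).add ((hrm n).const_mul (-stepSize γ₁ β (n + 1)))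
      refine ⟨hm, ?_⟩
      have hi1 : Integrable (R n) P :=
        (integrable_norm_iff ih.1.aestronglyMeasurable).1 ih.2
      have hi2 : Integrable (r n) P :=
        (integrable_norm_iff (hrm n).aestronglyMeasurable).1 (hri n)
      exact ((hi1.const_mul (p n)).add (hi2.const_mul (-stepSize γ₁ β (n + 1)))).norm
  have hRrate : ∫ ω, |R n ω| ∂P ≤ CR * stepSize γ₁ β n := by
    refine hCR (fun n => ∫ ω, |R n ω| ∂P) (fun n => integral_nonneg fun ω => abs_nonneg _) ?_
      (fun n hn => ?_) n hnN
    · refine (integral_mono (hRm N le_rfl).2 (integrable_const _) hRN).trans ?_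
      simp
    · have h3 : ∀ ω, |R (n + 1) ω| ≤ p n * |R n ω| + stepSize γ₁ β (n + 1) * |r n ω| := fun ω => by
        simp only [hR, linRec_succ _ _ _ hn]
        refine (abs_add_le _ _).trans (le_of_eq ?_)
        rw [abs_mul, abs_mul, abs_of_nonneg (hp0 n hn).1, abs_neg, abs_of_pos (hγpos n)]
      have hi3 : Integrable (fun ω => p n * |R n ω| + stepSize γ₁ β (n + 1) * |r n ω|) P :=
        ((hRm n hn).2.const_mul _).add ((hri n).const_mul _)
      refine (integral_mono (hRm (n + 1) (by omega)).2 hi3 h3).trans ?_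
      rw [integral_add ((hRm n hn).2.const_mul _) ((hri n).const_mul _), integral_const_mul,
        integral_const_mul]
      have h5 : 0 ≤ ∫ ω, |R n ω| ∂P := integral_nonneg fun ω => abs_nonneg _
      have h6 := hrint n hn
      have h7 := (hγpos n).le
      exact add_le_add (mul_le_mul_of_nonneg_right (hp0 n hn).2 h5)
        (mul_le_mul_of_nonneg_left h6 h7)
  -- the martingale part
  set F : ℝ → ℝ → ℝ := fun z x => H z x - H 0 x - g z with hF
  have hFm : Measurable (Function.uncurry F) := by
    refine (h.measurable_H.sub (h.measurable_H.comp
      (measurable_const.prodMk measurable_snd))).sub (hgm.comp measurable_fst)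
  have hF0 : ∀ z, ∫ x, F z x ∂μ = 0 := fun z => by
    have hi1 : Integrable (fun x => H z x - H 0 x) μ := (h.integrable_H z).sub (h.integrable_H 0)
    simp only [hF]
    rw [integral_sub hi1 (integrable_const _),
      integral_sub (h.integrable_H z) (h.integrable_H 0), h.integral_zero_eq_zero]
    simp [hg]
  have hFC : ∀ z x, |z| ≤ ρ → |F z x| ≤ 3 * B := fun z x _ => by
    have h2 := h.bound z x
    have h3 := h.bound 0 x
    have h4 := h.abs_mean_le z
    simp only [hF, hg]
    refine (abs_sub _ _).trans ?_
    have := abs_sub (H z x) (H 0 x)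
    linarith
  set M := confinedMartingale e X ρ N F p (fun k => -stepSize γ₁ β (k + 1)) with hM
  have hMi : ∀ n, N ≤ n → Integrable (fun ω => M n ω ^ 2) P := fun n hn =>
    h.integrable_confinedMartingale_sq ρ hn hFm (by positivity) hFC _ _
  have hMrate : ∫ ω, M n ω ^ 2 ∂P ≤ ε ^ 3 / 12 * stepSize γ₁ β n := by
    refine hNM (fun n => ∫ ω, M n ω ^ 2 ∂P) (fun n => integral_nonneg fun ω => sq_nonneg _) ?_
      (fun n hn => ?_) n hnM
    · simp [hM, confinedMartingale, linRec_self]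
    · have hstep := h.integral_confinedMartingale_sq_succ ρ hn hFm hF0 (by positivity) hFC p
        (fun k => -stepSize γ₁ β (k + 1))
      rw [← hM] at hstep
      show ∫ ω, M (n + 1) ω ^ 2 ∂P ≤ _
      rw [hstep]
      have hγn := stepSize_pos (β := β) hγ₁ (hN1.trans hn)
      have h5 : ∫ ω in confined e ρ N n, ∫ x, F (e n ω) x ^ 2 ∂μ ∂P ≤
          L * ((1 + C) * √(stepSize γ₁ β n)) := by
        have hsq := Real.sqrt_pos.2 hγn
        have hsq2 := Real.sq_sqrt hγn.le
        -- `|z| ≤ s + z ^ 2 / s` with `s = √γ`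
        have h6 : ∀ z : ℝ, L * |z| ≤
            L * (√(stepSize γ₁ β n) + z ^ 2 / √(stepSize γ₁ β n)) := fun z => by
          gcongr
          rw [← sub_nonneg]
          have : √(stepSize γ₁ β n) + z ^ 2 / √(stepSize γ₁ β n) - |z| =
              ((√(stepSize γ₁ β n) - |z| / 2) ^ 2 + 3 / 4 * z ^ 2) / √(stepSize γ₁ β n) := by
            rw [← sq_abs z]; field_simp; ring
          rw [this]; positivity
        have hi6 : Integrable (fun ω => L * (√(stepSize γ₁ β n) +
            e n ω ^ 2 / √(stepSize γ₁ β n))) P :=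
          ((integrable_const _).add ((h.integrable_sq n).div_const _)).const_mul L
        have hle : ∀ ω, ∫ x, F (e n ω) x ^ 2 ∂μ ≤ L * (√(stepSize γ₁ β n) +
            e n ω ^ 2 / √(stepSize γ₁ β n)) := fun ω =>
          (h.integral_noise_sq_le (e n ω)).trans (h6 _)
        calc ∫ ω in confined e ρ N n, ∫ x, F (e n ω) x ^ 2 ∂μ ∂P
            ≤ ∫ ω in confined e ρ N n, L * (√(stepSize γ₁ β n) +
              e n ω ^ 2 / √(stepSize γ₁ β n)) ∂P := by
              refine integral_mono_of_nonneg (ae_of_all _ fun ω => integral_nonneg fun x =>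
                sq_nonneg _) hi6.integrableOn (ae_of_all _ hle)
          _ = L * (√(stepSize γ₁ β n) * P.real (confined e ρ N n) +
              (∫ ω in confined e ρ N n, e n ω ^ 2 ∂P) / √(stepSize γ₁ β n)) := by
            rw [integral_const_mul, integral_add (integrable_const _)
              ((h.integrable_sq n).div_const _).integrableOn, setIntegral_const, integral_div,
              smul_eq_mul, mul_comm (P.real _)]
          _ ≤ L * (√(stepSize γ₁ β n) * 1 + (C * stepSize γ₁ β n) / √(stepSize γ₁ β n)) := by
            gcongr
            · exact measureReal_le_one
            · exact hC a ℱ X μ H e ha h n hn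
          _ = L * ((1 + C) * √(stepSize γ₁ β n)) := by
            have : C * stepSize γ₁ β n / √(stepSize γ₁ β n) = C * √(stepSize γ₁ β n) := by
              rw [div_eq_iff hsq.ne', mul_assoc, ← sq, hsq2]
            rw [this]; ring
      have h6 : 0 ≤ ∫ ω, M n ω ^ 2 ∂P := integral_nonneg fun ω => sq_nonneg _
      have h7 : p n ^ 2 ≤ 1 - a₀ * stepSize γ₁ β (n + 1) := by
        have h8 := hp0 n hn
        have h9 : 0 < a₀ * stepSize γ₁ β (n + 1) := mul_pos ha₀ (hγpos n)
        nlinarith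
      refine add_le_add (mul_le_mul_of_nonneg_right h7 h6) ?_
      rw [neg_sq]
      calc stepSize γ₁ β (n + 1) ^ 2 * ∫ ω in confined e ρ N n, ∫ x, F (e n ω) x ^ 2 ∂μ ∂P
          ≤ stepSize γ₁ β (n + 1) ^ 2 * (L * ((1 + C) * √(stepSize γ₁ β n))) := by gcongr
        _ = _ := by ring
  -- the decomposition on the confinement event
  have hdec : ∀ n, N ≤ n → ∀ ω ∈ confined e ρ N n, e n ω - u n ω = R n ω + M n ω := by
    intro n hn
    induction n, hn using Nat.le_induction with
    | base =>
      intro ω hω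
      simp [hR, hM, confinedMartingale, linRec_self, Set.indicator_of_mem hω]
    | succ n hn ih =>
      intro ω hω
      have hω' := confined_anti (Nat.le_succ n) hω
      have h2 := ih ω hω'
      have h3 : u (n + 1) ω = p n * u n ω - stepSize γ₁ β (n + 1) * H 0 (X n ω) := by
        simp only [hu, hp]; exact sum_weight_mul_succ n _
      have h4 : R (n + 1) ω = p n * R n ω + -stepSize γ₁ β (n + 1) * (g (e n ω) - a * e n ω) := by
        simp only [hR, linRec_succ _ _ _ hn, hr, Set.indicator_of_mem hω']
      have h5 : M (n + 1) ω = p n * M n ω + -stepSize γ₁ β (n + 1) * F (e n ω) (X n ω) := by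
        simp only [hM, confinedMartingale, linRec_succ _ _ _ hn, Set.indicator_of_mem hω']
      rw [h.succ, h3, h4, h5]
      simp only [hF]
      have h6 : p n = 1 - a * stepSize γ₁ β (n + 1) := rfl
      linear_combination p n * h2 - e n ω * h6
  have hγn := stepSize_pos (β := β) hγ₁ (hN1.trans hnN)
  have hsq := Real.sqrt_pos.2 hγn
  have hsq2 := Real.sq_sqrt hγn.le
  have hPR : P.real {ω | ε / 2 * √(stepSize γ₁ β n) < |R n ω|} ≤ ε / 3 := by
    refine (measureReal_lt_le_div (fun ω => abs_nonneg _) (hRm n hnN).2 (by positivity)).trans ?_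
    rw [div_le_iff₀ (by positivity)]
    refine hRrate.trans ?_
    have h2 := hNR n hnR
    calc CR * stepSize γ₁ β n = CR * √(stepSize γ₁ β n) * √(stepSize γ₁ β n) := by
          rw [mul_assoc, ← sq, hsq2]
      _ ≤ ε * ε / 6 * √(stepSize γ₁ β n) := by gcongr
      _ = _ := by ring
  have hPM : P.real {ω | ε / 2 * √(stepSize γ₁ β n) < |M n ω|} ≤ ε / 3 := by
    refine (measureReal_lt_abs_le_div_sq (hMi n hnN) (by positivity)).trans ?_
    rw [div_le_iff₀ (by positivity)]
    refine hMrate.trans (le_of_eq ?_)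
    rw [mul_pow, hsq2]; ring
  calc P.real {ω | ε * √(stepSize γ₁ β n) < |e n ω - u n ω|}
      ≤ P.real ((confined e ρ N n)ᶜ ∪ ({ω | ε / 2 * √(stepSize γ₁ β n) < |R n ω|} ∪
          {ω | ε / 2 * √(stepSize γ₁ β n) < |M n ω|})) := by
        refine measureReal_mono fun ω hω => ?_
        by_cases h2 : ω ∈ confined e ρ N n
        · refine Or.inr ?_
          by_contra hcon
          rw [Set.mem_union, not_or] at hcon
          have h3 : |R n ω| ≤ ε / 2 * √(stepSize γ₁ β n) := not_lt.1 hcon.1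
          have h4 : |M n ω| ≤ ε / 2 * √(stepSize γ₁ β n) := not_lt.1 hcon.2
          have h5 : ε * √(stepSize γ₁ β n) < |e n ω - u n ω| := hω
          rw [hdec n hnN ω h2] at h5
          have := abs_add_le (R n ω) (M n ω)
          linarith
        · exact Or.inl h2
    _ ≤ ε / 3 + (ε / 3 + ε / 3) :=
      (measureReal_union_le _ _).trans (add_le_add (hN a ℱ X μ H e h n hnN)
        ((measureReal_union_le _ _).trans (add_le_add hPR hPM)))
    _ = ε := by ring

end IsErrorProcess

namespace IsErrorProcess

/-! ### Averages along the error process -/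

set_option linter.unusedSectionVars false

variable {Ω : Type*} [mΩ : MeasurableSpace Ω]
  {P : Measure Ω} [IsProbabilityMeasure P] {γ₁ β B c L D a : ℝ} {ℱ : Filtration ℕ mΩ}
  {X : ℕ → Ω → ℝ} {μ : Measure ℝ} {H : ℝ → ℝ → ℝ} {e : ℕ → Ω → ℝ}

/-- In a sum of functionals `Q (e k) (X k)`, the error process may be replaced by its limit `0`:
the change is negligible on the scale `√n`, provided that the mean of `Q` is stationary at `0`. -/
theorem exists_sum_sub_le (hγ₁ : 0 < γ₁) (hβ₀ : 1 / 2 < β) (hβ₁ : β ≤ 1) {a₀ : ℝ}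
    (ha₀ : 0 < a₀) (h1 : β = 1 → 1 < a₀ * γ₁) {c : ℝ} (hc : 0 < c) (B : ℝ) {L : ℝ} (hL : 0 < L)
    (D : ℝ) {B' L' : ℝ} (hB' : 0 ≤ B') (hL' : 0 ≤ L') {ε : ℝ} (hε : 0 < ε) :
    ∃ N, ∀ a ℱ X μ H e (Q : ℝ → ℝ → ℝ), a₀ ≤ a → IsErrorProcess P γ₁ β B c L D a ℱ X μ H e →
      Measurable (Function.uncurry Q) → (∀ z x, |Q z x - Q 0 x| ≤ B' * |z|) →
      (∀ z, |∫ x, (Q z x - Q 0 x) ∂μ| ≤ L' * z ^ 2) →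
      ∀ n : ℕ, N ≤ n → P.real {ω | ε * √n <
        |∑ k ∈ Finset.range n, (Q (e k ω) (X k ω) - Q 0 (X k ω))|} ≤ ε := by
  set ρ := a₀ / (2 * L) with hρdef
  have hρ : 0 < ρ := by positivity
  have hρL : L * ρ ≤ a₀ / 2 := by rw [hρdef]; field_simp; rfl
  obtain ⟨N₁, hN₁1, hN₁⟩ := exists_setIntegral_sq_le (P := P) hγ₁ hβ₀ hβ₁ ha₀ h1 B c D hρL
  obtain ⟨N, hNN, hN⟩ := exists_measureReal_compl_confined_le (P := P) hγ₁ hβ₀ hβ₁ hc B L D hρ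
    (show 0 < ε / 4 by positivity) N₁
  obtain ⟨C, hC0, hC⟩ := hN₁ N hNN
  set K := 1 + (D + B ^ 2 * ∑' k, stepSize γ₁ β (k + 1) ^ 2) with hK
  -- the three error terms tend to zero
  have hT : Tendsto (fun n : ℕ => N * (B' * K) / √n) atTop (𝓝 0) :=
    tendsto_const_nhds.div_atTop (Real.tendsto_sqrt_atTop.comp tendsto_natCast_atTop_atTop)
  have hS := tendsto_sum_stepSize_div_sqrt hγ₁ hβ₀
  have hA : Tendsto (fun n : ℕ => L' * C * ((∑ k ∈ Finset.range n, stepSize γ₁ β k) / √n))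
      atTop (𝓝 0) := by simpa using hS.const_mul (L' * C)
  have hM' : Tendsto (fun n : ℕ => B' ^ 2 * C * ((∑ k ∈ Finset.range n, stepSize γ₁ β k) / √n))
      atTop (𝓝 0) := by simpa using hS.const_mul (B' ^ 2 * C)
  have hev := (hT.eventually (ge_mem_nhds (show 0 < ε / 3 * (ε / 4) by positivity))).and
    ((hA.eventually (ge_mem_nhds (show 0 < ε / 3 * (ε / 4) by positivity))).and
      (hM'.eventually (ge_mem_nhds (show 0 < (ε / 3) ^ 2 * (ε / 4) by positivity))))
  obtain ⟨N', hN'⟩ := eventually_atTop.1 hev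
  refine ⟨max (max N N') 1, fun a ℱ X μ H e Q ha h hQm hQB hQL n hn => ?_⟩
  have hnN : N ≤ n := (le_max_left _ _).trans ((le_max_left _ _).trans hn)
  obtain ⟨hnT, hnA, hnM⟩ := hN' n ((le_max_right _ _).trans ((le_max_left _ _).trans hn))
  have hn1 : (1 : ℝ) ≤ n := by exact_mod_cast (le_max_right _ _).trans hn
  have hsq1 : 1 ≤ √(n : ℝ) := by rw [Real.one_le_sqrt]; exact hn1
  have hsq : 0 < √(n : ℝ) := by linarith
  have hsq2 : √(n : ℝ) ^ 2 = n := Real.sq_sqrt (by linarith)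
  have hμ := h.isProbabilityMeasure
  have hmeas : ∀ n, MeasurableSet (confined e ρ N n) := fun n =>
    ℱ.le n _ (h.measurableSet_confined ρ N n)
  have hγ0 : ∀ k, 0 ≤ stepSize γ₁ β k := fun k =>
    mul_nonneg hγ₁.le (Real.rpow_nonneg (Nat.cast_nonneg _) _)
  have hγsum : ∀ n, ∑ k ∈ Finset.Ico N n, stepSize γ₁ β k ≤ ∑ k ∈ Finset.range n, stepSize γ₁ β k :=
    fun n => by
      rw [Finset.range_eq_Ico]
      exact Finset.sum_le_sum_of_subset_of_nonneg (Finset.Ico_subset_Ico_left (Nat.zero_le N))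
        fun k _ _ => hγ0 k
  set G : ℝ → ℝ → ℝ := fun z x => Q z x - Q 0 x with hG
  have hGm : Measurable (Function.uncurry G) :=
    hQm.sub (hQm.comp (measurable_const.prodMk measurable_snd))
  have hGi : ∀ z, Integrable (G z) μ := fun z =>
    integrable_of_measurable_of_abs_le (hGm.comp measurable_prodMk_left) (B' * |z|) (hQB z)
  set q : ℝ → ℝ := fun z => ∫ x, G z x ∂μ with hq
  have hqm : Measurable q := (hGm.stronglyMeasurable.integral_prod_right').measurable
  have hqB : ∀ z, |q z| ≤ B' * |z| := fun z => by
    have h1 := norm_integral_le_of_norm_le (f := G z) (integrable_const (B' * |z|))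
      (ae_of_all μ fun x => hQB z x)
    simpa using h1
  set F : ℝ → ℝ → ℝ := fun z x => G z x - q z with hF
  have hFm : Measurable (Function.uncurry F) := hGm.sub (hqm.comp measurable_fst)
  have hF0 : ∀ z, ∫ x, F z x ∂μ = 0 := fun z => by
    simp only [hF]
    rw [integral_sub (hGi z) (integrable_const _)]; simp [hq]
  have hFC : ∀ z x, |z| ≤ ρ → |F z x| ≤ 2 * (B' * ρ) := fun z x hz => by
    have h2 : B' * |z| ≤ B' * ρ := by gcongr
    have h3 := hQB z x
    have h4 := hqB z
    refine (abs_sub _ _).trans ?_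
    simp only [hG]
    linarith
  have hF2 : ∀ z, ∫ x, F z x ^ 2 ∂μ ≤ B' ^ 2 * z ^ 2 := fun z => by
    have hm : Measurable (G z) := hGm.comp measurable_prodMk_left
    have h2 := variance_le_expectation_sq (μ := μ) hm.aestronglyMeasurable
    rw [variance_eq_integral hm.aemeasurable] at h2
    have hle : ∀ x, (G z ^ 2) x ≤ B' ^ 2 * z ^ 2 := fun x => by
      rw [Pi.pow_apply, ← sq_abs, ← mul_pow, ← sq_abs (B' * z), abs_mul, abs_of_nonneg hB']
      have := hQB z x
      gcongr
    refine h2.trans ?_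
    refine (integral_mono_of_nonneg (ae_of_all _ fun x => sq_nonneg _) (integrable_const _)
      (ae_of_all _ hle)).trans ?_
    simp
  -- the contribution of the times before `N`
  set T : Ω → ℝ := fun ω => ∑ k ∈ Finset.range N, |G (e k ω) (X k ω)| with hTdef
  have hGXm : ∀ k, Measurable fun ω => G (e k ω) (X k ω) := fun k =>
    hGm.comp ((h.measurable' k).prodMk (h.measurable_X' k))
  have hGXle : ∀ k ω, |G (e k ω) (X k ω)| ≤ B' * (1 + e k ω ^ 2) := fun k ω => by
    refine (hQB _ _).trans ?_
    gcongr
    rw [← sq_abs]; nlinarith [sq_nonneg (|e k ω| - 1)]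
  have hi1 : ∀ k, Integrable (fun ω => B' * (1 + e k ω ^ 2)) P := fun k =>
    ((integrable_const 1).add (h.integrable_sq k)).const_mul B'
  have hTi1 : ∀ k, Integrable (fun ω => |G (e k ω) (X k ω)|) P := fun k =>
    (hi1 k).mono' (hGXm k).abs.aestronglyMeasurable
      (ae_of_all _ fun ω => by rw [Real.norm_eq_abs, abs_abs]; exact hGXle k ω)
  have hTi : Integrable T P := integrable_finsetSum _ fun k _ => hTi1 k
  have hTrate : ∫ ω, T ω ∂P ≤ N * (B' * K) := by
    rw [hTdef, integral_finsetSum _ fun k _ => hTi1 k]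
    have : ∀ k ∈ Finset.range N, ∫ ω, |G (e k ω) (X k ω)| ∂P ≤ B' * K := fun k _ => by
      refine (integral_mono (hTi1 k) (hi1 k) (hGXle k)).trans ?_
      rw [integral_const_mul, integral_add (integrable_const _) (h.integrable_sq k)]
      have h2 := h.integral_sq_le hc.le hγ₁ hβ₀ k
      gcongr
      simp only [hK, integral_const, probReal_univ, smul_eq_mul, mul_one]
      linarith
    simpa using Finset.sum_le_card_nsmul _ _ _ this
  -- the drift part
  set A : Ω → ℝ := fun ω => ∑ k ∈ Finset.Ico N n,
    (confined e ρ N k).indicator (fun ω => L' * e k ω ^ 2) ω with hAdef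
  have hAi1 : ∀ k, Integrable ((confined e ρ N k).indicator fun ω => L' * e k ω ^ 2) P := fun k =>
    ((h.integrable_sq k).const_mul L').indicator (hmeas k)
  have hA0 : ∀ ω, 0 ≤ A ω := fun ω => Finset.sum_nonneg fun k _ =>
    Set.indicator_nonneg (fun ω _ => by positivity) ω
  have hArate : ∫ ω, A ω ∂P ≤ L' * C * ∑ k ∈ Finset.range n, stepSize γ₁ β k := by
    rw [hAdef, integral_finsetSum _ fun k _ => hAi1 k]
    refine le_trans ?_ (mul_le_mul_of_nonneg_left (hγsum n) (by positivity))
    rw [Finset.mul_sum]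
    refine Finset.sum_le_sum fun k hk => ?_
    rw [integral_indicator (hmeas k), integral_const_mul, mul_assoc]
    gcongr
    exact hC a ℱ X μ H e ha h k (Finset.mem_Ico.1 hk).1
  -- the martingale part
  set M := confinedMartingale e X ρ N F (fun _ => 1) (fun _ => 1) with hM
  have hMrate : ∀ m, N ≤ m → ∫ ω, M m ω ^ 2 ∂P ≤
      B' ^ 2 * C * ∑ k ∈ Finset.Ico N m, stepSize γ₁ β k := by
    intro m hm
    induction m, hm using Nat.le_induction with
    | base => simp [hM, confinedMartingale, linRec_self]
    | succ m hm ih =>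
      have hstep := h.integral_confinedMartingale_sq_succ ρ hm hFm hF0 (by positivity) hFC
        (fun _ => 1) (fun _ => 1)
      rw [← hM, one_pow, one_mul, one_mul] at hstep
      rw [hstep, Finset.sum_Ico_succ_top hm, mul_add]
      refine add_le_add ih ?_
      calc ∫ ω in confined e ρ N m, ∫ x, F (e m ω) x ^ 2 ∂μ ∂P
          ≤ ∫ ω in confined e ρ N m, B' ^ 2 * e m ω ^ 2 ∂P :=
            integral_mono_of_nonneg (ae_of_all _ fun ω => integral_nonneg fun x => sq_nonneg _)
              ((h.integrable_sq m).const_mul _).integrableOn (ae_of_all _ fun ω => hF2 _)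
        _ = B' ^ 2 * ∫ ω in confined e ρ N m, e m ω ^ 2 ∂P := integral_const_mul _ _
        _ ≤ B' ^ 2 * (C * stepSize γ₁ β m) := by gcongr; exact hC a ℱ X μ H e ha h m hm
        _ = _ := by ring
  have hdec : ∀ m, N ≤ m → ∀ ω ∈ confined e ρ N m, ∑ k ∈ Finset.Ico N m, G (e k ω) (X k ω) =
      ∑ k ∈ Finset.Ico N m, q (e k ω) + M m ω := by
    intro m hm
    induction m, hm using Nat.le_induction with
    | base => intro ω _; simp [hM, confinedMartingale, linRec_self]
    | succ m hm ih =>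
      intro ω hω
      have hω' := confined_anti (Nat.le_succ m) hω
      have h5 : M (m + 1) ω = M m ω + F (e m ω) (X m ω) := by
        simp only [hM, confinedMartingale, linRec_succ _ _ _ hm, Set.indicator_of_mem hω', one_mul]
      rw [Finset.sum_Ico_succ_top hm, Finset.sum_Ico_succ_top hm, ih ω hω', h5]
      simp only [hF]; ring
  have hPT : P.real {ω | ε / 3 * √n < T ω} ≤ ε / 4 := by
    refine (measureReal_lt_le_div (fun ω => Finset.sum_nonneg fun k _ => abs_nonneg _) hTi
      (by positivity)).trans ?_
    rw [div_le_iff₀ (by positivity)]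
    rw [div_le_iff₀ hsq] at hnT
    linarith
  have hPA : P.real {ω | ε / 3 * √n < A ω} ≤ ε / 4 := by
    refine (measureReal_lt_le_div hA0 (integrable_finsetSum _ fun k _ => hAi1 k)
      (by positivity)).trans ?_
    rw [div_le_iff₀ (by positivity)]
    rw [← mul_div_assoc, div_le_iff₀ hsq] at hnA
    linarith
  have hPM : P.real {ω | ε / 3 * √n < |M n ω|} ≤ ε / 4 := by
    refine (measureReal_lt_abs_le_div_sq (h.integrable_confinedMartingale_sq ρ hnN hFm
      (by positivity) hFC _ _) (by positivity)).trans ?_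
    rw [div_le_iff₀ (by positivity)]
    rw [← mul_div_assoc, div_le_iff₀ hsq] at hnM
    refine (hMrate n hnN).trans ((mul_le_mul_of_nonneg_left (hγsum n) (by positivity)).trans
      (hnM.trans ?_))
    rw [mul_pow, hsq2]
    have h2 : √(n : ℝ) ≤ n := by nlinarith
    calc (ε / 3) ^ 2 * (ε / 4) * √(n : ℝ) ≤ (ε / 3) ^ 2 * (ε / 4) * n := by gcongr
      _ = _ := by ring
  calc P.real {ω | ε * √n < |∑ k ∈ Finset.range n, (Q (e k ω) (X k ω) - Q 0 (X k ω))|}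
      ≤ P.real ((confined e ρ N n)ᶜ ∪ ({ω | ε / 3 * √n < T ω} ∪
          ({ω | ε / 3 * √n < A ω} ∪ {ω | ε / 3 * √n < |M n ω|}))) := by
        refine measureReal_mono fun ω hω => ?_
        by_cases h2 : ω ∈ confined e ρ N n
        · refine Or.inr ?_
          by_contra hcon
          rw [Set.mem_union, not_or, Set.mem_union, not_or] at hcon
          have h3 : T ω ≤ ε / 3 * √n := not_lt.1 hcon.1
          have h4 : A ω ≤ ε / 3 * √n := not_lt.1 hcon.2.1
          have h5 : |M n ω| ≤ ε / 3 * √n := not_lt.1 hcon.2.2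
          have h6 : ε * √n < |∑ k ∈ Finset.range n, G (e k ω) (X k ω)| := hω
          rw [← Finset.sum_range_add_sum_Ico _ hnN, hdec n hnN ω h2] at h6
          have h7 : |∑ k ∈ Finset.range N, G (e k ω) (X k ω)| ≤ T ω :=
            Finset.abs_sum_le_sum_abs _ _
          have h8 : |∑ k ∈ Finset.Ico N n, q (e k ω)| ≤ A ω := by
            refine (Finset.abs_sum_le_sum_abs _ _).trans (Finset.sum_le_sum fun k hk => ?_)
            rw [Set.indicator_of_mem (confined_anti (Finset.mem_Ico.1 hk).2.le h2)]
            exact hQL _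
          have h9 := abs_add_le (∑ k ∈ Finset.range N, G (e k ω) (X k ω))
            (∑ k ∈ Finset.Ico N n, q (e k ω) + M n ω)
          have h10 := abs_add_le (∑ k ∈ Finset.Ico N n, q (e k ω)) (M n ω)
          linarith
        · exact Or.inl h2
    _ ≤ ε / 4 + (ε / 4 + (ε / 4 + ε / 4)) :=
      (measureReal_union_le _ _).trans (add_le_add (hN a ℱ X μ H e h n hnN)
        ((measureReal_union_le _ _).trans (add_le_add hPT
          ((measureReal_union_le _ _).trans (add_le_add hPA hPM)))))
    _ = ε := by ring

end IsErrorProcess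

/-! ### Laws with a continuous density -/

namespace IsContinuousPdf

set_option linter.unusedSectionVars false

variable {Ω : Type*} [MeasurableSpace Ω] {P : Measure Ω} [IsProbabilityMeasure P]
  {X : Ω → ℝ} {f : ℝ → ℝ}

lemma integral_comp (hf : IsContinuousPdf P X f) (hX : Measurable X) {g : ℝ → ℝ}
    (hg : Measurable g) : ∫ ω, g (X ω) ∂P = ∫ x, f x * g x := by
  rw [← integral_map hX.aemeasurable hg.aestronglyMeasurable, hf.map_eq,
    integral_withDensity_eq_integral_toReal_smul (hf.continuous.measurable.ennreal_ofReal)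
      (ae_of_all _ fun _ => ENNReal.ofReal_lt_top)]
  refine integral_congr_ae (ae_of_all _ fun x => ?_)
  simp [ENNReal.toReal_ofReal (hf.nonneg x)]

lemma integrable_comp_iff (hf : IsContinuousPdf P X f) (hX : Measurable X) {g : ℝ → ℝ}
    (hg : Measurable g) : Integrable (fun ω => g (X ω)) P ↔ Integrable fun x => f x * g x := by
  have h1 := integrable_map_measure (μ := P) (f := X) (g := g) hg.aestronglyMeasurable hX.aemeasurable
  rw [hf.map_eq, integrable_withDensity_iff_integrable_smul' (hf.continuous.measurable.ennreal_ofReal)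
    (ae_of_all _ fun _ => ENNReal.ofReal_lt_top)] at h1
  rw [show (fun ω => g (X ω)) = g ∘ X from rfl, ← h1]
  refine integrable_congr (ae_of_all _ fun x => ?_)
  simp [ENNReal.toReal_ofReal (hf.nonneg x)]

lemma integrable (hf : IsContinuousPdf P X f) (hX : Measurable X) : Integrable f := by
  have h1 := (hf.integrable_comp_iff hX (g := fun _ => 1) measurable_const).1 (integrable_const 1)
  simpa using h1

lemma integral_eq_one (hf : IsContinuousPdf P X f) (hX : Measurable X) : ∫ x, f x = 1 := by
  have h1 := hf.integral_comp hX (g := fun _ => 1) measurable_const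
  simpa using h1.symm

lemma measureReal_preimage (hf : IsContinuousPdf P X f) (hX : Measurable X) {s : Set ℝ}
    (hs : MeasurableSet s) : P.real (X ⁻¹' s) = ∫ x in s, f x := by
  have h1 := hf.integral_comp hX (g := s.indicator fun _ => 1) (measurable_const.indicator hs)
  rw [← integral_indicator hs, show P.real (X ⁻¹' s) = ∫ ω, s.indicator (fun _ => 1) (X ω) ∂P from ?_]
  · rw [h1]
    refine integral_congr_ae (ae_of_all _ fun x => ?_)
    by_cases hx : x ∈ s <;> simp [hx]
  · have h2 : (fun ω => s.indicator (fun _ => (1 : ℝ)) (X ω)) = (X ⁻¹' s).indicator 1 := by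
      ext ω; by_cases hx : X ω ∈ s <;> simp [hx]
    rw [h2, integral_indicator_one (hX hs)]

lemma cdfOf_eq (hf : IsContinuousPdf P X f) (hX : Measurable X) (ξ : ℝ) :
    cdfOf P X ξ = ∫ x in Set.Iic ξ, f x :=
  hf.measureReal_preimage hX measurableSet_Iic

lemma cdfOf_sub (hf : IsContinuousPdf P X f) (hX : Measurable X) (a b : ℝ) :
    cdfOf P X b - cdfOf P X a = ∫ x in a..b, f x := by
  rw [hf.cdfOf_eq hX, hf.cdfOf_eq hX, intervalIntegral.integral_Iic_sub_Iic]
  · exact (hf.integrable hX).integrableOn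
  · exact (hf.integrable hX).integrableOn

lemma measureReal_le (hf : IsContinuousPdf P X f) (hX : Measurable X) (ξ : ℝ) :
    P.real {ω | ξ ≤ X ω} = 1 - cdfOf P X ξ := by
  have h1 : P.real {ω | ξ ≤ X ω} = ∫ x in Set.Ici ξ, f x :=
    hf.measureReal_preimage hX measurableSet_Ici
  have h2 := integral_add_compl (μ := volume) (measurableSet_Iic (a := ξ)) (hf.integrable hX)
  rw [hf.integral_eq_one hX, Set.compl_Iic, ← hf.cdfOf_eq hX] at h2
  rw [h1, integral_Ici_eq_integral_Ioi]
  linarith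

lemma measure_eq_zero (hf : IsContinuousPdf P X f) (hX : Measurable X) (ξ : ℝ) :
    ∀ᵐ ω ∂P, X ω ≠ ξ := by
  have h1 : P.map X {ξ} = 0 := by
    rw [hf.map_eq, withDensity_apply _ (measurableSet_singleton ξ)]
    simp
  rw [Measure.map_apply hX (measurableSet_singleton ξ)] at h1
  exact measure_eq_zero_iff_ae_notMem.1 h1

lemma hasDerivAt_cdfOf (hf : IsContinuousPdf P X f) (hX : Measurable X) (ξ : ℝ) :
    HasDerivAt (cdfOf P X) (f ξ) ξ := by
  have h1 : cdfOf P X = fun x => cdfOf P X 0 + ∫ t in (0 : ℝ)..x, f t := by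
    ext x; rw [← hf.cdfOf_sub hX]; ring
  rw [h1]
  exact (hf.continuous.integral_hasStrictDerivAt 0 ξ).hasDerivAt.const_add _

lemma continuous_cdfOf (hf : IsContinuousPdf P X f) (hX : Measurable X) :
    Continuous (cdfOf P X) :=
  continuous_iff_continuousAt.2 fun ξ => (hf.hasDerivAt_cdfOf hX ξ).continuousAt

lemma strictMono_cdfOf (hf : IsContinuousPdf P X f) (hX : Measurable X) (hpos : ∀ x, 0 < f x) :
    StrictMono (cdfOf P X) :=
  strictMono_of_deriv_pos fun ξ => by rw [(hf.hasDerivAt_cdfOf hX ξ).deriv]; exact hpos ξ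

lemma abs_cdfOf_sub_le (hf : IsContinuousPdf P X f) (hX : Measurable X) {C : ℝ}
    (hC : ∀ x, |f x| ≤ C) (a b : ℝ) : |cdfOf P X b - cdfOf P X a| ≤ C * |b - a| := by
  rw [hf.cdfOf_sub hX]
  exact intervalIntegral.norm_integral_le_of_norm_le_const (f := f) fun x _ => hC x

/-- The linearisation of the distribution function around `m`. -/
lemma abs_cdfOf_sub_sub_le (hf : IsContinuousPdf P X f) (hX : Measurable X) {L : ℝ} (hL : 0 ≤ L)
    (hC : ∀ x y, |f x - f y| ≤ L * |x - y|) (m z : ℝ) :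
    |cdfOf P X (m + z) - cdfOf P X m - f m * z| ≤ L * z ^ 2 := by
  have h1 : cdfOf P X (m + z) - cdfOf P X m - f m * z = ∫ x in m..(m + z), (f x - f m) := by
    rw [intervalIntegral.integral_sub (hf.continuous.intervalIntegrable _ _)
      (continuous_const.intervalIntegrable _ _), hf.cdfOf_sub hX]
    simp; ring
  rw [h1]
  have h2 := intervalIntegral.norm_integral_le_of_norm_le_const (a := m) (b := m + z)
    (f := fun x => f x - f m) (C := L * |z|) fun x hx => ?_
  · rw [Real.norm_eq_abs] at h2
    refine h2.trans (le_of_eq ?_)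
    rw [add_sub_cancel_left, mul_assoc, ← sq, sq_abs]
  · refine (hC x m).trans ?_
    refine mul_le_mul_of_nonneg_left ?_ hL
    have h3 := Set.abs_sub_left_of_mem_uIcc (Set.uIoc_subset_uIcc hx)
    rw [add_sub_cancel_left] at h3
    exact h3

/-- Growth of the distribution function around `m`, at least linear up to distance `1`. -/
lemma mul_min_le_cdfOf (hf : IsContinuousPdf P X f) (hX : Measurable X) {c m : ℝ}
    (hfc : ∀ x, |x - m| ≤ 1 → c ≤ f x) (z : ℝ) :
    c * min (z ^ 2) |z| ≤ z * (cdfOf P X (m + z) - cdfOf P X m) := by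
  have hmono : Monotone (cdfOf P X) := monotone_of_deriv_nonneg
    (fun ξ => (hf.hasDerivAt_cdfOf hX ξ).differentiableAt) fun ξ => by
      rw [(hf.hasDerivAt_cdfOf hX ξ).deriv]; exact hf.nonneg ξ
  -- both one sided estimates
  have key : ∀ a b, a ≤ b → |a - m| ≤ 1 → |b - m| ≤ 1 →
      c * (b - a) ≤ cdfOf P X b - cdfOf P X a := by
    intro a b hab ha hb
    rw [hf.cdfOf_sub hX]
    have h1 : ∫ _ in a..b, c = c * (b - a) := by simp; ring
    rw [← h1]
    refine intervalIntegral.integral_mono_on hab (continuous_const.intervalIntegrable _ _)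
      (hf.continuous.intervalIntegrable _ _) fun x hx => hfc x ?_
    rw [abs_le] at ha hb ⊢
    exact ⟨by linarith [hx.1], by linarith [hx.2]⟩
  rcases le_total 0 z with hz | hz
  · rw [abs_of_nonneg hz]
    have h1 : c * min z 1 ≤ cdfOf P X (m + z) - cdfOf P X m := by
      have h2 := key m (m + min z 1) (by simp [hz]) (by simp) (by
        rw [add_sub_cancel_left, abs_of_nonneg (le_min hz zero_le_one)]; exact min_le_right _ _)
      rw [add_sub_cancel_left] at h2
      refine h2.trans (sub_le_sub_right (hmono ?_) _)
      linarith [min_le_left z 1]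
    calc c * min (z ^ 2) z = z * (c * min z 1) := by
          rw [show z * (c * min z 1) = c * (z * min z 1) by ring, mul_min_of_nonneg _ _ hz]
          congr 2 <;> ring
      _ ≤ _ := mul_le_mul_of_nonneg_left h1 hz
  · rw [abs_of_nonpos hz]
    have hz' : 0 ≤ -z := by linarith
    have h1 : c * min (-z) 1 ≤ cdfOf P X m - cdfOf P X (m + z) := by
      have h2 := key (m - min (-z) 1) m (by simp [hz]) (by
        rw [sub_sub_cancel_left, abs_neg, abs_of_nonneg (le_min hz' zero_le_one)]
        exact min_le_right _ _) (by simp)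
      rw [sub_sub_cancel] at h2
      refine h2.trans (sub_le_sub_left (hmono ?_) _)
      linarith [min_le_left (-z) 1]
    calc c * min (z ^ 2) (-z) = (-z) * (c * min (-z) 1) := by
          rw [show (-z) * (c * min (-z) 1) = c * ((-z) * min (-z) 1) by ring,
            mul_min_of_nonneg _ _ hz']
          congr 2 <;> ring
      _ ≤ (-z) * (cdfOf P X m - cdfOf P X (m + z)) := mul_le_mul_of_nonneg_left h1 hz'
      _ = _ := by ring

/-! ### The Rockafellar–Uryasev objective -/

lemma integrable_max (hi : Integrable X P) (ξ : ℝ) :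
    Integrable (fun ω => max (X ω - ξ) 0) P :=
  (hi.sub (integrable_const ξ)).pos_part

lemma hasDerivAt_V (hf : IsContinuousPdf P X f) (hX : Measurable X) (hi : Integrable X P) {α : ℝ}
    (hα₁ : α < 1) (ξ : ℝ) :
    HasDerivAt (V P α X) ((cdfOf P X ξ - α) / (1 - α)) ξ := by
  have h1 := hasDerivAt_integral_of_dominated_loc_of_lip (𝕜 := ℝ) (μ := P) (x₀ := ξ)
    (s := Set.univ)
    (F := fun ξ ω => max (X ω - ξ) 0) (F' := {ω | ξ ≤ X ω}.indicator fun _ => (-1 : ℝ))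
    (bound := fun _ => 1) Filter.univ_mem
    (Eventually.of_forall fun y => ((hX.sub_const y).max measurable_const).aestronglyMeasurable)
    (integrable_max hi ξ)
    ((measurable_const.indicator (measurableSet_le measurable_const hX)).aestronglyMeasurable)
    (ae_of_all _ fun ω => by
      refine LipschitzOnWith.of_dist_le_mul fun x _ y _ => ?_
      rw [Real.dist_eq, Real.dist_eq]
      simp only [Real.coe_nnabs, abs_one, one_mul]
      refine (abs_max_sub_max_le_abs _ _ _).trans (le_of_eq ?_)
      rw [abs_sub_comm]; congr 1; ring)
    (integrable_const 1) (by
      filter_upwards [hf.measure_eq_zero hX ξ] with ω hω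
      rcases lt_or_gt_of_ne hω with h | h
      · have h2 : ω ∉ {ω | ξ ≤ X ω} := not_le.2 h
        rw [Set.indicator_of_notMem h2]
        refine (hasDerivAt_const ξ (0 : ℝ)).congr_of_eventuallyEq ?_
        filter_upwards [eventually_gt_nhds h] with y hy
        rw [max_eq_right (by linarith)]
      · have h2 : ω ∈ {ω | ξ ≤ X ω} := h.le
        rw [Set.indicator_of_mem h2]
        refine ((hasDerivAt_id ξ).const_sub (X ω)).congr_of_eventuallyEq ?_
        filter_upwards [eventually_lt_nhds h] with y hy
        rw [max_eq_left (by linarith)]; rfl)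
  have h2 := (hasDerivAt_id ξ).add (h1.2.const_mul (1 / (1 - α)))
  have h3 : ∫ ω, {ω | ξ ≤ X ω}.indicator (fun _ => (-1 : ℝ)) ω ∂P = -(1 - cdfOf P X ξ) := by
    rw [integral_indicator_const _ (measurableSet_le measurable_const hX), hf.measureReal_le hX]
    simp
  rw [h3] at h2
  convert! h2 using 1
  have : (1 - α) ≠ 0 := by linarith
  field_simp; ring

lemma deriv_deriv_V (hf : IsContinuousPdf P X f) (hX : Measurable X) (hi : Integrable X P) {α : ℝ}
    (hα₁ : α < 1) : deriv (deriv (V P α X)) = fun ξ => f ξ / (1 - α) := by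
  have h1 : deriv (V P α X) = fun ξ => (cdfOf P X ξ - α) / (1 - α) :=
    funext fun ξ => (hf.hasDerivAt_V hX hi hα₁ ξ).deriv
  rw [h1]
  exact funext fun ξ => (((hf.hasDerivAt_cdfOf hX ξ).sub_const α).div_const (1 - α)).deriv

lemma cdfOf_eq_of_isMinOn (hf : IsContinuousPdf P X f) (hX : Measurable X) (hi : Integrable X P)
    {α : ℝ} (hα₁ : α < 1) {m : ℝ} (hm : IsMinOn (V P α X) Set.univ m) : cdfOf P X m = α := by
  have h1 := (hm.isLocalMin Filter.univ_mem).hasDerivAt_eq_zero (hf.hasDerivAt_V hX hi hα₁ m)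
  have : (1 - α) ≠ 0 := by linarith
  rw [div_eq_zero_iff] at h1
  rcases h1 with h1 | h1
  · linarith
  · exact absurd h1 this

/-- Near its minimiser the objective is quadratic. -/
lemma abs_V_sub_le (hf : IsContinuousPdf P X f) (hX : Measurable X) (hi : Integrable X P)
    {α : ℝ} (hα₁ : α < 1) {m : ℝ} (hm : cdfOf P X m = α) {C : ℝ} (hC : ∀ x, |f x| ≤ C) (z : ℝ) :
    |V P α X (m + z) - V P α X m| ≤ C / (1 - α) * z ^ 2 := by
  have h1α : 0 < 1 - α := by linarith
  have h1 := (convex_uIcc m (m + z)).norm_image_sub_le_of_norm_hasDerivWithin_le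
    (f := V P α X) (C := C * |z| / (1 - α))
    (fun x _ => (hf.hasDerivAt_V hX hi hα₁ x).hasDerivWithinAt) (fun x hx => ?_)
    Set.left_mem_uIcc Set.right_mem_uIcc
  · rw [add_sub_cancel_left, Real.norm_eq_abs, Real.norm_eq_abs] at h1
    refine h1.trans (le_of_eq ?_)
    rw [← sq_abs z]; field_simp
  · rw [norm_div, Real.norm_of_nonneg h1α.le, Real.norm_eq_abs]
    gcongr
    have h2 := hf.abs_cdfOf_sub_le hX hC m x
    rw [hm] at h2
    refine h2.trans ?_
    have hC0 : 0 ≤ C := (abs_nonneg _).trans (hC 0)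
    refine mul_le_mul_of_nonneg_left ?_ hC0
    have h3 := Set.abs_sub_left_of_mem_uIcc hx
    rw [add_sub_cancel_left] at h3
    exact h3

/-! ### Value-at-risk and expected shortfall -/

lemma exists_cdfOf_eq (hf : IsContinuousPdf P X f) (hX : Measurable X) {a : ℝ} (ha₀ : 0 < a)
    (ha₁ : a < 1) : ∃ x, cdfOf P X x = a := by
  have : IsProbabilityMeasure (P.map X) := Measure.isProbabilityMeasure_map hX.aemeasurable
  have h1 : cdfOf P X = cdf (P.map X) := by
    ext x
    rw [cdf_eq_real, map_measureReal_apply hX measurableSet_Iic]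
    rfl
  have hbot : Tendsto (cdfOf P X) atBot (𝓝 0) := by rw [h1]; exact tendsto_cdf_atBot _
  have htop : Tendsto (cdfOf P X) atTop (𝓝 1) := by rw [h1]; exact tendsto_cdf_atTop _
  exact mem_range_of_exists_le_of_exists_ge (hf.continuous_cdfOf hX)
    (hbot.eventually (ge_mem_nhds ha₀)).exists (htop.eventually (le_mem_nhds ha₁)).exists

lemma VaR_cdfOf (hf : IsContinuousPdf P X f) (hX : Measurable X) (hpos : ∀ x, 0 < f x) (x : ℝ) :
    VaR P (cdfOf P X x) X = x := by
  have h1 : {ξ : ℝ | cdfOf P X x ≤ cdfOf P X ξ} = Set.Ici x := by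
    ext ξ; simpa using (hf.strictMono_cdfOf hX hpos).le_iff_le
  rw [VaR, h1, csInf_Ici]

lemma cdfOf_VaR (hf : IsContinuousPdf P X f) (hX : Measurable X) (hpos : ∀ x, 0 < f x) {a : ℝ}
    (ha₀ : 0 < a) (ha₁ : a < 1) : cdfOf P X (VaR P a X) = a := by
  obtain ⟨x, rfl⟩ := hf.exists_cdfOf_eq hX ha₀ ha₁
  rw [hf.VaR_cdfOf hX hpos]

lemma cdfOf_mem_Ioo (hf : IsContinuousPdf P X f) (hX : Measurable X) (hpos : ∀ x, 0 < f x)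
    (x : ℝ) : cdfOf P X x < 1 := by
  have h1 := hf.strictMono_cdfOf hX hpos (lt_add_one x)
  exact h1.trans_le measureReal_le_one

/-- The expected shortfall is the minimum of the objective: the quantile function is integrated by
the substitution `a = F ξ`. -/
lemma ES_eq (hf : IsContinuousPdf P X f) (hX : Measurable X) (hi : Integrable X P)
    (hpos : ∀ x, 0 < f x) {α : ℝ} (hα₀ : 0 < α) (hα₁ : α < 1) :
    ES P α X = V P α X (VaR P α X) := by
  set m := VaR P α X with hm
  have hFm : cdfOf P X m = α := hf.cdfOf_VaR hX hpos hα₀ hα₁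
  have himg : cdfOf P X '' Set.Ioi m = Set.Ioo α 1 := by
    ext a
    constructor
    · rintro ⟨x, hx, rfl⟩
      exact ⟨hFm ▸ hf.strictMono_cdfOf hX hpos hx, hf.cdfOf_mem_Ioo hX hpos x⟩
    · rintro ⟨h1, h2⟩
      obtain ⟨x, rfl⟩ := hf.exists_cdfOf_eq hX (hα₀.trans h1) h2
      refine ⟨x, ?_, rfl⟩
      rw [← hFm] at h1
      exact (hf.strictMono_cdfOf hX hpos).lt_iff_lt.1 h1
  have hES : ∫ a in α..1, VaR P a X = ∫ x in Set.Ioi m, f x * x := by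
    rw [intervalIntegral.integral_of_le hα₁.le, integral_Ioc_eq_integral_Ioo, ← himg,
      integral_image_eq_integral_abs_deriv_smul measurableSet_Ioi
        (fun x _ => (hf.hasDerivAt_cdfOf hX x).hasDerivWithinAt)
        (hf.strictMono_cdfOf hX hpos).injective.injOn]
    refine integral_congr_ae (ae_of_all _ fun x => ?_)
    simp only [hf.VaR_cdfOf hX hpos, abs_of_pos (hpos x), smul_eq_mul]
  have hix : Integrable fun x => f x * x := (hf.integrable_comp_iff hX measurable_id).1 hi
  have hV : ∫ ω, max (X ω - m) 0 ∂P = ∫ x in Set.Ioi m, (f x * x - f x * m) := by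
    rw [hf.integral_comp hX (g := fun x => max (x - m) 0)
      ((measurable_id.sub_const m).max measurable_const), ← integral_indicator measurableSet_Ioi]
    refine integral_congr_ae (ae_of_all _ fun x => ?_)
    by_cases hx : m < x
    · simp only [Set.indicator_of_mem (show x ∈ Set.Ioi m from hx)]
      rw [max_eq_left (by linarith)]; ring
    · simp only [Set.indicator_of_notMem (show x ∉ Set.Ioi m from hx)]
      rw [max_eq_right (by linarith), mul_zero]
  have htail : ∫ x in Set.Ioi m, f x = 1 - α := by
    have h2 := integral_add_compl (μ := volume) (measurableSet_Iic (a := m)) (hf.integrable hX)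
    rw [hf.integral_eq_one hX, Set.compl_Iic, ← hf.cdfOf_eq hX, hFm] at h2
    linarith
  rw [ES, V, hES, hV, integral_sub hix.integrableOn ((hf.integrable hX).mul_const m).integrableOn,
    integral_mul_const, htail]
  have : (1 - α) ≠ 0 := by linarith
  field_simp; ring

end IsContinuousPdf

/-! ### The quantile recursion as an error process -/

section Increments

lemma measurable_H₁ (α : ℝ) : Measurable (Function.uncurry (H₁ α)) := by
  have : MeasurableSet {p : ℝ × ℝ | p.1 ≤ p.2} := measurableSet_le measurable_fst measurable_snd
  unfold H₁ Function.uncurry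
  exact ((measurable_const.ite this measurable_const).const_mul _).const_sub _

lemma measurable_H₁_right (α ξ : ℝ) : Measurable (H₁ α ξ) :=
  (measurable_H₁ α).comp measurable_prodMk_left

lemma abs_H₁_le {α : ℝ} (hα₁ : α < 1) (ξ x : ℝ) : |H₁ α ξ x| ≤ 1 + 1 / (1 - α) := by
  have h1 : 0 < 1 / (1 - α) := by have : 0 < 1 - α := by linarith
                                  positivity
  unfold H₁
  split_ifs <;> rw [abs_le] <;> constructor <;> linarith

/-- The increment of the estimator of the minimum, recentred at the minimum `V₀`, at the distance
`z` of the minimiser `m`. -/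
noncomputable def recentred (α m V₀ z x : ℝ) : ℝ := -H₂ α (m + z) V₀ x

lemma measurable_recentred (α m V₀ : ℝ) : Measurable (Function.uncurry (recentred α m V₀)) := by
  unfold recentred H₂ Function.uncurry
  fun_prop

lemma measurable_recentred_right (α m V₀ z : ℝ) : Measurable (recentred α m V₀ z) :=
  (measurable_recentred α m V₀).comp measurable_prodMk_left

lemma abs_recentred_sub_le {α : ℝ} (hα₁ : α < 1) (m V₀ z x : ℝ) :
    |recentred α m V₀ z x - recentred α m V₀ 0 x| ≤ (1 + 1 / (1 - α)) * |z| := by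
  have h1 : 0 < 1 - α := by linarith
  have h2 : recentred α m V₀ z x - recentred α m V₀ 0 x =
      z + 1 / (1 - α) * (max (x - (m + z)) 0 - max (x - (m + 0)) 0) := by
    unfold recentred H₂; ring
  rw [h2, add_mul, one_mul]
  refine (abs_add_le _ _).trans (add_le_add le_rfl ?_)
  rw [abs_mul, abs_of_pos (by positivity : (0 : ℝ) < 1 / (1 - α))]
  refine mul_le_mul_of_nonneg_left ?_ (by positivity)
  have h3 := abs_max_sub_max_le_abs (x - (m + z)) (x - (m + 0)) 0
  have h4 : x - (m + z) - (x - (m + 0)) = -z := by ring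
  rwa [h4, abs_neg] at h3

end Increments

namespace IsContinuousPdf

variable {Ω : Type*} [MeasurableSpace Ω] {P : Measure Ω} [IsProbabilityMeasure P]
  {X : Ω → ℝ} {f : ℝ → ℝ} {α : ℝ}

open Classical in
lemma integral_ite_le (hf : IsContinuousPdf P X f) (hX : Measurable X) (ξ : ℝ) :
    Integrable (fun ω => if ξ ≤ X ω then (1 : ℝ) else 0) P ∧
      ∫ ω, (if ξ ≤ X ω then (1 : ℝ) else 0) ∂P = 1 - cdfOf P X ξ := by
  have hs : MeasurableSet {ω | ξ ≤ X ω} := measurableSet_le measurable_const hX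
  have h1 : (fun ω => if ξ ≤ X ω then (1 : ℝ) else 0) = {ω | ξ ≤ X ω}.indicator 1 := by
    ext ω; simp [Set.indicator_apply]
  rw [h1]
  refine ⟨(integrable_const 1).indicator hs, ?_⟩
  rw [integral_indicator_one hs, hf.measureReal_le hX]

lemma integral_H₁ (hf : IsContinuousPdf P X f) (hX : Measurable X) (hα₁ : α < 1) (ξ : ℝ) :
    ∫ x, H₁ α ξ x ∂(P.map X) = (cdfOf P X ξ - α) / (1 - α) := by
  rw [integral_map hX.aemeasurable (measurable_H₁_right α ξ).aestronglyMeasurable]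
  obtain ⟨h1, h2⟩ := hf.integral_ite_le hX ξ
  unfold H₁
  rw [integral_sub (integrable_const _) (h1.const_mul _), integral_const_mul, h2]
  have : (1 - α) ≠ 0 := by linarith
  simp; field_simp; ring

/-- The variance of the increment at the quantile of level `α`. -/
lemma integral_H₁_sq (hf : IsContinuousPdf P X f) (hX : Measurable X) (hα₁ : α < 1) {m : ℝ}
    (hm : cdfOf P X m = α) : ∫ ω, H₁ α m (X ω) ^ 2 ∂P = α / (1 - α) := by
  obtain ⟨h1, h2⟩ := hf.integral_ite_le hX m
  have h3 : ∀ ω, H₁ α m (X ω) ^ 2 =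
      1 + ((1 / (1 - α)) ^ 2 - 2 * (1 / (1 - α))) * (by
        classical exact if m ≤ X ω then (1 : ℝ) else 0) := fun ω => by
    unfold H₁; split_ifs <;> ring
  simp_rw [h3]
  rw [integral_add (integrable_const _) (h1.const_mul _), integral_const_mul, h2, hm]
  have : (1 - α) ≠ 0 := by linarith
  simp; field_simp; ring

lemma integral_H₁_sub_sq_le (hf : IsContinuousPdf P X f) (hX : Measurable X) (hα₁ : α < 1)
    {C : ℝ} (hC : ∀ x, |f x| ≤ C) (m z : ℝ) :
    ∫ x, (H₁ α (m + z) x - H₁ α (m + 0) x) ^ 2 ∂(P.map X) ≤ (1 / (1 - α)) ^ 2 * C * |z| := by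
  have hme : Measurable fun x => (H₁ α (m + z) x - H₁ α m x) ^ 2 :=
    ((measurable_H₁_right α _).sub (measurable_H₁_right α _)).pow_const 2
  rw [add_zero, integral_map hX.aemeasurable hme.aestronglyMeasurable]
  obtain ⟨h1, h2⟩ := hf.integral_ite_le hX m
  obtain ⟨h3, h4⟩ := hf.integral_ite_le hX (m + z)
  have h5 : ∫ ω, (H₁ α (m + z) (X ω) - H₁ α m (X ω)) ^ 2 ∂P =
      (1 / (1 - α)) ^ 2 * |cdfOf P X (m + z) - cdfOf P X m| := by
    rcases le_total 0 z with hz | hz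
    · have h6 : ∀ ω, (H₁ α (m + z) (X ω) - H₁ α m (X ω)) ^ 2 = (1 / (1 - α)) ^ 2 * (by
          classical exact (if m ≤ X ω then (1 : ℝ) else 0) - if m + z ≤ X ω then 1 else 0) := by
        intro ω; unfold H₁; split_ifs <;> first | (exfalso; linarith) | ring
      have h7 : cdfOf P X m ≤ cdfOf P X (m + z) :=
        measureReal_mono fun ω (hω : X ω ≤ _) => show X ω ≤ _ by linarith
      simp_rw [h6]
      rw [integral_const_mul, integral_sub h1 h3, h2, h4, abs_of_nonneg (by linarith)]
      ring
    · have h6 : ∀ ω, (H₁ α (m + z) (X ω) - H₁ α m (X ω)) ^ 2 = (1 / (1 - α)) ^ 2 * (by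
          classical exact (if m + z ≤ X ω then (1 : ℝ) else 0) - if m ≤ X ω then 1 else 0) := by
        intro ω; unfold H₁; split_ifs <;> first | (exfalso; linarith) | ring
      have h7 : cdfOf P X (m + z) ≤ cdfOf P X m :=
        measureReal_mono fun ω (hω : X ω ≤ _) => show X ω ≤ _ by linarith
      simp_rw [h6]
      rw [integral_const_mul, integral_sub h3 h1, h2, h4, abs_of_nonpos (by linarith)]
      ring
  rw [h5, mul_assoc]
  gcongr
  have := hf.abs_cdfOf_sub_le hX hC m (m + z)
  rwa [add_sub_cancel_left] at this

lemma integral_recentred (hX : Measurable X) (hi : Integrable X P) (α m V₀ z : ℝ) :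
    Integrable (recentred α m V₀ z) (P.map X) ∧
      ∫ x, recentred α m V₀ z x ∂(P.map X) = V P α X (m + z) - V₀ := by
  have h1 := (integrable_max hi (m + z)).const_mul (1 / (1 - α))
  have h2 : ∀ x, recentred α m V₀ z x =
      (m + z - V₀) + 1 / (1 - α) * max (x - (m + z)) 0 := fun x => by
    unfold recentred H₂; ring
  have h3 : Integrable (fun ω => recentred α m V₀ z (X ω)) P := by
    simp_rw [h2]; exact (integrable_const _).add h1
  refine ⟨(integrable_map_measure (measurable_recentred_right α m V₀ z).aestronglyMeasurable
    hX.aemeasurable).2 h3, ?_⟩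
  rw [integral_map hX.aemeasurable (measurable_recentred_right α m V₀ z).aestronglyMeasurable]
  simp_rw [h2]
  rw [integral_add (integrable_const _) h1, integral_const_mul, V]
  simp; ring

lemma abs_integral_recentred_sub_le (hf : IsContinuousPdf P X f) (hX : Measurable X)
    (hi : Integrable X P) (hα₁ : α < 1) {m : ℝ} (hm : cdfOf P X m = α) {C : ℝ}
    (hC : ∀ x, |f x| ≤ C) (V₀ z : ℝ) :
    |∫ x, (recentred α m V₀ z x - recentred α m V₀ 0 x) ∂(P.map X)| ≤ C / (1 - α) * z ^ 2 := by
  obtain ⟨h1, h2⟩ := integral_recentred (α := α) (m := m) (V₀ := V₀) (z := z) hX hi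
  obtain ⟨h3, h4⟩ := integral_recentred (α := α) (m := m) (V₀ := V₀) (z := 0) hX hi
  rw [integral_sub h1 h3, h2, h4, add_zero]
  have := hf.abs_V_sub_le hX hi hα₁ hm hC z
  rwa [sub_sub_sub_cancel_right]

end IsContinuousPdf

section Innovation

variable {Ω : Type*} [mΩ : MeasurableSpace Ω] {P : Measure Ω} [IsProbabilityMeasure P]

/-- Independence is associative: if `U` is independent of `(A, B)` and `A` is independent of `B`,
then `(U, A)` is independent of `B`. -/
lemma indepFun_prodMk_of_indepFun {S T R : Type*} [MeasurableSpace S] [MeasurableSpace T]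
    [MeasurableSpace R] {U : Ω → S} {A : Ω → T} {B : Ω → R} (hU : Measurable U)
    (hA : Measurable A) (hB : Measurable B) (h1 : IndepFun U (fun ω => (A ω, B ω)) P)
    (h2 : IndepFun A B P) : IndepFun (fun ω => (U ω, A ω)) B P := by
  have : IsProbabilityMeasure (P.map U) := Measure.isProbabilityMeasure_map hU.aemeasurable
  have : IsProbabilityMeasure (P.map A) := Measure.isProbabilityMeasure_map hA.aemeasurable
  have : IsProbabilityMeasure (P.map B) := Measure.isProbabilityMeasure_map hB.aemeasurable
  have hUA : IndepFun U A P := h1.comp measurable_id measurable_fst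
  rw [indepFun_iff_map_prod_eq_prod_map_map (by fun_prop) (by fun_prop)] at h1 h2 hUA ⊢
  rw [hUA]
  rw [h2] at h1
  have h3 := (measurePreserving_prodAssoc (P.map U) (P.map A) (P.map B)).symm.map_eq
  rw [← h3, ← h1, Measure.map_map (by fun_prop) (by fun_prop)]
  rfl

/-- The history of the starting point and of the first `k` innovations. -/
def history (ξ₀ : Ω → ℝ) (x : ℕ → Ω → ℝ) (k : ℕ) (ω : Ω) : ℝ × (Finset.range k → ℝ) :=
  (ξ₀ ω, fun i => x i ω)

lemma measurable_history {ξ₀ : Ω → ℝ} {x : ℕ → Ω → ℝ} (hξ₀ : Measurable ξ₀)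
    (hx : ∀ k, Measurable (x k)) (k : ℕ) : Measurable (history ξ₀ x k) :=
  hξ₀.prodMk (measurable_pi_lambda _ fun i => hx i)

/-- The filtration generated by the starting point and the innovations. -/
def historyFiltration {ξ₀ : Ω → ℝ} {x : ℕ → Ω → ℝ} (hξ₀ : Measurable ξ₀)
    (hx : ∀ k, Measurable (x k)) : Filtration ℕ mΩ where
  seq k := MeasurableSpace.comap (history ξ₀ x k) inferInstance
  mono' k l hkl := by
    have h1 : history ξ₀ x k = (fun p : ℝ × (Finset.range l → ℝ) =>
        (p.1, fun i : Finset.range k => p.2 ⟨i, Finset.range_subset_range.2 hkl i.2⟩)) ∘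
          history ξ₀ x l := rfl
    change MeasurableSpace.comap (history ξ₀ x k) inferInstance ≤
      MeasurableSpace.comap (history ξ₀ x l) inferInstance
    rw [h1, ← MeasurableSpace.comap_comp]
    refine MeasurableSpace.comap_mono (Measurable.comap_le ?_)
    exact measurable_fst.prodMk (measurable_pi_lambda _ fun i =>
      (measurable_pi_apply _).comp measurable_snd)
  le' k := (measurable_history hξ₀ hx k).comap_le

lemma indep_history {ξ₀ : Ω → ℝ} {x : ℕ → Ω → ℝ} (hξ₀ : Measurable ξ₀)
    (hx : ∀ k, Measurable (x k)) (hind : iIndepFun x P)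
    (hind₀ : IndepFun ξ₀ (fun ω n => x n ω) P) (k : ℕ) :
    IndepFun (history ξ₀ x k) (x k) P := by
  refine indepFun_prodMk_of_indepFun hξ₀ (measurable_pi_lambda _ fun i => hx i) (hx k) ?_ ?_
  · exact hind₀.comp measurable_id (ψ := fun y : ℕ → ℝ =>
      ((fun i : Finset.range k => y i), y k)) (by fun_prop)
  · have h1 := hind.indepFun_finset (Finset.range k) {k} (by simp) hx
    exact h1.comp measurable_id (ψ := fun y : ({k} : Finset ℕ) → ℝ => y ⟨k, by simp⟩)
      (measurable_pi_apply _)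

lemma mul_iterate_snd (α : ℝ) (γ : ℕ → ℝ) (ξ V₀ m : ℝ) (x : ℕ → ℝ) (n : ℕ) :
    n * ((iterate α γ ξ x n).2 - V₀) =
      ∑ k ∈ Finset.range n, recentred α m V₀ ((iterate α γ ξ x k).1 - m) (x k) := by
  induction n with
  | zero => simp
  | succ n ih =>
    rw [Finset.sum_range_succ, ← ih]
    simp only [iterate, recentred, H₂]
    have : (n : ℝ) + 1 ≠ 0 := by positivity
    push_cast
    field_simp
    ring_nf

/-- The error `ξ k - m` of the quantile recursion is an error process. -/
lemma isErrorProcess_iterate {X : Ω → ℝ} {f : ℝ → ℝ} (hf : IsContinuousPdf P X f)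
    (hX : Measurable X) {α : ℝ} (hα₁ : α < 1) {m : ℝ} (hm : cdfOf P X m = α)
    {ξ₀ : Ω → ℝ} {x : ℕ → Ω → ℝ} (hξ₀ : Measurable ξ₀) (hx : ∀ k, Measurable (x k))
    (hlaw : ∀ k, IdentDistrib (x k) X P P) (hind : iIndepFun x P)
    (hind₀ : IndepFun ξ₀ (fun ω n => x n ω) P) {c C L D γ₁ β : ℝ}
    (hfc : ∀ y, |y - m| ≤ 1 → c ≤ f y) (hC : ∀ y, |f y| ≤ C) (hL : 0 ≤ L)
    (hLip : ∀ y z, |f y - f z| ≤ L * |y - z|)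
    (hi₀ : Integrable (fun ω => (ξ₀ ω - m) ^ 2) P) (hD : ∫ ω, (ξ₀ ω - m) ^ 2 ∂P ≤ D) :
    IsErrorProcess P γ₁ β (1 + 1 / (1 - α)) (c / (1 - α))
      (L / (1 - α) + (1 / (1 - α)) ^ 2 * C) D (f m / (1 - α)) (historyFiltration hξ₀ hx) x
      (P.map X) (fun z y => H₁ α (m + z) y)
      (fun k ω => (iterate α (stepSize γ₁ β) (ξ₀ ω) (fun n => x n ω) k).1 - m) := by
  have h1α : 0 < 1 - α := by linarith
  have hC0 : 0 ≤ C := (abs_nonneg _).trans (hC 0)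
  have hh : ∀ k, Measurable[MeasurableSpace.comap (history ξ₀ x k) inferInstance]
      (history ξ₀ x k) := fun k => comap_measurable _
  refine ⟨fun k => ?_, fun k => (hlaw k).map_eq, fun k => ?_, ?_, ?_, fun k ω => ?_,
    fun z y => abs_H₁_le hα₁ _ _, fun z => ?_, fun z => ?_, fun z => ?_, ?_, ?_⟩
  · have h1 : x k = (fun p : ℝ × (Finset.range (k + 1) → ℝ) => p.2 ⟨k, by simp⟩) ∘
        history ξ₀ x (k + 1) := rfl
    have h2 : Measurable fun p : ℝ × (Finset.range (k + 1) → ℝ) => p.2 ⟨k, by simp⟩ :=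
      (measurable_pi_apply _).comp measurable_snd
    have h3 := h2.comp (hh (k + 1))
    rw [← h1] at h3
    exact h3
  · exact (IndepFun_iff_Indep _ _ _).1 (indep_history hξ₀ hx hind hind₀ k)
  · have h1 : ξ₀ = Prod.fst ∘ history ξ₀ x 0 := rfl
    have h3 := measurable_fst.comp (hh 0)
    rw [← h1] at h3
    exact h3.sub_const m
  · exact (measurable_H₁ α).comp ((measurable_fst.const_add m).prodMk measurable_snd)
  · simp only [iterate]
    rw [add_sub_cancel]; rw [sub_right_comm]
  · rw [hf.integral_H₁ hX hα₁, ← mul_div_assoc, div_mul_eq_mul_div]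
    refine div_le_div_of_nonneg_right ?_ h1α.le
    have := hf.mul_min_le_cdfOf hX hfc z
    rwa [hm] at this
  · rw [hf.integral_H₁ hX hα₁]
    have h1 := hf.abs_cdfOf_sub_sub_le hX hL hLip m z
    rw [hm] at h1
    calc |(cdfOf P X (m + z) - α) / (1 - α) - f m / (1 - α) * z|
        = |cdfOf P X (m + z) - α - f m * z| / (1 - α) := by
          rw [← abs_of_pos h1α, ← abs_div, abs_of_pos h1α]; congr 1; ring
      _ ≤ L * z ^ 2 / (1 - α) := by gcongr
      _ = L / (1 - α) * z ^ 2 := by ring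
      _ ≤ _ := by
        gcongr
        have : 0 ≤ (1 / (1 - α)) ^ 2 * C := by positivity
        linarith
  · refine (hf.integral_H₁_sub_sq_le hX hα₁ hC m z).trans ?_
    gcongr
    have : 0 ≤ L / (1 - α) := by positivity
    linarith
  · simpa [iterate] using hi₀
  · simpa [iterate] using hD

end Innovation

/-! ### Moments of the losses -/

section Moments

set_option linter.unusedSectionVars false

variable {Ω : Type*} [mΩ : MeasurableSpace Ω] {P : Measure Ω} [IsProbabilityMeasure P]
  {E F : Type*} [mE : MeasurableSpace E] [MeasurableSpace F] {φ : E × F → ℝ} {Y : Ω → E}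
  {Z : Ω → F} {Zs : ℕ → Ω → F}

lemma measurable_loss (hS : IsSampling P Y Z Zs) (hφ : Measurable φ) (i : Option ℕ+) :
    Measurable (loss P φ Y Z Zs i) := by
  cases i with
  | none =>
    exact (stronglyMeasurable_condExp.measurable).mono hS.measurable_Y.comap_le le_rfl
  | some K =>
    exact (Finset.measurable_fun_sum _ fun k _ =>
      hφ.comp (hS.measurable_Y.prodMk (hS.measurable_Zs k))).const_mul _

lemma identDistrib_sample (hS : IsSampling P Y Z Zs) (k : ℕ) :
    IdentDistrib (fun ω => (Y ω, Zs k ω)) (fun ω => (Y ω, Z ω)) P P := by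
  have : IsProbabilityMeasure (P.map Y) :=
    Measure.isProbabilityMeasure_map hS.measurable_Y.aemeasurable
  refine ⟨(hS.measurable_Y.prodMk (hS.measurable_Zs k)).aemeasurable,
    (hS.measurable_Y.prodMk hS.measurable_Z).aemeasurable, ?_⟩
  have h1 : IndepFun Y (Zs k) P := hS.indep_Y_Zs.comp measurable_id (measurable_pi_apply k)
  rw [(indepFun_iff_map_prod_eq_prod_map_map hS.measurable_Y.aemeasurable
    (hS.measurable_Zs k).aemeasurable).1 h1, (indepFun_iff_map_prod_eq_prod_map_map
    hS.measurable_Y.aemeasurable hS.measurable_Z.aemeasurable).1 hS.indep_YZ,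
    (hS.identDistrib_Zs k).map_eq]

/-- By Jensen's inequality the moments of all losses are bounded by those of `φ(Y, Z)`. -/
lemma loss_moment (hS : IsSampling P Y Z Zs) (hφ : Measurable φ) {p : ℝ} (hp : 1 ≤ p)
    (hmom : Integrable (fun ω => |φ (Y ω, Z ω)| ^ p) P) (i : Option ℕ+) :
    Integrable (fun ω => |loss P φ Y Z Zs i ω| ^ p) P ∧
      ∫ ω, |loss P φ Y Z Zs i ω| ^ p ∂P ≤ ∫ ω, |φ (Y ω, Z ω)| ^ p ∂P := by
  have hp0 : 0 < p := by linarith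
  cases i with
  | none =>
    have hφm : Measurable fun ω => φ (Y ω, Z ω) := hφ.comp (hS.measurable_Y.prodMk hS.measurable_Z)
    have hp1 : ENNReal.ofReal p ≠ 0 := by simpa using hp0
    have hpt : (ENNReal.ofReal p).toReal = p := ENNReal.toReal_ofReal hp0.le
    have hp2 : (1 : ENNReal) ≤ ENNReal.ofReal p := by simpa using hp
    have h1 : MemLp (fun ω => φ (Y ω, Z ω)) (ENNReal.ofReal p) P := by
      refine (integrable_norm_rpow_iff hφm.aestronglyMeasurable hp1 ENNReal.ofReal_ne_top).1 ?_
      simpa [hpt] using hmom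
    have h2 : MemLp (loss P φ Y Z Zs none) (ENNReal.ofReal p) P := h1.condExp hp2
    have h3 : eLpNorm (loss P φ Y Z Zs none) (ENNReal.ofReal p) P ≤ _ :=
      eLpNorm_condExp_le_eLpNorm (fun ω => φ (Y ω, Z ω)) hp2
    have h4 := (integrable_norm_rpow_iff h2.1 hp1 ENNReal.ofReal_ne_top).2 h2
    simp only [hpt, Real.norm_eq_abs] at h4
    refine ⟨h4, ?_⟩
    rw [h1.eLpNorm_eq_integral_rpow_norm hp1 ENNReal.ofReal_ne_top,
      h2.eLpNorm_eq_integral_rpow_norm hp1 ENNReal.ofReal_ne_top] at h3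
    simp only [hpt, Real.norm_eq_abs] at h3
    have h5 : 0 ≤ ∫ ω, |φ (Y ω, Z ω)| ^ p ∂P := integral_nonneg fun ω => by positivity
    have h6 : 0 ≤ ∫ ω, |loss P φ Y Z Zs none ω| ^ p ∂P := integral_nonneg fun ω => by positivity
    rw [ENNReal.ofReal_le_ofReal_iff (by positivity)] at h3
    exact (Real.rpow_le_rpow_iff h6 h5 (inv_pos.2 hp0)).1 h3
  | some K =>
    have hK : (0 : ℝ) < K := by exact_mod_cast K.pos
    have hm : Measurable fun z : E × F => |φ z| ^ p := by fun_prop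
    have h1 : ∀ k, IdentDistrib (fun ω => |φ (Y ω, Zs k ω)| ^ p) (fun ω => |φ (Y ω, Z ω)| ^ p) P P :=
      fun k => (identDistrib_sample hS k).comp hm
    have h2 : ∀ k, Integrable (fun ω => |φ (Y ω, Zs k ω)| ^ p) P := fun k =>
      (h1 k).integrable_iff.2 hmom
    have h3 : Integrable (fun ω => ∑ k ∈ Finset.range K, 1 / (K : ℝ) * |φ (Y ω, Zs k ω)| ^ p) P :=
      integrable_finsetSum _ fun k _ => (h2 k).const_mul _
    have h4 : ∀ ω, |loss P φ Y Z Zs (some K) ω| ^ p ≤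
        ∑ k ∈ Finset.range K, 1 / (K : ℝ) * |φ (Y ω, Zs k ω)| ^ p := fun ω => by
      refine le_trans ?_ (Real.rpow_arith_mean_le_arith_mean_rpow (Finset.range K)
        (fun _ => 1 / (K : ℝ)) (fun k => |φ (Y ω, Zs k ω)|) (fun _ _ => by positivity)
        (by simp [hK.ne']) (fun _ _ => abs_nonneg _) hp)
      refine Real.rpow_le_rpow (abs_nonneg _) ?_ hp0.le
      simp only [loss]
      rw [abs_mul, abs_of_pos (by positivity : (0 : ℝ) < 1 / K), ← Finset.mul_sum]
      exact mul_le_mul_of_nonneg_left (Finset.abs_sum_le_sum_abs _ _) (by positivity)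
    have hmX := measurable_loss hS hφ (some K)
    refine ⟨h3.mono' (hmX.abs.pow_const p).aestronglyMeasurable (ae_of_all _ fun ω => ?_), ?_⟩
    · rw [Real.norm_of_nonneg (by positivity)]; exact h4 ω
    refine (integral_mono_of_nonneg (ae_of_all _ fun ω => by positivity) h3 (ae_of_all _ h4)).trans
      (le_of_eq ?_)
    rw [integral_finsetSum _ fun k _ => (h2 k).const_mul _]
    simp_rw [integral_const_mul, (h1 _).integral_eq]
    simp [hK.ne']

end Moments

/-! ### Convergence of the laws -/

section Convergence

set_option linter.unusedSectionVars false

variable {Ω : Type*} [mΩ : MeasurableSpace Ω] {P : Measure Ω} [IsProbabilityMeasure P]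

lemma one_add_sq_le {δ : ℝ} (hδ : 0 < δ) {R x : ℝ} (hR : 1 ≤ R) (hx : R ≤ |x|) :
    1 + x ^ 2 ≤ 2 * R ^ (-δ) * |x| ^ (2 + δ) := by
  have hx0 : 0 < |x| := by linarith
  have hR0 : 0 < R := by linarith
  rw [Real.rpow_add hx0, Real.rpow_two, sq_abs, Real.rpow_neg hR0.le]
  have h1 : R ^ δ ≤ |x| ^ δ := Real.rpow_le_rpow hR0.le hx hδ.le
  have h2 : 0 < R ^ δ := by positivity
  have h3 : 1 ≤ x ^ 2 := by rw [← sq_abs]; nlinarith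
  have h4 : 1 ≤ (R ^ δ)⁻¹ * |x| ^ δ := by rw [inv_mul_eq_div, one_le_div h2]; exact h1
  nlinarith

lemma IsContinuousPdf.integrable_mul {X : Ω → ℝ} {f : ℝ → ℝ} (hf : IsContinuousPdf P X f)
    (hX : Measurable X) (hi : Integrable (fun ω => X ω ^ 2) P) {g : ℝ → ℝ} (hg : Measurable g)
    {C : ℝ} (hgC : ∀ x, |g x| ≤ C * (1 + x ^ 2)) : Integrable fun x => f x * g x := by
  refine (hf.integrable_comp_iff hX hg).1 ?_
  refine (((integrable_const 1).add hi).const_mul C).mono' (hg.comp hX).aestronglyMeasurable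
    (ae_of_all _ fun ω => hgC _)

lemma IsContinuousPdf.abs_integral_sub_setIntegral_le {X : Ω → ℝ} {f : ℝ → ℝ}
    (hf : IsContinuousPdf P X f) (hX : Measurable X) {δ : ℝ} (hδ : 0 < δ)
    (hi : Integrable (fun ω => |X ω| ^ (2 + δ)) P) {M : ℝ} (hM : ∫ ω, |X ω| ^ (2 + δ) ∂P ≤ M)
    {g : ℝ → ℝ} (hg : Measurable g) {C : ℝ} (hgC : ∀ x, |g x| ≤ C * (1 + x ^ 2)) {R : ℝ}
    (hR : 1 ≤ R) :
    |(∫ x, f x * g x) - ∫ x in Set.Icc (-R) R, f x * g x| ≤ 2 * C * M * R ^ (-δ) := by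
  have hC : 0 ≤ C := by simpa using (abs_nonneg _).trans (hgC 0)
  have hm : Measurable fun x : ℝ => |x| ^ (2 + δ) := by fun_prop
  have hgi := hf.integrable_mul hX (integrable_sq_of_integrable_rpow hX hδ hi) hg hgC
  have h1 : Integrable fun x => f x * |x| ^ (2 + δ) := (hf.integrable_comp_iff hX hm).1 hi
  have h2 : (∫ x, f x * g x) - ∫ x in Set.Icc (-R) R, f x * g x =
      ∫ x, (Set.Icc (-R) R)ᶜ.indicator (fun x => f x * g x) x := by
    rw [integral_indicator measurableSet_Icc.compl, ← integral_add_compl measurableSet_Icc hgi]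
    ring
  rw [h2, ← Real.norm_eq_abs]
  refine (norm_integral_le_of_norm_le (h1.const_mul (2 * C * R ^ (-δ)))
    (ae_of_all _ fun x => ?_)).trans ?_
  · by_cases hx : x ∈ Set.Icc (-R) R
    · rw [Set.indicator_of_notMem (by simpa using hx), norm_zero]
      have := hf.nonneg x
      positivity
    · rw [Set.indicator_of_mem hx, Real.norm_eq_abs, abs_mul, abs_of_nonneg (hf.nonneg x)]
      have hx' : R ≤ |x| := by
        by_contra h
        exact hx ⟨by linarith [neg_abs_le x], by linarith [le_abs_self x]⟩
      have h3 := one_add_sq_le hδ hR hx'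
      calc f x * |g x| ≤ f x * (C * (2 * R ^ (-δ) * |x| ^ (2 + δ))) := by
            have := hf.nonneg x
            gcongr
            exact (hgC x).trans (by gcongr)
        _ = _ := by ring
  · rw [integral_const_mul, ← hf.integral_comp hX hm]
    calc 2 * C * R ^ (-δ) * ∫ ω, |X ω| ^ (2 + δ) ∂P ≤ 2 * C * R ^ (-δ) * M := by gcongr
      _ = _ := by ring

/-- Pointwise convergence of uniformly bounded densities and a bound on a moment of order `2 + δ`
make the expectations of functions of at most quadratic growth converge. -/
lemma tendsto_integral_comp {ι : Type*} {l : Filter ι} [l.IsCountablyGenerated]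
    {X : ι → Ω → ℝ} {f : ι → ℝ → ℝ} {X₀ : Ω → ℝ} {f₀ : ℝ → ℝ}
    (hf : ∀ i, IsContinuousPdf P (X i) (f i)) (hf₀ : IsContinuousPdf P X₀ f₀)
    (hX : ∀ i, Measurable (X i)) (hX₀ : Measurable X₀) {B : ℝ} (hB : ∀ i x, |f i x| ≤ B)
    (hlim : ∀ x, Tendsto (fun i => f i x) l (𝓝 (f₀ x))) {δ : ℝ} (hδ : 0 < δ)
    (hi : ∀ i, Integrable (fun ω => |X i ω| ^ (2 + δ)) P)
    (hi₀ : Integrable (fun ω => |X₀ ω| ^ (2 + δ)) P) {M : ℝ}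
    (hM : ∀ i, ∫ ω, |X i ω| ^ (2 + δ) ∂P ≤ M) (hM₀ : ∫ ω, |X₀ ω| ^ (2 + δ) ∂P ≤ M)
    {g : ι → ℝ → ℝ} {g₀ : ℝ → ℝ} (hg : ∀ i, Measurable (g i)) (hg₀ : Measurable g₀) {C : ℝ}
    (hgC : ∀ᶠ i in l, ∀ x, |g i x| ≤ C * (1 + x ^ 2)) (hgC₀ : ∀ x, |g₀ x| ≤ C * (1 + x ^ 2))
    (hglim : ∀ᵐ x, Tendsto (fun i => g i x) l (𝓝 (g₀ x))) :
    Tendsto (fun i => ∫ ω, g i (X i ω) ∂P) l (𝓝 (∫ ω, g₀ (X₀ ω) ∂P)) := by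
  simp_rw [(hf _).integral_comp (hX _) (hg _), hf₀.integral_comp hX₀ hg₀]
  have hC : 0 ≤ C := by simpa using (abs_nonneg _).trans (hgC₀ 0)
  rw [Metric.tendsto_nhds]
  intro ε hε
  have h1 : Tendsto (fun R : ℝ => 2 * C * M * R ^ (-δ)) atTop (𝓝 0) := by
    simpa using (tendsto_rpow_neg_atTop hδ).const_mul (2 * C * M)
  obtain ⟨R, hR1, hR⟩ := ((eventually_ge_atTop (1 : ℝ)).and
    (h1.eventually (gt_mem_nhds (show (0 : ℝ) < ε / 3 by positivity)))).exists
  have h2 : Tendsto (fun i => ∫ x in Set.Icc (-R) R, f i x * g i x) l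
      (𝓝 (∫ x in Set.Icc (-R) R, f₀ x * g₀ x)) := by
    refine tendsto_integral_filter_of_dominated_convergence (fun _ => B * (C * (1 + R ^ 2)))
      (Eventually.of_forall fun i => ((hf i).continuous.measurable.mul (hg i)).aestronglyMeasurable)
      ?_ ?_ ?_
    · filter_upwards [hgC] with i hgi
      refine (ae_restrict_iff' measurableSet_Icc).2 (ae_of_all _ fun x hx => ?_)
      rw [norm_mul]
      have hx2 : x ^ 2 ≤ R ^ 2 := sq_le_sq' hx.1 hx.2
      have hB0 : 0 ≤ B := (abs_nonneg _).trans (hB i 0)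
      exact mul_le_mul (hB i x) ((hgi x).trans (by gcongr)) (norm_nonneg _) hB0
    · exact integrable_const _
    · refine ae_restrict_of_ae ?_
      filter_upwards [hglim] with x hx
      exact (hlim x).mul hx
  filter_upwards [hgC, Metric.tendsto_nhds.1 h2 (ε / 3) (by positivity)] with i hgi h3
  have h4 := (hf i).abs_integral_sub_setIntegral_le (hX i) hδ (hi i) (hM i) (hg i) hgi hR1
  have h5 := hf₀.abs_integral_sub_setIntegral_le hX₀ hδ hi₀ hM₀ hg₀ hgC₀ hR1
  rw [Real.dist_eq] at h3 ⊢
  rw [abs_le] at h4 h5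
  rw [abs_lt] at h3 ⊢
  constructor <;> linarith

end Convergence

section ConvergingLaws

variable {Ω : Type*} [mΩ : MeasurableSpace Ω] {P : Measure Ω} [IsProbabilityMeasure P]
  {ι : Type*} {l : Filter ι}

/-- The random variables `X i` have bounded Lipschitz densities that converge pointwise to the
positive density `f₀` of `X₀`, with a common bound on the moment of order `2 + δ`; `m i` and `m₀`
are their quantiles of level `α`. -/
structure ConvergingLaws (P : Measure Ω) (α δ B L M : ℝ) (l : Filter ι) (X : ι → Ω → ℝ)
    (f : ι → ℝ → ℝ) (m : ι → ℝ) (X₀ : Ω → ℝ) (f₀ : ℝ → ℝ) (m₀ : ℝ) : Prop where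
  pdf : ∀ i, IsContinuousPdf P (X i) (f i)
  pdf₀ : IsContinuousPdf P X₀ f₀
  measurable : ∀ i, Measurable (X i)
  measurable₀ : Measurable X₀
  abs_pdf_le : ∀ i x, |f i x| ≤ B
  lipschitz : ∀ i x y, |f i x - f i y| ≤ L * |x - y|
  tendsto_pdf : ∀ x, Tendsto (fun i => f i x) l (𝓝 (f₀ x))
  pos₀ : ∀ x, 0 < f₀ x
  integrable : ∀ i, Integrable (fun ω => |X i ω| ^ (2 + δ)) P
  integrable₀ : Integrable (fun ω => |X₀ ω| ^ (2 + δ)) P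
  moment_le : ∀ i, ∫ ω, |X i ω| ^ (2 + δ) ∂P ≤ M
  moment_le₀ : ∫ ω, |X₀ ω| ^ (2 + δ) ∂P ≤ M
  cdfOf_eq : ∀ i, cdfOf P (X i) (m i) = α
  cdfOf_eq₀ : cdfOf P X₀ m₀ = α

/-- A bound on the recentred increment, relative to `1 + |x|`. -/
noncomputable def recentredBound (α m V₀ : ℝ) : ℝ := |m - V₀| + 1 / (1 - α) * (1 + |m|)

lemma abs_recentred_zero_le {α : ℝ} (hα₁ : α < 1) (m V₀ x : ℝ) :
    |recentred α m V₀ 0 x| ≤ recentredBound α m V₀ * (1 + |x|) := by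
  have h1 : 0 < 1 / (1 - α) := by
    have : 0 < 1 - α := by linarith
    positivity
  have h2 : recentred α m V₀ 0 x = (m - V₀) + 1 / (1 - α) * max (x - m) 0 := by
    unfold recentred H₂; rw [add_zero]; ring
  have h3 : max (x - m) 0 ≤ |x| + |m| :=
    max_le (by linarith [le_abs_self x, neg_abs_le m]) (by positivity)
  have h4 : |recentred α m V₀ 0 x| ≤ |m - V₀| + 1 / (1 - α) * max (x - m) 0 := by
    rw [h2]
    refine (abs_add_le _ _).trans (le_of_eq ?_)
    rw [abs_of_nonneg (a := 1 / (1 - α) * max (x - m) 0)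
      (mul_nonneg h1.le (le_max_right _ _))]
  have h5 := mul_le_mul_of_nonneg_left h3 h1.le
  have h6 : 0 ≤ 1 / (1 - α) * (|m| * |x|) := by positivity
  have h7 : 0 ≤ |m - V₀| * |x| := by positivity
  unfold recentredBound
  nlinarith [abs_nonneg x, abs_nonneg m]

lemma H₁_eventually_eq (α : ℝ) {m : ι → ℝ} {m₀ : ℝ} (hm : Tendsto m l (𝓝 m₀)) {x : ℝ} (hx : x ≠ m₀) :
    ∀ᶠ i in l, H₁ α (m i) x = H₁ α m₀ x := by
  rcases lt_or_gt_of_ne hx with h | h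
  · filter_upwards [hm.eventually (lt_mem_nhds h)] with i hi
    simp [H₁, not_le.2 h, not_le.2 hi]
  · filter_upwards [hm.eventually (gt_mem_nhds h)] with i hi
    simp [H₁, h.le, hi.le]

namespace ConvergingLaws

variable {α δ B L M : ℝ} {X : ι → Ω → ℝ} {f : ι → ℝ → ℝ} {m : ι → ℝ} {X₀ : Ω → ℝ}
  {f₀ : ℝ → ℝ} {m₀ : ℝ}

lemma tendsto_integral [l.IsCountablyGenerated]
    (h : ConvergingLaws P α δ B L M l X f m X₀ f₀ m₀) (hδ : 0 < δ)
    {g : ι → ℝ → ℝ} {g₀ : ℝ → ℝ} (hg : ∀ i, Measurable (g i)) (hg₀ : Measurable g₀) {C : ℝ}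
    (hgC : ∀ᶠ i in l, ∀ x, |g i x| ≤ C * (1 + x ^ 2)) (hgC₀ : ∀ x, |g₀ x| ≤ C * (1 + x ^ 2))
    (hglim : ∀ x, x ≠ m₀ → Tendsto (fun i => g i x) l (𝓝 (g₀ x))) :
    Tendsto (fun i => ∫ ω, g i (X i ω) ∂P) l (𝓝 (∫ ω, g₀ (X₀ ω) ∂P)) := by
  refine tendsto_integral_comp h.pdf h.pdf₀ h.measurable h.measurable₀ h.abs_pdf_le h.tendsto_pdf hδ
    h.integrable h.integrable₀ h.moment_le h.moment_le₀ hg hg₀ hgC hgC₀ ?_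
  filter_upwards [measure_eq_zero_iff_ae_notMem.1 (measure_singleton (μ := volume) m₀)] with x hx
  exact hglim x hx

lemma integrable_X (h : ConvergingLaws P α δ B L M l X f m X₀ f₀ m₀) (hδ : 0 < δ) (i : ι) :
    Integrable (X i) P :=
  integrable_of_integrable_sq (h.measurable i).aestronglyMeasurable
    (integrable_sq_of_integrable_rpow (h.measurable i) hδ (h.integrable i))

lemma integrable_X₀ (h : ConvergingLaws P α δ B L M l X f m X₀ f₀ m₀) (hδ : 0 < δ) :
    Integrable X₀ P :=
  integrable_of_integrable_sq h.measurable₀.aestronglyMeasurable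
    (integrable_sq_of_integrable_rpow h.measurable₀ hδ h.integrable₀)

lemma tendsto_cdfOf [l.IsCountablyGenerated]
    (h : ConvergingLaws P α δ B L M l X f m X₀ f₀ m₀) (hδ : 0 < δ) (x : ℝ) :
    Tendsto (fun i => cdfOf P (X i) x) l (𝓝 (cdfOf P X₀ x)) := by
  have hm : Measurable ((Set.Iic x).indicator fun _ => (1 : ℝ)) :=
    measurable_const.indicator measurableSet_Iic
  have hb : ∀ y, |(Set.Iic x).indicator (fun _ => (1 : ℝ)) y| ≤ 1 * (1 + y ^ 2) := fun y => by
    by_cases hy : y ∈ Set.Iic x <;> simp [hy] <;> positivity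
  have h1 := h.tendsto_integral hδ (g := fun _ => (Set.Iic x).indicator fun _ => (1 : ℝ))
    (fun _ => hm) hm (Eventually.of_forall fun _ => hb) hb fun _ _ => tendsto_const_nhds
  have h2 : ∀ W : Ω → ℝ, Measurable W →
      ∫ ω, (Set.Iic x).indicator (fun _ => (1 : ℝ)) (W ω) ∂P = cdfOf P W x := fun W hW => by
    rw [show (fun ω => (Set.Iic x).indicator (fun _ => (1 : ℝ)) (W ω)) =
      {ω | W ω ≤ x}.indicator 1 from rfl, integral_indicator_one (measurableSet_le hW
        measurable_const), cdfOf]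
  simpa only [h2 _ (h.measurable _), h2 _ h.measurable₀] using h1

/-- The quantiles converge since the limiting distribution function is strictly increasing. -/
lemma tendsto_quantile [l.IsCountablyGenerated]
    (h : ConvergingLaws P α δ B L M l X f m X₀ f₀ m₀) (hδ : 0 < δ) : Tendsto m l (𝓝 m₀) := by
  have hs := h.pdf₀.strictMono_cdfOf h.measurable₀ h.pos₀
  have hmono : ∀ i {x y : ℝ}, cdfOf P (X i) x < cdfOf P (X i) y → x < y := fun i x y hxy => by
    by_contra hle
    exact absurd hxy (not_lt.2 (measureReal_mono fun ω (hω : X i ω ≤ y) =>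
      show X i ω ≤ x from hω.trans (not_lt.1 hle)))
  refine tendsto_order.2 ⟨fun a ha => ?_, fun a ha => ?_⟩
  · have h1 := hs ha
    rw [h.cdfOf_eq₀] at h1
    filter_upwards [(h.tendsto_cdfOf hδ a).eventually (gt_mem_nhds h1)] with i hi
    rw [← h.cdfOf_eq i] at hi
    exact hmono i hi
  · have h1 := hs ha
    rw [h.cdfOf_eq₀] at h1
    filter_upwards [(h.tendsto_cdfOf hδ a).eventually (lt_mem_nhds h1)] with i hi
    rw [← h.cdfOf_eq i] at hi
    exact hmono i hi

lemma tendsto_pdf_quantile [l.IsCountablyGenerated]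
    (h : ConvergingLaws P α δ B L M l X f m X₀ f₀ m₀) (hδ : 0 < δ) :
    Tendsto (fun i => f i (m i)) l (𝓝 (f₀ m₀)) := by
  have h1 : Tendsto (fun i => L * |m i - m₀|) l (𝓝 0) := by
    simpa using (((h.tendsto_quantile hδ).sub_const m₀).abs).const_mul L
  have h2 := (squeeze_zero_norm (fun i => h.lipschitz i (m i) m₀) h1).add (h.tendsto_pdf m₀)
  simpa using h2

lemma tendsto_V [l.IsCountablyGenerated]
    (h : ConvergingLaws P α δ B L M l X f m X₀ f₀ m₀) (hδ : 0 < δ) :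
    Tendsto (fun i => V P α (X i) (m i)) l (𝓝 (V P α X₀ m₀)) := by
  have hm := h.tendsto_quantile hδ
  have hb : ∀ {y : ℝ}, |y| ≤ |m₀| + 1 → ∀ x, |max (x - y) 0| ≤ (|m₀| + 2) * (1 + x ^ 2) := by
    intro y hy x
    rw [abs_of_nonneg (le_max_right _ _)]
    refine max_le ?_ (by positivity)
    nlinarith [neg_abs_le y, sq_nonneg (x - 1), abs_nonneg m₀, sq_nonneg x,
      mul_nonneg (abs_nonneg m₀) (sq_nonneg x)]
  refine hm.add ((h.tendsto_integral hδ (g := fun i x => max (x - m i) 0)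
    (g₀ := fun x => max (x - m₀) 0) (fun i => by fun_prop) (by fun_prop) ?_
    (hb (by linarith)) fun x _ => ?_).const_mul _)
  · filter_upwards [hm.abs.eventually (ge_mem_nhds (lt_add_one |m₀|))] with i hi
    exact hb hi
  · exact (hm.const_sub x).max tendsto_const_nhds

lemma exists_recentred_le [l.IsCountablyGenerated]
    (h : ConvergingLaws P α δ B L M l X f m X₀ f₀ m₀) (hδ : 0 < δ) (hα₁ : α < 1) :
    ∃ A, 0 ≤ A ∧ (∀ᶠ i in l, ∀ x, |recentred α (m i) (V P α (X i) (m i)) 0 x| ≤ A * (1 + |x|)) ∧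
      ∀ x, |recentred α m₀ (V P α X₀ m₀) 0 x| ≤ A * (1 + |x|) := by
  have h1 : Tendsto (fun i => recentredBound α (m i) (V P α (X i) (m i))) l
      (𝓝 (recentredBound α m₀ (V P α X₀ m₀))) :=
    ((h.tendsto_quantile hδ).sub (h.tendsto_V hδ)).abs.add
      (((h.tendsto_quantile hδ).abs.const_add 1).const_mul _)
  have h0 : 0 ≤ recentredBound α m₀ (V P α X₀ m₀) := by
    have : 0 < 1 - α := by linarith
    unfold recentredBound; positivity
  refine ⟨recentredBound α m₀ (V P α X₀ m₀) + 1, by linarith, ?_, fun x => ?_⟩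
  · filter_upwards [h1.eventually (ge_mem_nhds (lt_add_one _))] with i hi x
    exact (abs_recentred_zero_le hα₁ _ _ x).trans (by gcongr)
  · exact (abs_recentred_zero_le hα₁ _ _ x).trans (by gcongr; linarith)

lemma tendsto_recentred [l.IsCountablyGenerated]
    (h : ConvergingLaws P α δ B L M l X f m X₀ f₀ m₀) (hδ : 0 < δ) (x : ℝ) :
    Tendsto (fun i => recentred α (m i) (V P α (X i) (m i)) 0 x) l
      (𝓝 (recentred α m₀ (V P α X₀ m₀) 0 x)) := by
  unfold recentred H₂
  have hm := (h.tendsto_quantile hδ).add_const 0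
  exact ((h.tendsto_V hδ).sub (hm.add (((hm.const_sub x).max tendsto_const_nhds).const_mul _))).neg

lemma integral_recentred_zero (h : ConvergingLaws P α δ B L M l X f m X₀ f₀ m₀) (hδ : 0 < δ)
    (i : ι) : ∫ ω, recentred α (m i) (V P α (X i) (m i)) 0 (X i ω) ∂P = 0 := by
  have h1 := (IsContinuousPdf.integral_recentred (h.measurable i) (h.integrable_X hδ i) α (m i)
    (V P α (X i) (m i)) 0).2
  rw [integral_map (h.measurable i).aemeasurable
    (measurable_recentred_right _ _ _ _).aestronglyMeasurable] at h1
  rw [h1, add_zero, sub_self]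

/-- The limit of the covariances of the two increments at the quantiles. -/
lemma tendsto_integral_H₁_mul [l.IsCountablyGenerated]
    (h : ConvergingLaws P α δ B L M l X f m X₀ f₀ m₀) (hδ : 0 < δ) (hα₁ : α < 1) :
    Tendsto (fun i => ∫ ω, H₁ α (m i) (X i ω) *
      recentred α (m i) (V P α (X i) (m i)) 0 (X i ω) ∂P) l
      (𝓝 (-(α / (1 - α)) * (V P α X₀ m₀ - m₀))) := by
  have h1α : 0 < 1 - α := by linarith
  obtain ⟨A, hA, hA1, hA2⟩ := h.exists_recentred_le hδ hα₁
  have hb : ∀ {r u x : ℝ}, |u| ≤ 1 + 1 / (1 - α) → |r| ≤ A * (1 + |x|) →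
      |u * r| ≤ 2 * (1 + 1 / (1 - α)) * A * (1 + x ^ 2) := by
    intro r u x hu hr
    have h2 : 1 + |x| ≤ 2 * (1 + x ^ 2) := by
      rw [← sq_abs x]; nlinarith [sq_nonneg (|x| - 1), sq_nonneg |x|]
    rw [abs_mul]
    calc |u| * |r| ≤ (1 + 1 / (1 - α)) * (A * (2 * (1 + x ^ 2))) :=
          mul_le_mul hu (hr.trans (by gcongr)) (abs_nonneg _) (by positivity)
      _ = _ := by ring
  have h1 := h.tendsto_integral hδ
    (g := fun i x => H₁ α (m i) x * recentred α (m i) (V P α (X i) (m i)) 0 x)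
    (g₀ := fun x => H₁ α m₀ x * recentred α m₀ (V P α X₀ m₀) 0 x)
    (fun i => (measurable_H₁_right _ _).mul (measurable_recentred_right _ _ _ _))
    ((measurable_H₁_right _ _).mul (measurable_recentred_right _ _ _ _))
    (by filter_upwards [hA1] with i hi x using hb (abs_H₁_le hα₁ _ _) (hi x))
    (fun x => hb (abs_H₁_le hα₁ _ _) (hA2 x)) fun x hx =>
      (tendsto_const_nhds.congr' ((H₁_eventually_eq α (h.tendsto_quantile hδ) hx).mono
        fun _ hi => hi.symm)).mul (h.tendsto_recentred hδ x)
  convert h1 using 2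
  -- the product of the increments is again affine in the indicator and the positive part
  obtain ⟨h2, h3⟩ := h.pdf₀.integral_ite_le h.measurable₀ m₀
  have h4 : ∀ x, H₁ α m₀ x * recentred α m₀ (V P α X₀ m₀) 0 x =
      (m₀ - V P α X₀ m₀) - (m₀ - V P α X₀ m₀) / (1 - α) * (by
        classical exact if m₀ ≤ x then (1 : ℝ) else 0) -
        α / (1 - α) * (1 / (1 - α) * max (x - m₀) 0) := by
    intro x
    unfold H₁ recentred H₂
    rw [add_zero]
    split_ifs with hx
    · field_simp; ring
    · rw [max_eq_right (by linarith)]; ring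
  have h5 := (IsContinuousPdf.integrable_max (h.integrable_X₀ hδ) m₀).const_mul (1 / (1 - α))
  have h6 : 1 / (1 - α) * ∫ ω, max (X₀ ω - m₀) 0 ∂P = V P α X₀ m₀ - m₀ := by
    unfold V; ring
  have h7 := (integrable_const (μ := P) (m₀ - V P α X₀ m₀)).sub
    (h2.const_mul ((m₀ - V P α X₀ m₀) / (1 - α)))
  simp only [Pi.sub_def] at h7
  simp_rw [h4]
  rw [integral_sub h7 (h5.const_mul _),
    integral_sub (integrable_const _) (h2.const_mul _), integral_const_mul, integral_const_mul,
    integral_const_mul, h6, h3, h.cdfOf_eq₀]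
  simp
  field_simp
  ring

/-- The limit of the variances of the recentred increment. -/
lemma tendsto_integral_recentred_sq [l.IsCountablyGenerated]
    (h : ConvergingLaws P α δ B L M l X f m X₀ f₀ m₀) (hδ : 0 < δ) (hα₁ : α < 1) :
    Tendsto (fun i => ∫ ω, recentred α (m i) (V P α (X i) (m i)) 0 (X i ω) ^ 2 ∂P) l
      (𝓝 (Var[fun ω => max (X₀ ω - m₀) 0; P] / (1 - α) ^ 2)) := by
  have h1α : 0 < 1 - α := by linarith
  obtain ⟨A, hA, hA1, hA2⟩ := h.exists_recentred_le hδ hα₁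
  have hb : ∀ {r x : ℝ}, |r| ≤ A * (1 + |x|) → |r ^ 2| ≤ 2 * A ^ 2 * (1 + x ^ 2) := by
    intro r x hr
    rw [abs_of_nonneg (sq_nonneg r), ← sq_abs r, ← sq_abs x]
    calc |r| ^ 2 ≤ (A * (1 + |x|)) ^ 2 := by gcongr
      _ = A ^ 2 * (1 + |x|) ^ 2 := by ring
      _ ≤ A ^ 2 * (2 * (1 + |x| ^ 2)) := by gcongr; nlinarith [sq_nonneg (|x| - 1)]
      _ = _ := by ring
  have h1 := h.tendsto_integral hδ
    (g := fun i x => recentred α (m i) (V P α (X i) (m i)) 0 x ^ 2)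
    (g₀ := fun x => recentred α m₀ (V P α X₀ m₀) 0 x ^ 2)
    (fun i => (measurable_recentred_right _ _ _ _).pow_const 2)
    ((measurable_recentred_right _ _ _ _).pow_const 2)
    (by filter_upwards [hA1] with i hi x using hb (hi x))
    (fun x => hb (hA2 x)) fun x hx => (h.tendsto_recentred hδ x).pow 2
  convert h1 using 2
  rw [variance_eq_integral (by have := h.measurable₀; fun_prop), ← integral_div]
  refine integral_congr_ae (ae_of_all _ fun ω => ?_)
  have h6 : 1 / (1 - α) * ∫ ω, max (X₀ ω - m₀) 0 ∂P = V P α X₀ m₀ - m₀ := by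
    unfold V; ring
  simp only [recentred, H₂, add_zero]
  rw [show V P α X₀ m₀ = m₀ + 1 / (1 - α) * ∫ ω, max (X₀ ω - m₀) 0 ∂P from rfl]
  field_simp
  ring

lemma integral_recentred_rpow_le (h : ConvergingLaws P α δ B L M l X f m X₀ f₀ m₀) (hδ : 0 < δ)
    {A : ℝ} (hA : 0 ≤ A) {i : ι}
    (hi : ∀ x, |recentred α (m i) (V P α (X i) (m i)) 0 x| ≤ A * (1 + |x|)) :
    Integrable (fun ω => |recentred α (m i) (V P α (X i) (m i)) 0 (X i ω)| ^ (2 + δ)) P ∧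
      ∫ ω, |recentred α (m i) (V P α (X i) (m i)) 0 (X i ω)| ^ (2 + δ) ∂P ≤
        (2 * A) ^ (2 + δ) * (1 + M) := by
  have hp : 0 < 2 + δ := by linarith
  have h1 : ∀ ω, |recentred α (m i) (V P α (X i) (m i)) 0 (X i ω)| ^ (2 + δ) ≤
      (2 * A) ^ (2 + δ) * (1 + |X i ω| ^ (2 + δ)) := fun ω => by
    have h2 : A * (1 + |X i ω|) ≤ 2 * A * max 1 |X i ω| := by
      nlinarith [le_max_left 1 |X i ω|, le_max_right 1 |X i ω|]
    refine (Real.rpow_le_rpow (abs_nonneg _) ((hi _).trans h2) hp.le).trans ?_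
    rw [Real.mul_rpow (by positivity) (by positivity)]
    gcongr
    rcases le_total 1 |X i ω| with h3 | h3
    · rw [max_eq_right h3]; linarith
    · rw [max_eq_left h3, Real.one_rpow]
      have : 0 ≤ |X i ω| ^ (2 + δ) := by positivity
      linarith
  have h3 : Integrable (fun ω => (2 * A) ^ (2 + δ) * (1 + |X i ω| ^ (2 + δ))) P :=
    ((integrable_const _).add (h.integrable i)).const_mul _
  have h4 := (measurable_recentred_right α (m i) (V P α (X i) (m i)) 0).comp (h.measurable i)
  refine ⟨h3.mono' (h4.abs.pow_const _).aestronglyMeasurable (ae_of_all _ fun ω => ?_), ?_⟩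
  · rw [Real.norm_of_nonneg (by positivity)]; exact h1 ω
  refine (integral_mono_of_nonneg (ae_of_all _ fun ω => by positivity) h3 (ae_of_all _ h1)).trans ?_
  rw [integral_const_mul, integral_add (integrable_const _) (h.integrable i)]
  simp only [integral_const, probReal_univ, one_smul]
  gcongr
  exact h.moment_le i

lemma integrable_recentred_rpow (h : ConvergingLaws P α δ B L M l X f m X₀ f₀ m₀) (hδ : 0 < δ)
    (hα₁ : α < 1) (i : ι) :
    Integrable (fun ω => |recentred α (m i) (V P α (X i) (m i)) 0 (X i ω)| ^ (2 + δ)) P := by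
  have h1α : 0 < 1 - α := by linarith
  exact (h.integral_recentred_rpow_le hδ (by unfold recentredBound; positivity)
    (abs_recentred_zero_le hα₁ _ _)).1

lemma exists_integral_recentred_rpow_le [l.IsCountablyGenerated]
    (h : ConvergingLaws P α δ B L M l X f m X₀ f₀ m₀) (hδ : 0 < δ) (hα₁ : α < 1) :
    ∃ M', ∀ᶠ i in l,
      ∫ ω, |recentred α (m i) (V P α (X i) (m i)) 0 (X i ω)| ^ (2 + δ) ∂P ≤ M' := by
  obtain ⟨A, hA, hA1, -⟩ := h.exists_recentred_le hδ hα₁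
  exact ⟨_, hA1.mono fun i hi => (h.integral_recentred_rpow_le hδ hA hi).2⟩

end ConvergingLaws
end ConvergingLaws

/-! ### Weighted sums of the two increments -/

section WeightedSum

variable {Ω : Type*} [mΩ : MeasurableSpace Ω] {P : Measure Ω} [IsProbabilityMeasure P]

lemma abs_add_rpow_le {p : ℝ} (hp : 0 < p) (a b : ℝ) :
    |a + b| ^ p ≤ 2 ^ p * (|a| ^ p + |b| ^ p) := by
  have h1 : |a + b| ≤ 2 * max |a| |b| :=
    (abs_add_le a b).trans (by linarith [le_max_left |a| |b|, le_max_right |a| |b|])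
  refine (Real.rpow_le_rpow (abs_nonneg _) h1 hp.le).trans ?_
  rw [Real.mul_rpow (by norm_num) (by positivity)]
  gcongr
  have ha : 0 ≤ |a| ^ p := by positivity
  have hb : 0 ≤ |b| ^ p := by positivity
  rcases le_total |a| |b| with h | h
  · rw [max_eq_right h]; linarith
  · rw [max_eq_left h]; linarith

/-- A central limit theorem for sums of `b i k * u i (x i k) + d i * q i (x i k)`, `k < n i`, of
identically distributed centred terms with a bounded part `u` and an unbounded part `q`. -/
theorem tendsto_integral_cexp_weighted {ι : Type*} {l : Filter ι} (n : ι → ℕ)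
    {x : ι → ℕ → Ω → ℝ} {X : ι → Ω → ℝ} (hx : ∀ i k, Measurable (x i k))
    (hX : ∀ i, Measurable (X i)) (hlaw : ∀ i k, IdentDistrib (x i k) (X i) P P)
    (hind : ∀ i, iIndepFun (x i) P) {u q : ι → ℝ → ℝ} (hu : ∀ i, Measurable (u i))
    (hq : ∀ i, Measurable (q i)) (b : ι → ℕ → ℝ) (d : ι → ℝ) {B : ℝ} (huB : ∀ i y, |u i y| ≤ B)
    (hu0 : ∀ i, ∫ ω, u i (X i ω) ∂P = 0) (hq0 : ∀ i, ∫ ω, q i (X i ω) ∂P = 0) {δ : ℝ}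
    (hδ₀ : 0 < δ) (hδ₁ : δ ≤ 1) (hqi : ∀ i, Integrable (fun ω => |q i (X i ω)| ^ (2 + δ)) P) {M : ℝ}
    (hqM : ∀ᶠ i in l, ∫ ω, |q i (X i ω)| ^ (2 + δ) ∂P ≤ M) {ρ : ι → ℝ}
    (hρ0 : Tendsto ρ l (𝓝 0)) (hbρ : ∀ᶠ i in l, ∀ k < n i, |b i k| ≤ ρ i) {S T t U κ τ : ℝ}
    (hS : Tendsto (fun i => ∑ k ∈ Finset.range (n i), b i k ^ 2) l (𝓝 S))
    (hT : Tendsto (fun i => d i * ∑ k ∈ Finset.range (n i), b i k) l (𝓝 T))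
    (ht : Tendsto (fun i => n i * d i ^ 2) l (𝓝 t)) (hd : Tendsto d l (𝓝 0))
    (hU : Tendsto (fun i => ∫ ω, u i (X i ω) ^ 2 ∂P) l (𝓝 U))
    (hκ : Tendsto (fun i => ∫ ω, u i (X i ω) * q i (X i ω) ∂P) l (𝓝 κ))
    (hτ : Tendsto (fun i => ∫ ω, q i (X i ω) ^ 2 ∂P) l (𝓝 τ)) :
    Tendsto (fun i => ∑ k ∈ Finset.range (n i),
        ∫ ω, (b i k * u i (x i k ω) + d i * q i (x i k ω)) ^ 2 ∂P) l
      (𝓝 (S * U + 2 * T * κ + t * τ)) ∧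
    Tendsto (fun i => ∫ ω, Complex.exp ((∑ k ∈ Finset.range (n i),
        (b i k * u i (x i k ω) + d i * q i (x i k ω)) : ℝ) * Complex.I) ∂P) l
      (𝓝 (Complex.exp ((-(S * U + 2 * T * κ + t * τ) / 2 : ℝ) : ℂ))) := by
  have hp : 0 < 2 + δ := by linarith
  have huX : ∀ i, Measurable fun ω => u i (X i ω) := fun i => (hu i).comp (hX i)
  have hqX : ∀ i, Measurable fun ω => q i (X i ω) := fun i => (hq i).comp (hX i)
  have hqi2 : ∀ i, Integrable (fun ω => q i (X i ω) ^ 2) P := fun i =>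
    integrable_sq_of_integrable_rpow (hqX i) hδ₀ (hqi i)
  have hqi1 : ∀ i, Integrable (fun ω => q i (X i ω)) P := fun i =>
    integrable_of_integrable_sq (hqX i).aestronglyMeasurable (hqi2 i)
  have hui1 : ∀ i, Integrable (fun ω => u i (X i ω)) P := fun i =>
    integrable_of_measurable_of_abs_le (huX i) B fun ω => huB i _
  have hui2 : ∀ i, Integrable (fun ω => u i (X i ω) ^ 2) P := fun i =>
    integrable_of_measurable_of_abs_le ((huX i).pow_const 2) (B ^ 2) fun ω => by
      rw [abs_pow]; exact pow_le_pow_left₀ (abs_nonneg _) (huB i _) 2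
  have huq : ∀ i, Integrable (fun ω => u i (X i ω) * q i (X i ω)) P := fun i =>
    (hqi1 i).bdd_mul (c := B) (huX i).aestronglyMeasurable (ae_of_all _ fun ω => huB i _)
  -- expectations of functions of one term
  have hlaw' : ∀ i k (g : ℝ → ℝ), Measurable g →
      IdentDistrib (fun ω => g (x i k ω)) (fun ω => g (X i ω)) P P :=
    fun i k g hg => (hlaw i k).comp hg
  have hsq : ∀ i k, ∫ ω, (b i k * u i (x i k ω) + d i * q i (x i k ω)) ^ 2 ∂P =
      b i k ^ 2 * ∫ ω, u i (X i ω) ^ 2 ∂P +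
        2 * (d i * b i k) * ∫ ω, u i (X i ω) * q i (X i ω) ∂P +
          d i ^ 2 * ∫ ω, q i (X i ω) ^ 2 ∂P := by
    intro i k
    have h1 := (hlaw' i k (fun y => (b i k * u i y + d i * q i y) ^ 2)
      ((((hu i).const_mul _).add ((hq i).const_mul _)).pow_const 2)).integral_eq
    rw [h1]
    have h2 : ∀ ω, (b i k * u i (X i ω) + d i * q i (X i ω)) ^ 2 = b i k ^ 2 * u i (X i ω) ^ 2 +
        2 * (d i * b i k) * (u i (X i ω) * q i (X i ω)) + d i ^ 2 * q i (X i ω) ^ 2 :=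
      fun ω => by ring
    simp_rw [h2]
    have h3 : Integrable (fun ω => b i k ^ 2 * u i (X i ω) ^ 2 +
        2 * (d i * b i k) * (u i (X i ω) * q i (X i ω))) P :=
      ((hui2 i).const_mul _).add ((huq i).const_mul _)
    rw [integral_add h3 ((hqi2 i).const_mul _), integral_add ((hui2 i).const_mul _)
      ((huq i).const_mul _), integral_const_mul, integral_const_mul, integral_const_mul]
  have hsum : Tendsto (fun i => ∑ k ∈ Finset.range (n i),
      ∫ ω, (b i k * u i (x i k ω) + d i * q i (x i k ω)) ^ 2 ∂P) l
      (𝓝 (S * U + 2 * T * κ + t * τ)) := by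
    refine (((hS.mul hU).add ((hT.const_mul 2).mul hκ)).add (ht.mul hτ)).congr fun i => ?_
    simp_rw [hsq]
    rw [Finset.sum_add_distrib, Finset.sum_add_distrib, ← Finset.sum_mul, ← Finset.sum_mul,
      ← Finset.mul_sum, ← Finset.mul_sum, Finset.sum_const, Finset.card_range, nsmul_eq_mul]
    ring
  refine ⟨hsum, ?_⟩
  have hm : ∀ i k, Measurable fun y => b i k * u i y + d i * q i y := fun i k =>
    ((hu i).const_mul _).add ((hq i).const_mul _)
  -- the bound on the moments of order `2 + δ`
  have hrp : ∀ i k y, |b i k * u i y + d i * q i y| ^ (2 + δ) ≤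
      2 ^ (2 + δ) * (|b i k| ^ (2 + δ) * B ^ (2 + δ) + |d i| ^ (2 + δ) * |q i y| ^ (2 + δ)) := by
    intro i k y
    refine (abs_add_rpow_le hp _ _).trans ?_
    rw [abs_mul, abs_mul, Real.mul_rpow (abs_nonneg _) (abs_nonneg _),
      Real.mul_rpow (abs_nonneg _) (abs_nonneg _)]
    have := Real.rpow_le_rpow (abs_nonneg _) (huB i y) hp.le
    gcongr
  have hrpi : ∀ i k, Integrable (fun ω => 2 ^ (2 + δ) * (|b i k| ^ (2 + δ) * B ^ (2 + δ) +
      |d i| ^ (2 + δ) * |q i (X i ω)| ^ (2 + δ))) P := fun i k =>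
    ((integrable_const _).add ((hqi i).const_mul _)).const_mul _
  have hint : ∀ i k, Integrable (fun ω => |b i k * u i (X i ω) + d i * q i (X i ω)| ^ (2 + δ)) P :=
    fun i k => (hrpi i k).mono' ((((hm i k).comp (hX i)).abs.pow_const _).aestronglyMeasurable)
      (ae_of_all _ fun ω => by rw [Real.norm_of_nonneg (by positivity)]; exact hrp i k _)
  have hrpw : ∀ a : ℝ, |a| ^ (2 + δ) = |a| ^ δ * a ^ 2 := fun a => by
    rcases eq_or_ne a 0 with rfl | ha
    · rw [abs_zero, Real.zero_rpow hp.ne']; simp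
    · rw [Real.rpow_add (abs_pos.2 ha), Real.rpow_two, sq_abs, mul_comm]
  refine tendsto_integral_cexp_sum n (fun i k ω => b i k * u i (x i k ω) + d i * q i (x i k ω))
    (fun i k => (hm i k).comp (hx i k)) (fun i => (hind i).comp _ (hm i)) (fun i k => ?_) hδ₀ hδ₁
    (fun i k => ?_) hsum ?_ ?_
  · rw [(hlaw' i k _ (hm i k)).integral_eq, integral_add ((hui1 i).const_mul _)
      ((hqi1 i).const_mul _), integral_const_mul, integral_const_mul, hu0, hq0]
    ring
  · exact (hlaw' i k (fun y => |b i k * u i y + d i * q i y| ^ (2 + δ))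
      ((hm i k).abs.pow_const _)).integrable_iff.2 (hint i k)
  · -- each variance is at most of the order of the largest weight
    have hub : ∀ i, ∫ ω, u i (X i ω) ^ 2 ∂P ≤ B ^ 2 := fun i => by
      refine (integral_mono (hui2 i) (integrable_const (B ^ 2)) fun ω => ?_).trans (by simp)
      exact sq_le_sq.2 ((huB i _).trans (le_abs_self B))
    have h1 : Tendsto (fun i => (2 * (ρ i ^ 2 * B ^ 2) + 2 * (d i ^ 2 * ∫ ω, q i (X i ω) ^ 2 ∂P)) *
        ∑ k ∈ Finset.range (n i), ∫ ω, (b i k * u i (x i k ω) + d i * q i (x i k ω)) ^ 2 ∂P) l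
        (𝓝 0) := by
      have := (((((hρ0.pow 2).mul_const (B ^ 2)).const_mul 2).add
        (((hd.pow 2).mul hτ).const_mul 2)).mul hsum)
      simpa using this
    refine squeeze_zero' (Eventually.of_forall fun i => Finset.sum_nonneg fun k _ => sq_nonneg _)
      ?_ h1
    filter_upwards [hbρ] with i hi
    rw [Finset.mul_sum]
    refine Finset.sum_le_sum fun k hk => ?_
    have h2 : 0 ≤ ∫ ω, (b i k * u i (x i k ω) + d i * q i (x i k ω)) ^ 2 ∂P :=
      integral_nonneg fun ω => sq_nonneg _
    rw [sq (∫ ω, _ ∂P)]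
    refine mul_le_mul_of_nonneg_right ?_ h2
    rw [(hlaw' i k (fun y => (b i k * u i y + d i * q i y) ^ 2)
      ((hm i k).pow_const 2)).integral_eq]
    have h3 : ∀ ω, (b i k * u i (X i ω) + d i * q i (X i ω)) ^ 2 ≤
        2 * (b i k ^ 2 * u i (X i ω) ^ 2) + 2 * (d i ^ 2 * q i (X i ω) ^ 2) := fun ω => by
      nlinarith [sq_nonneg (b i k * u i (X i ω) - d i * q i (X i ω))]
    have h4 : Integrable (fun ω => 2 * (b i k ^ 2 * u i (X i ω) ^ 2) +
        2 * (d i ^ 2 * q i (X i ω) ^ 2)) P :=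
      (((hui2 i).const_mul _).const_mul _).add (((hqi2 i).const_mul _).const_mul _)
    refine (integral_mono_of_nonneg (ae_of_all _ fun ω => sq_nonneg _) h4 (ae_of_all _ h3)).trans ?_
    rw [integral_add (((hui2 i).const_mul _).const_mul _) (((hqi2 i).const_mul _).const_mul _),
      integral_const_mul, integral_const_mul, integral_const_mul, integral_const_mul]
    have h5 : b i k ^ 2 ≤ ρ i ^ 2 :=
      sq_le_sq.2 ((hi k (Finset.mem_range.1 hk)).trans (le_abs_self _))
    have h6 : 0 ≤ ∫ ω, u i (X i ω) ^ 2 ∂P := integral_nonneg fun ω => sq_nonneg _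
    have h7 := mul_le_mul h5 (hub i) h6 (sq_nonneg _)
    linarith
  · have h1 : Tendsto (fun i => 2 ^ (2 + δ) * (ρ i ^ δ * (∑ k ∈ Finset.range (n i), b i k ^ 2) *
        B ^ (2 + δ) + |d i| ^ δ * (n i * d i ^ 2) * M)) l (𝓝 0) := by
      have h2 := hρ0.rpow_const (p := δ) (Or.inr hδ₀.le)
      have h3 := hd.abs.rpow_const (p := δ) (Or.inr hδ₀.le)
      rw [Real.zero_rpow hδ₀.ne'] at h2
      rw [abs_zero, Real.zero_rpow hδ₀.ne'] at h3
      have := ((((h2.mul hS).mul_const (B ^ (2 + δ))).add ((h3.mul ht).mul_const M)).const_mul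
        ((2 : ℝ) ^ (2 + δ)))
      simpa using this
    refine squeeze_zero' (Eventually.of_forall fun i => Finset.sum_nonneg fun k _ =>
      integral_nonneg fun ω => by positivity) ?_ h1
    filter_upwards [hbρ, hqM] with i hi hqMi
    have hB0 : 0 ≤ B := (abs_nonneg _).trans (huB i 0)
    have h2 : ∀ k ∈ Finset.range (n i),
        ∫ ω, |b i k * u i (x i k ω) + d i * q i (x i k ω)| ^ (2 + δ) ∂P ≤
        2 ^ (2 + δ) * (ρ i ^ δ * b i k ^ 2 * B ^ (2 + δ) + |d i| ^ δ * d i ^ 2 * M) := by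
      intro k hk
      rw [(hlaw' i k (fun y => |b i k * u i y + d i * q i y| ^ (2 + δ))
        ((hm i k).abs.pow_const _)).integral_eq]
      refine (integral_mono_of_nonneg (ae_of_all _ fun ω => by positivity) (hrpi i k)
        (ae_of_all _ fun ω => hrp i k _)).trans ?_
      rw [integral_const_mul, integral_add (integrable_const _) ((hqi i).const_mul _),
        integral_const_mul (|d i| ^ (2 + δ))]
      simp only [integral_const, probReal_univ, one_smul]
      rw [hrpw (b i k), hrpw (d i)]
      have h5 : |b i k| ^ δ ≤ ρ i ^ δ :=
        Real.rpow_le_rpow (abs_nonneg _) (hi k (Finset.mem_range.1 hk)) hδ₀.le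
      gcongr
    refine (Finset.sum_le_sum h2).trans (le_of_eq ?_)
    rw [← Finset.mul_sum, Finset.sum_add_distrib, ← Finset.sum_mul, ← Finset.mul_sum,
      Finset.sum_const, Finset.card_range, nsmul_eq_mul]
    ring

end WeightedSum

/-! ### Scaling by the bias parameter -/

section Scaling

lemma inv_bias (K : ℕ+) : (bias K)⁻¹ = K := by rw [bias, one_div, inv_inv]

lemma ceil_bias_zpow (K : ℕ+) : ⌈bias K ^ (-2 : ℤ)⌉₊ = (K : ℕ) ^ 2 := by
  have h : bias K ^ (-2 : ℤ) = (((K : ℕ) ^ 2 : ℕ) : ℝ) := by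
    simp [bias, zpow_neg]
  rw [h, Nat.ceil_natCast]

lemma bias_rpow_neg (K : ℕ+) (β : ℝ) : bias K ^ (-β) = (K : ℝ) ^ β := by
  rw [bias, one_div, Real.inv_rpow (by positivity), Real.rpow_neg (by positivity), inv_inv]

lemma tendsto_pnat_cast : Tendsto (fun K : ℕ+ => (K : ℝ)) atTop atTop :=
  tendsto_natCast_atTop_atTop.comp tendsto_PNat_val_atTop_atTop

lemma tendsto_pnat_sq : Tendsto (fun K : ℕ+ => (K : ℕ) ^ 2) atTop atTop :=
  (tendsto_pow_atTop two_ne_zero).comp tendsto_PNat_val_atTop_atTop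

lemma stepSize_sq (γ₁ β : ℝ) (K : ℕ+) :
    stepSize γ₁ β ((K : ℕ) ^ 2) = γ₁ * ((K : ℝ) ^ (-β)) ^ 2 := by
  rw [stepSize, ← Real.rpow_natCast _ 2, ← Real.rpow_mul (by positivity)]
  push_cast
  rw [← Real.rpow_natCast (K : ℝ) 2, ← Real.rpow_mul (by positivity)]
  congr 2; push_cast; ring

lemma rpow_mul_rpow_neg (K : ℕ+) (β : ℝ) : (K : ℝ) ^ β * (K : ℝ) ^ (-β) = 1 := by
  have : (0 : ℝ) < K := by exact_mod_cast K.pos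
  rw [← Real.rpow_add this, add_neg_cancel, Real.rpow_zero]

variable {γ₁ β : ℝ}

/-- A rate slightly below `a` that still meets the condition of the critical case `β = 1`. -/
lemma exists_rate_lt {a : ℝ} (hγ₁ : 0 < γ₁) (ha : 0 < a) (h1 : β = 1 → 1 < a * γ₁) :
    ∃ a₀, 0 < a₀ ∧ a₀ < a ∧ (β = 1 → 1 < a₀ * γ₁) := by
  by_cases hβ : β = 1
  · have h2 : γ₁⁻¹ < a := by rw [inv_lt_iff_one_lt_mul₀ hγ₁]; linarith [h1 hβ, mul_comm a γ₁]
    obtain ⟨a₀, h3, h4⟩ := exists_between h2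
    exact ⟨a₀, (inv_pos.2 hγ₁).trans h3, h4, fun _ => by
      rw [inv_lt_iff_one_lt_mul₀ hγ₁] at h3; linarith [mul_comm a₀ γ₁]⟩
  · exact ⟨a / 2, by linarith, by linarith, fun h => absurd h hβ⟩

lemma tendsto_sum_weight (hγ₁ : 0 < γ₁) (hβ₀ : 0 < β) (hβ₁ : β ≤ 1) {a : ℕ+ → ℝ} {a' : ℝ}
    (ha : Tendsto a atTop (𝓝 a')) (ha' : 0 < a') :
    Tendsto (fun K : ℕ+ => ∑ k ∈ Finset.range ((K : ℕ) ^ 2), weight γ₁ β (a K) ((K : ℕ) ^ 2) k)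
      atTop (𝓝 (-(1 / a'))) := by
  have h1 : Tendsto (fun K : ℕ+ => ∑ k ∈ Finset.range ((K : ℕ) ^ 2),
      weight γ₁ β (a K) ((K : ℕ) ^ 2) k + 1 / a K) atTop (𝓝 0) := by
    rw [Metric.tendsto_nhds]
    intro ε hε
    obtain ⟨N, hN⟩ := exists_abs_sum_weight_add_le (a₀ := a' / 2) (a₁ := a' + 1) hγ₁ hβ₀ hβ₁
      (half_pos ha') (half_pos hε)
    filter_upwards [ha.eventually (le_mem_nhds (half_lt_self ha')),
      ha.eventually (ge_mem_nhds (lt_add_one a')), tendsto_pnat_sq.eventually_ge_atTop N]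
      with K h2 h3 h4
    rw [Real.dist_eq, sub_zero]
    exact (hN _ h2 h3 _ h4).trans_lt (half_lt_self hε)
  have h2 := h1.sub ((tendsto_const_nhds (x := (1 : ℝ))).div ha ha'.ne')
  simpa using h2

open Classical in
lemma tendsto_sum_weight_sq (hγ₁ : 0 < γ₁) (hβ₀ : 0 < β) (hβ₁ : β ≤ 1) {a : ℕ+ → ℝ} {a' : ℝ}
    (ha : Tendsto a atTop (𝓝 a')) (ha' : 0 < a') (h1 : β = 1 → 1 < a' * γ₁) :
    Tendsto (fun K : ℕ+ => ∑ k ∈ Finset.range ((K : ℕ) ^ 2),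
      ((K : ℝ) ^ β * weight γ₁ β (a K) ((K : ℕ) ^ 2) k) ^ 2)
      atTop (𝓝 (γ₁ / (2 * a' - γ₁⁻¹ * if β = 1 then 1 else 0))) := by
  obtain ⟨a₀, ha₀, ha₀', h1'⟩ := exists_rate_lt hγ₁ ha' h1
  set e : ℝ := γ₁⁻¹ * if β = 1 then 1 else 0 with he
  have hea : 2 * a' - e ≠ 0 := by
    have : e < a' := by
      rw [he]; split_ifs with h
      · have := h1 h; rw [mul_one, inv_lt_iff_one_lt_mul₀ hγ₁]; linarith
      · simpa using ha'
    linarith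
  have h2 : Tendsto (fun K : ℕ+ => (∑ k ∈ Finset.range ((K : ℕ) ^ 2),
      weight γ₁ β (a K) ((K : ℕ) ^ 2) k ^ 2) / stepSize γ₁ β ((K : ℕ) ^ 2) -
        1 / (2 * a K - e)) atTop (𝓝 0) := by
    rw [Metric.tendsto_nhds]
    intro ε hε
    obtain ⟨N, hN⟩ := exists_abs_sum_weight_sq_div_sub_le (a₀ := a₀) (a₁ := a' + 1) hγ₁ hβ₀ hβ₁
      ha₀ h1' (half_pos hε)
    filter_upwards [ha.eventually (le_mem_nhds ha₀'),
      ha.eventually (ge_mem_nhds (lt_add_one a')), tendsto_pnat_sq.eventually_ge_atTop N]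
      with K h3 h4 h5
    rw [Real.dist_eq, sub_zero]
    exact (hN _ h3 h4 _ h5).trans_lt (half_lt_self hε)
  have h3 := (h2.add
    ((tendsto_const_nhds (x := (1 : ℝ))).div ((ha.const_mul 2).sub_const e) hea)).const_mul γ₁
  simp only [Pi.div_apply, sub_add_cancel, zero_add] at h3
  rw [mul_one_div] at h3
  refine h3.congr fun K => ?_
  have h4 : (0 : ℝ) < (K : ℝ) ^ (-β) := Real.rpow_pos_of_pos (by exact_mod_cast K.pos) _
  have h5 : (K : ℝ) ^ β = ((K : ℝ) ^ (-β))⁻¹ := eq_inv_of_mul_eq_one_left (rpow_mul_rpow_neg K β)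
  rw [stepSize_sq, h5]
  simp_rw [mul_pow]
  rw [← Finset.mul_sum]
  field_simp

lemma exists_abs_rpow_mul_weight_le (hγ₁ : 0 < γ₁) (hβ₀ : 0 < β) (hβ₁ : β ≤ 1) {a : ℕ+ → ℝ}
    {a' : ℝ} (ha : Tendsto a atTop (𝓝 a')) (ha' : 0 < a') (h1 : β = 1 → 1 < a' * γ₁) :
    ∃ C, ∀ᶠ K : ℕ+ in atTop, ∀ k < (K : ℕ) ^ 2,
      |(K : ℝ) ^ β * weight γ₁ β (a K) ((K : ℕ) ^ 2) k| ≤ C * (K : ℝ) ^ (-β) := by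
  obtain ⟨a₀, ha₀, ha₀', h1'⟩ := exists_rate_lt hγ₁ ha' h1
  obtain ⟨C, hC0, hC⟩ := exists_abs_weight_le (a₁ := a' + 1) hγ₁ hβ₀ hβ₁ ha₀ h1'
  refine ⟨C * γ₁, ?_⟩
  filter_upwards [ha.eventually (le_mem_nhds ha₀'), ha.eventually (ge_mem_nhds (lt_add_one a'))]
    with K h3 h4 k hk
  have h5 := hC _ h3 h4 _ (Nat.one_le_pow _ _ K.pos) k hk
  have h6 : (0 : ℝ) < (K : ℝ) ^ β := Real.rpow_pos_of_pos (by exact_mod_cast K.pos) _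
  rw [abs_mul, abs_of_pos h6]
  refine (mul_le_mul_of_nonneg_left h5 h6.le).trans (le_of_eq ?_)
  rw [stepSize_sq]
  calc (K : ℝ) ^ β * (C * (γ₁ * ((K : ℝ) ^ (-β)) ^ 2))
      = C * γ₁ * ((K : ℝ) ^ β * (K : ℝ) ^ (-β)) * (K : ℝ) ^ (-β) := by ring
    _ = _ := by rw [rpow_mul_rpow_neg, mul_one]

lemma tendsto_rpow_neg_pnat (hβ₀ : 0 < β) :
    Tendsto (fun K : ℕ+ => (K : ℝ) ^ (-β)) atTop (𝓝 0) :=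
  (tendsto_rpow_neg_atTop hβ₀).comp tendsto_pnat_cast

open Classical in
lemma tendsto_rpow_sub_one (hβ₁ : β ≤ 1) :
    Tendsto (fun K : ℕ+ => (K : ℝ)⁻¹ * (K : ℝ) ^ β) atTop (𝓝 (if β = 1 then 1 else 0)) := by
  split_ifs with h
  · refine tendsto_const_nhds.congr fun K => ?_
    have : (K : ℝ) ≠ 0 := by exact_mod_cast K.ne_zero
    rw [h, Real.rpow_one, inv_mul_cancel₀ this]
  · refine (tendsto_rpow_neg_pnat (β := 1 - β) (by
      have := lt_of_le_of_ne hβ₁ h; linarith)).congr fun K => ?_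
    have : (0 : ℝ) < K := by exact_mod_cast K.pos
    rw [← Real.rpow_neg_one, ← Real.rpow_add this]
    congr 1; ring

end Scaling

section Tools

set_option linter.unusedSectionVars false

variable {Ω : Type*} [mΩ : MeasurableSpace Ω] {P : Measure Ω} [IsProbabilityMeasure P]

/-- Lévy's continuity theorem along the positive integers. -/
lemma tendstoInDistribution_of_tendsto_charFun {E : Type*} [NormedAddCommGroup E]
    [InnerProductSpace ℝ E] [FiniteDimensional ℝ E] [MeasurableSpace E] [BorelSpace E]
    {X : ℕ+ → Ω → E} (hX : ∀ K, Measurable (X K)) (μ : Measure E) [IsProbabilityMeasure μ]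
    (h : ∀ t, Tendsto (fun K => charFun (P.map (X K)) t) atTop (𝓝 (charFun μ t))) :
    TendstoInDistribution X atTop (id : E → E) (fun _ => P) μ := by
  have h1 : ∀ (ν : ℕ+ → ProbabilityMeasure E) (ν₀ : ProbabilityMeasure E),
      (∀ t, Tendsto (fun K => charFun (ν K : Measure E) t) atTop (𝓝 (charFun (ν₀ : Measure E) t))) →
        Tendsto ν atTop (𝓝 ν₀) := fun ν ν₀ hν => by
    rw [← OrderIso.map_atTop OrderIso.pnatIsoNat.symm, tendsto_map'_iff]
    exact ProbabilityMeasure.tendsto_iff_tendsto_charFun.2 fun t =>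
      (hν t).comp (OrderIso.tendsto_atTop OrderIso.pnatIsoNat.symm)
  refine ⟨fun K => (hX K).aemeasurable, aemeasurable_id, h1 _ _ fun t => ?_⟩
  simpa using h t

lemma exists_integral_init_sq_le {α : ℝ} (hα₁ : α < 1) {f : Option ℕ+ → ℝ → ℝ}
    {ξ₀ : ℕ+ → Ω → ℝ} (hm : ∀ K, Measurable (ξ₀ K)) (h : InitialMoment P α f ξ₀) :
    ∃ S, ∀ K, Integrable (fun ω => ξ₀ K ω ^ 2) P ∧ ∫ ω, ξ₀ K ω ^ 2 ∂P ≤ S := by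
  unfold InitialMoment at h
  set T := ⨆ K : ℕ+, ∫⁻ ω, ENNReal.ofReal (|ξ₀ K ω| ^ 2 * Real.exp (4 / (1 - α) *
    max 1 (α / (1 - α)) * (⨆ L : ℕ+, supNorm (f (some L))) * |ξ₀ K ω|)) ∂P with hT
  have hs : 0 ≤ ⨆ L : ℕ+, supNorm (f (some L)) :=
    Real.iSup_nonneg fun L => Real.iSup_nonneg fun x => abs_nonneg _
  have h1α : 0 < 1 - α := by linarith
  have h1 : ∀ K, ∫⁻ ω, ENNReal.ofReal (ξ₀ K ω ^ 2) ∂P ≤ T := fun K => by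
    refine (lintegral_mono fun ω => ENNReal.ofReal_le_ofReal ?_).trans (le_iSup (fun K : ℕ+ =>
      ∫⁻ ω, ENNReal.ofReal (|ξ₀ K ω| ^ 2 * Real.exp (4 / (1 - α) *
        max 1 (α / (1 - α)) * (⨆ L : ℕ+, supNorm (f (some L))) * |ξ₀ K ω|)) ∂P) K)
    rw [sq_abs]
    exact le_mul_of_one_le_right (sq_nonneg _) (Real.one_le_exp (by positivity))
  refine ⟨T.toReal, fun K => ?_⟩
  have hi : Integrable (fun ω => ξ₀ K ω ^ 2) P := by
    refine ⟨((hm K).pow_const 2).aestronglyMeasurable, ?_⟩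
    rw [hasFiniteIntegral_iff_ofReal (ae_of_all _ fun ω => sq_nonneg _)]
    exact (h1 K).trans_lt h
  refine ⟨hi, ?_⟩
  rw [integral_eq_lintegral_of_nonneg_ae (ae_of_all _ fun ω => sq_nonneg _) hi.1]
  exact ENNReal.toReal_mono h.ne (h1 K)

lemma integral_sub_sq_le {U : Ω → ℝ} (hU : Measurable U) (hi : Integrable (fun ω => U ω ^ 2) P)
    {S : ℝ} (hS : ∫ ω, U ω ^ 2 ∂P ≤ S) (m : ℝ) :
    Integrable (fun ω => (U ω - m) ^ 2) P ∧ ∫ ω, (U ω - m) ^ 2 ∂P ≤ 2 * S + 2 * m ^ 2 := by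
  have h1 : ∀ ω, (U ω - m) ^ 2 ≤ 2 * U ω ^ 2 + 2 * m ^ 2 := fun ω => by
    nlinarith [sq_nonneg (U ω + m)]
  have h2 : Integrable (fun ω => 2 * U ω ^ 2 + 2 * m ^ 2) P :=
    (hi.const_mul 2).add (integrable_const _)
  have h3 : Integrable (fun ω => (U ω - m) ^ 2) P :=
    h2.mono' ((hU.sub_const m).pow_const 2).aestronglyMeasurable (ae_of_all _ fun ω => by
      rw [Real.norm_of_nonneg (sq_nonneg _)]; exact h1 ω)
  refine ⟨h3, (integral_mono h3 h2 h1).trans ?_⟩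
  rw [integral_add (hi.const_mul 2) (integrable_const _), integral_const_mul]
  simp only [integral_const, probReal_univ, one_smul]
  linarith

end Tools

/-! ### The limit of the rescaled error -/

section Limit

set_option linter.unusedSectionVars false

variable {Ω : Type*} [mΩ : MeasurableSpace Ω] {P : Measure Ω} [IsProbabilityMeasure P]

/-- The linearisation of the rescaled error after `K ^ 2` steps driven by `x`, with the linear rate
`a`, the minimiser `m` and the minimum `V₀`: both components are sums of independent terms. -/
noncomputable def linearPart (α γ₁ β a m V₀ : ℝ) (x : ℕ → ℝ) (K : ℕ+) : EuclideanSpace ℝ (Fin 2) :=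
  !₂[(K : ℝ) ^ β * ∑ k ∈ Finset.range ((K : ℕ) ^ 2), weight γ₁ β a ((K : ℕ) ^ 2) k * H₁ α m (x k),
    (K : ℝ)⁻¹ * ∑ k ∈ Finset.range ((K : ℕ) ^ 2), recentred α m V₀ 0 (x k)]

lemma measurable_linearPart (α γ₁ β a m V₀ : ℝ) {x : ℕ → Ω → ℝ} (hx : ∀ k, Measurable (x k))
    (K : ℕ+) : Measurable fun ω => linearPart α γ₁ β a m V₀ (fun k => x k ω) K := by
  have h1 : ∀ k, Measurable fun ω => H₁ α m (x k ω) := fun k => (measurable_H₁_right α m).comp (hx k)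
  have h2 : ∀ k, Measurable fun ω => recentred α m V₀ 0 (x k ω) := fun k =>
    (measurable_recentred_right α m V₀ 0).comp (hx k)
  unfold linearPart
  refine (WithLp.measurable_toLp 2 _).comp (measurable_pi_iff.2 fun i => ?_)
  fin_cases i
  · exact (Finset.measurable_fun_sum _ fun k _ => (h1 k).const_mul _).const_mul _
  · exact (Finset.measurable_fun_sum _ fun k _ => h2 k).const_mul _

lemma inner_linearPart (α γ₁ β a m V₀ : ℝ) (x : ℕ → ℝ) (K : ℕ+) (t : EuclideanSpace ℝ (Fin 2)) :
    inner ℝ (linearPart α γ₁ β a m V₀ x K) t = ∑ k ∈ Finset.range ((K : ℕ) ^ 2),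
      (t 0 * ((K : ℝ) ^ β * weight γ₁ β a ((K : ℕ) ^ 2) k) * H₁ α m (x k) +
        t 1 * (K : ℝ)⁻¹ * recentred α m V₀ 0 (x k)) := by
  rw [Finset.sum_add_distrib, ← Finset.mul_sum, PiLp.inner_apply, Fin.sum_univ_two]
  simp only [linearPart, Matrix.cons_val_zero, Matrix.cons_val_one, RCLike.inner_apply, conj_trivial]
  congr 1
  · rw [Finset.mul_sum, Finset.mul_sum]
    exact Finset.sum_congr rfl fun k _ => by ring
  · ring

open Classical in
/-- The quadratic form of the limiting covariance matrix as the limit of the variances of the linear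
combinations of the linearised error. -/
lemma dotProduct_limitCov {α γ₁ β : ℝ} (hα₁ : α < 1) {X : Ω → ℝ} {f : ℝ → ℝ} {m v : ℝ}
    (hm : VaR P α X = m) (hv : ES P α X = v) (t : EuclideanSpace ℝ (Fin 2)) :
    t.ofLp ⬝ᵥ (limitCov P α γ₁ β X f).mulVec t.ofLp =
      t 0 ^ 2 * (γ₁ / (2 * (f m / (1 - α)) - γ₁⁻¹ * if β = 1 then 1 else 0)) * (α / (1 - α)) +
        2 * (t 1 * t 0 * ((if β = 1 then 1 else 0) * -(1 / (f m / (1 - α))))) *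
          (-(α / (1 - α)) * (v - m)) +
        t 1 ^ 2 * (Var[fun ω => max (X ω - m) 0; P] / (1 - α) ^ 2) := by
  have h1α : 1 - α ≠ 0 := by linarith
  have h1 : ∀ e : ℝ, γ₁ / (2 * (f m / (1 - α)) - γ₁⁻¹ * e) * (α / (1 - α)) =
      α * γ₁ / (2 * f m - γ₁⁻¹ * (1 - α) * e) := fun e => by
    rw [div_mul_div_comm, mul_comm γ₁ α]
    congr 1
    field_simp
  have h2 : ∀ e : ℝ, e * -(1 / (f m / (1 - α))) * (-(α / (1 - α)) * (v - m)) =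
      α * ((v - m) / f m) * e := fun e => by
    rw [one_div_div]
    field_simp
  simp only [limitCov, Matrix.mulVec, dotProduct, Fin.sum_univ_two, Matrix.of_apply,
    Matrix.cons_val_zero, Matrix.cons_val_one, Matrix.cons_val', Matrix.cons_val_fin_one, hm, hv]
  linear_combination -t 0 ^ 2 * h1 (if β = 1 then 1 else 0) -
    2 * t 0 * t 1 * h2 (if β = 1 then 1 else 0)

variable {α δ B L M γ₁ β : ℝ} {X : ℕ+ → Ω → ℝ} {f : ℕ+ → ℝ → ℝ} {m : ℕ+ → ℝ} {X₀ : Ω → ℝ}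
  {f₀ : ℝ → ℝ} {m₀ : ℝ}

/-- The characteristic function of the linearised error converges to that of the normal law. -/
theorem ConvergingLaws.tendsto_charFun_linearPart
    (h : ConvergingLaws P α δ B L M atTop X f m X₀ f₀ m₀) (hδ₀ : 0 < δ) (hδ₁ : δ ≤ 1)
    (hα₀ : 0 < α) (hα₁ : α < 1) (hγ₁ : 0 < γ₁) (hβ₀ : 0 < β) (hβ₁ : β ≤ 1)
    (h1 : β = 1 → 1 < f₀ m₀ / (1 - α) * γ₁) {x : ℕ+ → ℕ → Ω → ℝ}
    (hx : ∀ K k, Measurable (x K k)) (hlaw : ∀ K k, IdentDistrib (x K k) (X K) P P)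
    (hind : ∀ K, iIndepFun (x K) P) (t : EuclideanSpace ℝ (Fin 2)) :
    0 ≤ t.ofLp ⬝ᵥ (limitCov P α γ₁ β X₀ f₀).mulVec t.ofLp ∧
      Tendsto (fun K => charFun (P.map fun ω => linearPart α γ₁ β (f K (m K) / (1 - α)) (m K)
        (V P α (X K) (m K)) (fun k => x K k ω) K) t) atTop
        (𝓝 (Complex.exp (-(t.ofLp ⬝ᵥ (limitCov P α γ₁ β X₀ f₀).mulVec t.ofLp : ℝ) / 2))) := by
  have h1α : 0 < 1 - α := by linarith
  have hm₀ : VaR P α X₀ = m₀ := by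
    have := h.pdf₀.VaR_cdfOf h.measurable₀ h.pos₀ m₀
    rwa [h.cdfOf_eq₀] at this
  have hv := h.pdf₀.ES_eq h.measurable₀ (h.integrable_X₀ hδ₀) h.pos₀ hα₀ hα₁
  rw [hm₀] at hv
  have ha' : 0 < f₀ m₀ / (1 - α) := div_pos (h.pos₀ _) h1α
  have ha : Tendsto (fun K => f K (m K) / (1 - α)) atTop (𝓝 (f₀ m₀ / (1 - α))) :=
    (h.tendsto_pdf_quantile hδ₀).div_const _
  obtain ⟨C, hC⟩ := exists_abs_rpow_mul_weight_le hγ₁ hβ₀ hβ₁ ha ha' h1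
  obtain ⟨M', hM'⟩ := h.exists_integral_recentred_rpow_le hδ₀ hα₁
  have hU : ∀ K, ∫ ω, H₁ α (m K) (X K ω) ^ 2 ∂P = α / (1 - α) := fun K =>
    (h.pdf K).integral_H₁_sq (h.measurable K) hα₁ (h.cdfOf_eq K)
  have hu0 : ∀ K, ∫ ω, H₁ α (m K) (X K ω) ∂P = 0 := fun K => by
    have h2 := (h.pdf K).integral_H₁ (h.measurable K) hα₁ (m K)
    rw [integral_map (h.measurable K).aemeasurable
      (measurable_H₁_right _ _).aestronglyMeasurable, h.cdfOf_eq] at h2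
    simpa using h2
  have hinv : Tendsto (fun K : ℕ+ => (K : ℝ)⁻¹) atTop (𝓝 0) :=
    tendsto_inv_atTop_zero.comp tendsto_pnat_cast
  obtain ⟨h3, h4⟩ := tendsto_integral_cexp_weighted (P := P) (l := atTop)
    (fun K : ℕ+ => (K : ℕ) ^ 2) hx
    h.measurable hlaw hind (u := fun K => H₁ α (m K))
    (q := fun K => recentred α (m K) (V P α (X K) (m K)) 0)
    (fun K => measurable_H₁_right _ _) (fun K => measurable_recentred_right _ _ _ _)
    (fun K k => t 0 * ((K : ℝ) ^ β * weight γ₁ β (f K (m K) / (1 - α)) ((K : ℕ) ^ 2) k))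
    (fun K => t 1 * (K : ℝ)⁻¹) (fun K y => abs_H₁_le hα₁ _ _) hu0 (h.integral_recentred_zero hδ₀)
    hδ₀ hδ₁ (h.integrable_recentred_rpow hδ₀ hα₁) hM'
    (ρ := fun K => |t 0| * (C * (K : ℝ) ^ (-β)))
    (by simpa using ((tendsto_rpow_neg_pnat hβ₀).const_mul C).const_mul |t 0|)
    (by
      filter_upwards [hC] with K hK k hk
      rw [abs_mul]
      exact mul_le_mul_of_nonneg_left (hK k hk) (abs_nonneg _))
    (S := t 0 ^ 2 * (γ₁ / (2 * (f₀ m₀ / (1 - α)) - γ₁⁻¹ * if β = 1 then 1 else 0)))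
    (by
      refine ((tendsto_sum_weight_sq hγ₁ hβ₀ hβ₁ ha ha' h1).const_mul (t 0 ^ 2)).congr fun K => ?_
      rw [Finset.mul_sum]
      exact Finset.sum_congr rfl fun k _ => by ring)
    (T := t 1 * t 0 * ((if β = 1 then 1 else 0) * -(1 / (f₀ m₀ / (1 - α)))))
    (by
      refine (((tendsto_rpow_sub_one hβ₁).mul (tendsto_sum_weight hγ₁ hβ₀ hβ₁ ha ha')).const_mul
        (t 1 * t 0)).congr fun K => ?_
      simp_rw [Finset.mul_sum]
      exact Finset.sum_congr rfl fun k _ => by ring)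
    (t := t 1 ^ 2)
    (by
      refine tendsto_const_nhds.congr fun K => ?_
      have : (K : ℝ) ≠ 0 := by exact_mod_cast K.ne_zero
      push_cast
      field_simp)
    (by simpa using hinv.const_mul (t 1))
    (U := α / (1 - α)) (by simp_rw [hU]; exact tendsto_const_nhds)
    (h.tendsto_integral_H₁_mul hδ₀ hα₁) (h.tendsto_integral_recentred_sq hδ₀ hα₁)
  rw [dotProduct_limitCov hα₁ hm₀ hv]
  refine ⟨ge_of_tendsto' h3 fun K => Finset.sum_nonneg fun k _ =>
    integral_nonneg fun ω => sq_nonneg _, ?_⟩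
  convert h4 using 2 with K
  · rw [charFun_apply, integral_map (measurable_linearPart _ _ _ _ _ _ (hx K) K).aemeasurable
      (by fun_prop)]
    simp_rw [inner_linearPart]
  · rw [Complex.ofReal_div, Complex.ofReal_neg, Complex.ofReal_ofNat]

/-- The rescaled error and its linearisation are asymptotically equivalent. -/
theorem ConvergingLaws.tendstoInMeasure_rescaledError {X : Option ℕ+ → Ω → ℝ}
    {f : Option ℕ+ → ℝ → ℝ} {ξs : Option ℕ+ → ℝ}
    (h : ConvergingLaws P α δ B L M atTop (fun K => X (some K)) (fun K => f (some K))
      (fun K => ξs (some K)) X₀ f₀ m₀) (hδ₀ : 0 < δ)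
    (hα₁ : α < 1) (hγ₁ : 0 < γ₁) (hβ₀ : 1 / 2 < β) (hβ₁ : β ≤ 1)
    (h1 : β = 1 → 1 < f₀ m₀ / (1 - α) * γ₁) (hL : 0 < L) {c : ℝ} (hc : 0 < c)
    (hfc : ∀ᶠ K : ℕ+ in atTop, ∀ y, |y - ξs (some K)| ≤ 1 → c ≤ f (some K) y) {ξ₀ : ℕ+ → Ω → ℝ}
    {x : ℕ+ → ℕ → Ω → ℝ} (hx : IsInnovation P X ξ₀ x) {S : ℝ}
    (hS : ∀ K, Integrable (fun ω => ξ₀ K ω ^ 2) P ∧ ∫ ω, ξ₀ K ω ^ 2 ∂P ≤ S) :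
    TendstoInMeasure P (rescaledError P α γ₁ β X ξs ξ₀ x - fun K ω =>
      linearPart α γ₁ β (f (some K) (ξs (some K)) / (1 - α)) (ξs (some K))
        (V P α (X (some K)) (ξs (some K))) (fun k => x K k ω) K) atTop 0 := by
  have h1α : 0 < 1 - α := by linarith
  have hB : 0 ≤ B := (abs_nonneg _).trans (h.abs_pdf_le 1 0)
  have ha' : 0 < f₀ m₀ / (1 - α) := div_pos (h.pos₀ _) h1α
  have hm := h.tendsto_quantile hδ₀
  have ha : Tendsto (fun K => f (some K) (ξs (some K)) / (1 - α)) atTop (𝓝 (f₀ m₀ / (1 - α))) :=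
    (h.tendsto_pdf_quantile hδ₀).div_const _
  obtain ⟨a₀, ha₀, ha₀', h1'⟩ := exists_rate_lt hγ₁ ha' h1
  rw [tendstoInMeasure_iff_measureReal_norm]
  intro η hη
  rw [Metric.tendsto_nhds]
  intro η' hη'
  have hsγ : 0 ≤ √γ₁ := Real.sqrt_nonneg _
  set ε := min (η' / 3) (η / (2 * (√γ₁ + 1))) with hε
  have hε0 : 0 < ε := lt_min (by positivity) (by positivity)
  have hL' : 0 < L / (1 - α) + (1 / (1 - α)) ^ 2 * B := by positivity
  obtain ⟨N₁, hN₁⟩ := IsErrorProcess.exists_linearisation (P := P) (a₁ := f₀ m₀ / (1 - α) + 1) hγ₁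
    hβ₀ hβ₁ ha₀ h1' (div_pos hc h1α) (1 + 1 / (1 - α)) hL' (2 * S + 2 * (|m₀| + 1) ^ 2) hε0
  obtain ⟨N₂, hN₂⟩ := IsErrorProcess.exists_sum_sub_le (P := P) hγ₁
    hβ₀ hβ₁ ha₀ h1' (div_pos hc h1α) (1 + 1 / (1 - α)) hL' (2 * S + 2 * (|m₀| + 1) ^ 2)
    (B' := 1 + 1 / (1 - α)) (L' := B / (1 - α)) (by positivity) (by positivity) hε0
  filter_upwards [hfc, hm.abs.eventually (ge_mem_nhds (lt_add_one |m₀|)),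
    ha.eventually (le_mem_nhds ha₀'), ha.eventually (ge_mem_nhds (lt_add_one _)),
    tendsto_pnat_sq.eventually_ge_atTop N₁, tendsto_pnat_sq.eventually_ge_atTop N₂]
    with K hfcK hmK haK haK' hK₁ hK₂
  have hK0 : (0 : ℝ) < K := by exact_mod_cast K.pos
  set m := ξs (some K) with hmdef
  set V₀ := V P α (X (some K)) m with hV₀
  have hinit := integral_sub_sq_le (hx.measurable_init K) (hS K).1 (hS K).2 m
  have hE := isErrorProcess_iterate (γ₁ := γ₁) (β := β) (h.pdf K) (h.measurable K) hα₁
    (h.cdfOf_eq K) (hx.measurable_init K) (hx.measurable K) (hx.identDistrib K) (hx.indep K)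
    (hx.indep_init K) hfcK (h.abs_pdf_le K) hL.le (h.lipschitz K) hinit.1
    (hinit.2.trans (show _ ≤ 2 * S + 2 * (|m₀| + 1) ^ 2 by
      rw [← sq_abs m]; gcongr))
  have hA := hN₁ _ _ _ _ _ _ haK haK' hE _ hK₁
  have hC := hN₂ _ _ _ _ _ _ (recentred α m V₀) haK hE (measurable_recentred _ _ _)
    (abs_recentred_sub_le hα₁ _ _) ((h.pdf K).abs_integral_recentred_sub_le (h.measurable K)
      (h.integrable_X hδ₀ K) hα₁ (h.cdfOf_eq K) (h.abs_pdf_le K) V₀) _ hK₂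
  rw [Real.dist_eq, sub_zero, abs_of_nonneg measureReal_nonneg]
  refine lt_of_le_of_lt ?_ (show ε + ε < η' by
    have : ε ≤ η' / 3 := min_le_left _ _
    linarith)
  refine le_trans (measureReal_mono ?_) ((measureReal_union_le _ _).trans (add_le_add hA hC))
  intro ω hω
  by_contra hnot
  simp only [Set.mem_union, Set.mem_ofPred_eq, not_or, not_lt] at hnot
  obtain ⟨h2, h3⟩ := hnot
  have hω' : η ≤ ‖rescaledError P α γ₁ β X ξs ξ₀ x K ω -
      linearPart α γ₁ β (f (some K) m / (1 - α)) m V₀ (fun k => x K k ω) K‖ := by simpa using hω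
  have hnorm : ∀ y : EuclideanSpace ℝ (Fin 2), ‖y‖ ≤ |y 0| + |y 1| := fun y => by
    rw [EuclideanSpace.norm_eq, Fin.sum_univ_two, Real.norm_eq_abs, Real.norm_eq_abs]
    refine Real.sqrt_le_iff.2 ⟨by positivity, ?_⟩
    nlinarith [mul_nonneg (abs_nonneg (y 0)) (abs_nonneg (y 1))]
  have hfst : |(rescaledError P α γ₁ β X ξs ξ₀ x K ω -
      linearPart α γ₁ β (f (some K) m / (1 - α)) m V₀ (fun k => x K k ω) K) 0| ≤ ε * √γ₁ := by
    have h4 : √(stepSize γ₁ β ((K : ℕ) ^ 2)) = √γ₁ * (K : ℝ) ^ (-β) := by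
      rw [stepSize_sq, Real.sqrt_mul hγ₁.le, Real.sqrt_sq (by positivity)]
    rw [h4] at h2
    simp only [rescaledError, linearPart, finalIterate, PiLp.sub_apply, Matrix.cons_val_zero,
      ceil_bias_zpow, bias_rpow_neg]
    rw [← mul_sub, abs_mul, abs_of_pos (by positivity : 0 < (K : ℝ) ^ β)]
    simp only [add_zero] at h2
    calc (K : ℝ) ^ β * _ ≤ (K : ℝ) ^ β * (ε * (√γ₁ * (K : ℝ) ^ (-β))) :=
          mul_le_mul_of_nonneg_left h2 (by positivity)
      _ = ε * √γ₁ * ((K : ℝ) ^ β * (K : ℝ) ^ (-β)) := by ring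
      _ = ε * √γ₁ := by rw [rpow_mul_rpow_neg, mul_one]
  have hsnd : |(rescaledError P α γ₁ β X ξs ξ₀ x K ω -
      linearPart α γ₁ β (f (some K) m / (1 - α)) m V₀ (fun k => x K k ω) K) 1| ≤ ε := by
    have h4 : √(((K : ℕ) ^ 2 : ℕ) : ℝ) = K := by
      push_cast; exact Real.sqrt_sq hK0.le
    rw [h4, Finset.sum_sub_distrib, ← mul_iterate_snd] at h3
    simp only [rescaledError, linearPart, finalIterate, PiLp.sub_apply, Matrix.cons_val_one,
      Matrix.cons_val_fin_one, ceil_bias_zpow, inv_bias]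
    refine le_of_mul_le_mul_left (le_trans (le_of_eq ?_) (h3.trans (le_of_eq (mul_comm _ _)))) hK0
    rw [← abs_of_pos hK0, ← abs_mul, abs_of_pos hK0]
    congr 1
    push_cast
    field_simp
    rfl
  have hfin : ε * √γ₁ + ε < η := by
    have h4 : ε * (2 * (√γ₁ + 1)) ≤ η :=
      (le_div_iff₀ (by positivity)).1 (min_le_right _ _)
    nlinarith [mul_nonneg hε0.le hsγ]
  linarith [hnorm (rescaledError P α γ₁ β X ξs ξ₀ x K ω -
    linearPart α γ₁ β (f (some K) m / (1 - α)) m V₀ (fun k => x K k ω) K)]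

lemma measurable_iterate (α : ℝ) (γ : ℕ → ℝ) {ξ₀ : Ω → ℝ} {x : ℕ → Ω → ℝ} (hξ₀ : Measurable ξ₀)
    (hx : ∀ k, Measurable (x k)) (n : ℕ) :
    Measurable fun ω => iterate α γ (ξ₀ ω) (fun k => x k ω) n := by
  induction n with
  | zero => exact hξ₀.prodMk measurable_const
  | succ n ih =>
    have h1 := (measurable_H₁ α).comp (ih.fst.prodMk (hx n))
    have h2 := hx n
    have h3 := ih.fst
    have h4 := ih.snd
    simp only [iterate]
    refine (h3.sub (h1.const_mul _)).prodMk (h4.sub (Measurable.const_mul ?_ _))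
    unfold H₂
    fun_prop

lemma measurable_rescaledError {X : Option ℕ+ → Ω → ℝ} {ξs : Option ℕ+ → ℝ} {ξ₀ : ℕ+ → Ω → ℝ}
    {x : ℕ+ → ℕ → Ω → ℝ} (hx : IsInnovation P X ξ₀ x) (K : ℕ+) :
    Measurable (rescaledError P α γ₁ β X ξs ξ₀ x K) := by
  have h1 := measurable_iterate α (stepSize γ₁ β) (hx.measurable_init K) (hx.measurable K)
    ⌈bias K ^ (-2 : ℤ)⌉₊
  unfold rescaledError finalIterate
  refine (WithLp.measurable_toLp 2 _).comp (measurable_pi_iff.2 fun i => ?_)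
  fin_cases i
  · exact (h1.fst.sub_const _).const_mul _
  · exact (h1.snd.sub_const _).const_mul _

end Limit

lemma isHermitian_limitCov {Ω : Type*} [MeasurableSpace Ω] (P : Measure Ω) (α γ₁ β : ℝ)
    (X : Ω → ℝ) (f : ℝ → ℝ) : (limitCov P α γ₁ β X f).IsHermitian := by
  refine Matrix.IsHermitian.ext fun i j => ?_
  fin_cases i <;> fin_cases j <;> simp [limitCov]

/-- The condition on `λ` implies the condition on the linear rate that governs the case `β = 1`. -/
lemma lam_le {Ω : Type*} [MeasurableSpace Ω] {P : Measure Ω} [IsProbabilityMeasure P] {α : ℝ}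
    (hα₁ : α < 1) {X : Option ℕ+ → Ω → ℝ} {f : Option ℕ+ → ℝ → ℝ}
    (hf : ∀ i, IsContinuousPdf P (X i) (f i)) (hX : ∀ i, Measurable (X i))
    (hi : ∀ i, Integrable (X i) P) (ξs : Option ℕ+ → ℝ) (i : Option ℕ+) :
    lam P α X ξs ≤ f i (ξs i) / (1 - α) := by
  have h1α : 0 < 1 - α := by linarith
  have h0 : ∀ i, 0 ≤ f i (ξs i) / (1 - α) := fun i => div_nonneg ((hf i).nonneg _) h1α.le
  have hs : ∀ g : ℝ → ℝ, 0 ≤ supNorm g := fun g => Real.iSup_nonneg fun x => abs_nonneg _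
  refine (ciInf_le ⟨0, ?_⟩ i).trans ((min_le_left _ _).trans ?_)
  · rintro _ ⟨j, rfl⟩
    refine le_min ?_ (mul_nonneg (hs _) (div_nonneg (Even.pow_nonneg ⟨2, rfl⟩ _) (by positivity)))
    rw [(hf j).deriv_deriv_V (hX j) (hi j) hα₁]
    exact mul_nonneg (by norm_num) (h0 j)
  · rw [(hf i).deriv_deriv_V (hX i) (hi i) hα₁]
    linarith [h0 i]

end NestedSA

theorem theorem1p3 {Ω : Type*} [MeasurableSpace Ω] (P : Measure Ω) [IsProbabilityMeasure P]
    {d q : ℕ} (Y : Ω → EuclideanSpace ℝ (Fin d)) (Z : Ω → EuclideanSpace ℝ (Fin q))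
    (Zs : ℕ → Ω → EuclideanSpace ℝ (Fin q))
    (φ : EuclideanSpace ℝ (Fin d) × EuclideanSpace ℝ (Fin q) → ℝ) (hφ : Measurable φ)
    (hS : IsSampling P Y Z Zs)
    (δ : ℝ) (hδ : 0 < δ) (hmom : Integrable (fun ω => |φ (Y ω, Z ω)| ^ (2 + δ)) P)
    (α : ℝ) (hα₀ : 0 < α) (hα₁ : α < 1)
    (f : Option ℕ+ → ℝ → ℝ) (v : ℝ → ℝ) (w : ℝ → ℝ → ℝ)
    (hreg : Regularity P α (loss P φ Y Z Zs) f v w)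
    (ξs : Option ℕ+ → ℝ) (hξs₀ : ξs none = VaR P α (loss P φ Y Z Zs none))
    (hξs : ∀ K : ℕ+, IsMinOn (V P α (loss P φ Y Z Zs (some K))) Set.univ (ξs (some K)))
    (ξ₀ : ℕ+ → Ω → ℝ) (Xs : ℕ+ → ℕ → Ω → ℝ)
    (hinn : IsInnovation P (loss P φ Y Z Zs) ξ₀ Xs)
    (hinit : InitialMoment P α f ξ₀)
    (γ₁ β : ℝ) (hγ₁ : 0 < γ₁) (hβ₀ : 1 / 2 < β) (hβ₁ : β ≤ 1)
    (hlam : β = 1 → 1 < lam P α (loss P φ Y Z Zs) ξs * γ₁) :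
    (limitCov P α γ₁ β (loss P φ Y Z Zs none) (f none)).PosSemidef ∧
    TendstoInDistribution (rescaledError P α γ₁ β (loss P φ Y Z Zs) ξs ξ₀ Xs) atTop
      (id : EuclideanSpace ℝ (Fin 2) → EuclideanSpace ℝ (Fin 2)) (fun _ => P)
      (multivariateGaussian 0 (limitCov P α γ₁ β (loss P φ Y Z Zs none) (f none))) := by
  set X := loss P φ Y Z Zs with hXdef
  -- it suffices to use moments of order `2 + δ'` with `δ' ≤ 1`
  set δ' := min δ 1 with hδ'
  have hδ'₀ : 0 < δ' := lt_min hδ one_pos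
  have hδ'₁ : δ' ≤ 1 := min_le_right _ _
  have hφm : Measurable fun ω => φ (Y ω, Z ω) := hφ.comp (hS.measurable_Y.prodMk hS.measurable_Z)
  have hmom' : Integrable (fun ω => |φ (Y ω, Z ω)| ^ (2 + δ')) P := by
    refine ((integrable_const 1).add hmom).mono' (hφm.abs.pow_const _).aestronglyMeasurable
      (ae_of_all _ fun ω => ?_)
    rw [Real.norm_of_nonneg (by positivity), Pi.add_apply]
    rcases le_total 1 |φ (Y ω, Z ω)| with h | h
    · have h2 := Real.rpow_le_rpow_of_exponent_le h
        (show 2 + δ' ≤ 2 + δ by linarith [min_le_left δ 1])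
      linarith
    · have h2 := Real.rpow_le_one (abs_nonneg _) h (show 0 ≤ 2 + δ' by linarith)
      have h3 : 0 ≤ |φ (Y ω, Z ω)| ^ (2 + δ) := by positivity
      linarith
  have hX : ∀ i, Measurable (X i) := measurable_loss hS hφ
  have hXm := loss_moment hS hφ (show 1 ≤ 2 + δ' by linarith) hmom'
  have hXi : ∀ i, Integrable (X i) P := fun i =>
    integrable_of_integrable_sq (hX i).aestronglyMeasurable
      (integrable_sq_of_integrable_rpow (hX i) hδ'₀ (hXm i).1)
  have hpos : ∀ i y, 0 < f i y := fun i y => by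
    obtain ⟨c, hc, hcf⟩ := hreg.pdf_lower (|y - VaR P α (X none)| + 1) (by positivity)
    exact hc.trans_le (hcf i y (by rw [Metric.mem_ball, Real.dist_eq]; linarith))
  obtain ⟨B, hB⟩ := hreg.pdf_bounded
  obtain ⟨L, hL⟩ := hreg.pdf_lipschitz
  have hcdf₀ : cdfOf P (X none) (ξs none) = α := by
    rw [hξs₀]; exact (hreg.pdf none).cdfOf_VaR (hX none) (hpos none) hα₀ hα₁
  have hlaws : ConvergingLaws P α δ' B (max L 1) (∫ ω, |φ (Y ω, Z ω)| ^ (2 + δ') ∂P) atTop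
      (fun K : ℕ+ => X (some K)) (fun K => f (some K)) (fun K => ξs (some K)) (X none) (f none)
      (ξs none) :=
    { pdf := fun K => hreg.pdf (some K)
      pdf₀ := hreg.pdf none
      measurable := fun K => hX (some K)
      measurable₀ := hX none
      abs_pdf_le := fun K => hB (some K)
      lipschitz := fun K y z => (hL (some K) y z).trans
        (mul_le_mul_of_nonneg_right (le_max_left _ _) (abs_nonneg _))
      tendsto_pdf := fun y =>
        (tendstoLocallyUniformlyOn_univ.2 hreg.tendsto_pdf).tendsto_at (Set.mem_univ y)
      pos₀ := hpos none
      integrable := fun K => (hXm (some K)).1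
      integrable₀ := (hXm none).1
      moment_le := fun K => (hXm (some K)).2
      moment_le₀ := (hXm none).2
      cdfOf_eq := fun K =>
        (hreg.pdf (some K)).cdfOf_eq_of_isMinOn (hX (some K)) (hXi (some K)) hα₁ (hξs K)
      cdfOf_eq₀ := hcdf₀ }
  have hrate : β = 1 → 1 < f none (ξs none) / (1 - α) * γ₁ := fun h =>
    (hlam h).trans_le (mul_le_mul_of_nonneg_right (lam_le hα₁ hreg.pdf hX hXi ξs none) hγ₁.le)
  have hchar := hlaws.tendsto_charFun_linearPart hδ'₀ hδ'₁ hα₀ hα₁ hγ₁ (by linarith) hβ₁ hrate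
    hinn.measurable hinn.identDistrib hinn.indep
  have hpsd : (limitCov P α γ₁ β (X none) (f none)).PosSemidef :=
    Matrix.PosSemidef.of_dotProduct_mulVec_nonneg (isHermitian_limitCov _ _ _ _ _ _) fun y => by
      simpa using (hchar (WithLp.toLp 2 y)).1
  refine ⟨hpsd, ?_⟩
  have hlin := tendstoInDistribution_of_tendsto_charFun (fun K => measurable_linearPart α γ₁ β
    (f (some K) (ξs (some K)) / (1 - α)) (ξs (some K)) (V P α (X (some K)) (ξs (some K)))
    (hinn.measurable K) K) (multivariateGaussian 0 (limitCov P α γ₁ β (X none) (f none)))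
    fun t => by
      have h2 := (hchar t).2
      rw [charFun_multivariateGaussian hpsd, inner_zero_right, Complex.ofReal_zero, zero_mul,
        zero_sub, ← neg_div]
      exact h2
  obtain ⟨c, hc, hcf⟩ := hreg.pdf_lower 2 two_pos
  obtain ⟨S, hS'⟩ := exists_integral_init_sq_le hα₁ hinn.measurable_init hinit
  refine tendstoInDistribution_of_tendstoInMeasure_sub _ _ hlin
    (hlaws.tendstoInMeasure_rescaledError hδ'₀ hα₁ hγ₁ hβ₀ hβ₁ hrate
      (lt_max_of_lt_right one_pos) hc ?_ hinn hS')
    fun K => (measurable_rescaledError hinn K).aemeasurable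
  filter_upwards [Metric.tendsto_nhds.1 (hlaws.tendsto_quantile hδ'₀) 1 one_pos] with K hK y hy
  refine hcf _ _ ?_
  rw [← hξs₀, Metric.mem_ball]
  calc dist y (ξs none) ≤ dist y (ξs (some K)) + dist (ξs (some K)) (ξs none) := dist_triangle _ _ _
    _ < 2 := by rw [Real.dist_eq y]; linarith
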